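/- Quadratic forms are integral and positive definite, and are identified with their Gram matrices (symmetric positive definite matrices with entries in $\mathbb Z$). A form $f$ of rank $n$ represents a form $g$ of rank $m$ if $T^tfT=g$ for some $T\in M_{n,m}(\mathbb Z)$; the forms are isometric if $m=n$ and such a $T$ can be chosen in $GL_n(\mathbb Z)$. A proper subform of $f$ is a form (of any rank) that is represented by $f$ and not isometric to $f$. An isolation of $f$ is a form that represents all proper subforms of $f$ but not $f$ itself. Let $I_2=x^2+y^2$, identified with the lattice $\mathbb Z^2$ with the standard inner product. **Theorem.** Consider the quinary forms $$\langle 1\rangle\perp\begin{pmatrix}2&0&a_1&b_1\\0&2&a_2&b_2\\a_1&a_2&a_3&b_3\\b_1&b_2&b_3&b_4\end{pmatrix},$$ where $(a_1,a_2,a_3)$ and $(b_1,b_2,b_3,b_4)$ run over the following 231 choices (the number of quadruples is given in parentheses after each triple): - $(a_1,a_2,a_3)=(1,1,2)$ (3): $(1,0,0,3)$, $(0,0,0,3)$, $(1,-1,0,5)$ - $(a_1,a_2,a_3)=(0,1,2)$ (15): $(1,1,0,3)$, $(0,0,1,3)$, $(1,0,0,3)$, $(0,0,0,3)$, $(1,1,0,5)$,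 $(0,1,0,5)$, $(1,0,0,5)$, $(0,0,0,5)$, $(1,1,0,7)$, $(0,1,0,7)$, $(1,0,0,7)$, $(0,0,0,7)$, $(1,1,0,9)$, $(0,1,0,9)$, $(0,0,0,9)$ - $(a_1,a_2,a_3)=(0,0,2)$ (4): $(0,1,1,3)$, $(0,0,1,3)$, $(0,1,1,5)$, $(1,0,0,5)$ - $(a_1,a_2,a_3)=(1,1,3)$ (4): $(1,-1,0,4)$, $(1,0,0,4)$, $(1,-1,1,5)$, $(1,-1,0,5)$ - $(a_1,a_2,a_3)=(0,1,3)$ (52): $(1,1,0,3)$, $(1,0,1,3)$, $(0,1,0,3)$, $(1,0,0,3)$, $(0,0,1,3)$, $(1,1,0,4)$, $(0,1,0,4)$, $(1,0,0,4)$, $(0,0,1,4)$, $(1,1,0,5)$, $(0,0,0,4)$, $(1,0,1,5)$, $(0,1,0,5)$, $(0,0,1,5)$, $(1,1,0,6)$, $(1,0,0,6)$, $(0,0,1,6)$, $(1,1,0,7)$, $(0,0,0,6)$, $(1,0,1,7)$, $(0,1,0,7)$, $(1,0,0,7)$, $(0,0,1,7)$, $(1,1,0,8)$, $(0,0,0,7)$,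 $(1,0,1,8)$, $(0,0,1,8)$, $(0,0,0,8)$, $(1,0,1,9)$, $(0,1,0,9)$, $(1,0,0,9)$, $(0,0,1,9)$, $(1,1,0,10)$, $(0,0,0,9)$, $(0,1,0,10)$, $(0,0,1,10)$, $(0,0,0,10)$, $(1,0,1,11)$, $(0,1,0,11)$, $(1,0,0,11)$, $(0,0,1,11)$, $(1,1,0,12)$, $(1,0,1,12)$, $(0,1,0,12)$, $(0,0,1,12)$, $(1,1,0,13)$, $(1,0,1,13)$, $(0,1,0,13)$, $(1,0,0,13)$, $(1,0,1,4)$, $(1,0,0,5)$, $(1,1,0,9)$ - $(a_1,a_2,a_3)=(0,0,3)$ (4): $(1,0,0,4)$, $(1,1,0,5)$, $(1,0,0,5)$, $(0,1,1,5)$ - $(a_1,a_2,a_3)=(1,1,4)$ (6): $(1,-1,2,5)$, $(1,-1,0,5)$, $(1,0,0,5)$, $(1,-1,2,7)$, $(0,0,0,5)$, $(1,-1,1,5)$ - $(a_1,a_2,a_3)=(0,1,4)$ (22): $(0,-1,2,5)$, $(1,1,2,5)$, $(0,1,2,5)$, $(1,1,0,5)$, $(1,0,1,5)$, $(0,1,0,5)$,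 $(1,0,0,5)$, $(0,0,1,5)$, $(0,0,0,5)$, $(1,1,2,7)$, $(0,1,2,7)$, $(1,1,0,7)$, $(1,0,1,7)$, $(0,1,0,7)$, $(1,0,0,7)$, $(0,0,1,7)$, $(1,1,2,9)$, $(0,1,2,9)$, $(1,1,0,9)$, $(0,1,0,9)$, $(1,0,0,9)$, $(0,0,0,9)$ - $(a_1,a_2,a_3)=(0,0,4)$ (3): $(1,1,0,5)$, $(1,0,0,5)$, $(1,1,2,5)$ - $(a_1,a_2,a_3)=(1,1,5)$ (111): $(-1,-1,2,5)$, $(-1,-1,2,6)$, $(1,-1,1,5)$, $(-1,-1,2,7)$, $(1,-1,0,5)$, $(1,-1,2,6)$, $(1,-1,1,6)$, $(0,0,1,5)$, $(1,0,2,6)$, $(1,-1,0,6)$, $(1,-1,2,7)$, $(0,0,0,5)$, $(1,0,0,6)$, $(1,-1,1,7)$, $(0,0,1,6)$, $(1,0,2,7)$, $(1,-1,2,8)$, $(1,0,0,7)$, $(1,-1,1,8)$, $(0,0,1,7)$, $(1,-1,2,9)$, $(0,0,0,7)$, $(1,0,0,8)$, $(1,-1,1,9)$, $(1,0,2,9)$,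 $(1,-1,0,9)$, $(1,-1,2,10)$, $(0,0,0,8)$, $(1,0,0,9)$, $(1,-1,1,10)$, $(0,0,1,9)$, $(1,0,2,10)$, $(0,0,0,9)$, $(1,0,0,10)$, $(0,0,1,10)$, $(1,0,2,11)$, $(1,0,0,11)$, $(1,-1,1,12)$, $(0,0,1,11)$, $(1,0,2,12)$, $(1,-1,0,12)$, $(1,-1,2,13)$, $(1,0,0,12)$, $(1,-1,1,13)$, $(1,0,2,13)$, $(1,-1,0,13)$, $(1,-1,2,14)$, $(0,0,0,12)$, $(1,0,0,13)$, $(1,-1,1,14)$, $(0,0,1,13)$, $(1,0,2,14)$, $(1,-1,0,14)$, $(1,0,0,14)$, $(0,0,1,14)$, $(1,0,2,15)$, $(1,-1,2,16)$, $(1,-1,1,16)$, $(0,0,1,15)$, $(1,0,2,16)$, $(1,-1,2,17)$, $(0,0,0,15)$, $(1,0,0,16)$, $(1,-1,1,17)$, $(1,0,2,17)$, $(1,-1,0,17)$, $(1,-1,2,18)$, $(0,0,0,16)$, $(1,0,0,17)$, $(1,-1,1,18)$, $(0,0,1,17)$, $(1,0,2,18)$, $(1,-1,0,18)$, $(0,0,0,17)$,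 $(1,0,0,18)$, $(0,0,1,18)$, $(1,0,2,19)$, $(1,0,0,19)$, $(1,-1,1,20)$, $(1,0,2,20)$, $(1,-1,0,20)$, $(1,-1,2,21)$, $(1,0,0,20)$, $(1,-1,1,21)$, $(1,0,2,21)$, $(1,-1,0,21)$, $(1,-1,2,22)$, $(0,0,0,20)$, $(1,0,0,21)$, $(1,-1,1,22)$, $(0,0,1,21)$, $(1,0,2,22)$, $(1,-1,0,22)$, $(0,0,0,21)$, $(1,0,0,22)$, $(0,0,1,22)$, $(1,0,2,23)$, $(1,-1,2,24)$, $(1,0,0,23)$, $(1,-1,1,24)$, $(0,0,1,23)$, $(1,0,2,24)$, $(1,-1,2,25)$, $(0,0,0,23)$, $(1,-1,1,25)$, $(1,0,2,25)$, $(1,-1,0,25)$, $(0,0,2,25)$, $(1,0,0,25)$, $(0,0,1,25)$, $(0,0,0,25)$ - $(a_1,a_2,a_3)=(0,1,5)$ (7): $(1,1,2,5)$, $(1,1,0,5)$, $(0,0,2,5)$, $(0,1,0,5)$, $(1,0,0,5)$, $(0,0,1,5)$, $(0,0,0,5)$ All of these are positive definite, and the following hold. 1. Every quinary isolation of $I_2$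 is isometric to one of these 231 forms. In particular, up to isometry there are at most 231 quinary isolations of $I_2$. 2. A quinary form represents every proper sublattice of $I_2$ of index $q\le 29$ but does not represent $I_2$ if and only if it is isometric to one of these 231 forms. Up to isometry there are exactly 231 such forms (so the listed forms are pairwise non-isometric). -/

import Mathlib

namespace QuadIsolation

open Matrix

/-- `M` is the Gram matrix of an integral, positive definite quadratic form of rank `n`:
the entries are integers, and `M` is symmetric and positive definite over `ℝ`. -/
def IsForm {n : ℕ} (M : Matrix (Fin n) (Fin n) ℤ) : Prop :=
  (M.map (Int.cast : ℤ → ℝ)).PosDef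

/-- The form `f` of rank `n` represents the form `g` of rank `m`:
there is an integral `n × m` matrix `T` with `Tᵀ f T = g`. -/
def Represents {n m : ℕ} (f : Matrix (Fin n) (Fin n) ℤ) (g : Matrix (Fin m) (Fin m) ℤ) : Prop :=
  ∃ T : Matrix (Fin n) (Fin m) ℤ, Tᵀ * f * T = g

/-- Isometry of forms: a representation by an invertible integral matrix. -/
def Isometric {n m : ℕ} (f : Matrix (Fin n) (Fin n) ℤ) (g : Matrix (Fin m) (Fin m) ℤ) : Prop :=
  ∃ (T : Matrix (Fin n) (Fin m) ℤ) (S : Matrix (Fin m) (Fin n) ℤ),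
    T * S = 1 ∧ S * T = 1 ∧ Tᵀ * f * T = g

/-- `g` is a proper subform of `f`: a form represented by `f` and not isometric to `f`. -/
def IsProperSubform {n m : ℕ} (g : Matrix (Fin m) (Fin m) ℤ) (f : Matrix (Fin n) (Fin n) ℤ) :
    Prop :=
  IsForm g ∧ Represents f g ∧ ¬ Isometric f g

/-- `L` is an isolation of `f` (from its proper subforms): a form that represents all proper
subforms of `f`, of every rank, but not `f` itself. -/
def IsIsolation {k n : ℕ} (L : Matrix (Fin k) (Fin k) ℤ) (f : Matrix (Fin n) (Fin n) ℤ) : Prop :=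
  IsForm L ∧
    (∀ (m : ℕ) (g : Matrix (Fin m) (Fin m) ℤ), IsProperSubform g f → Represents L g) ∧
    ¬ Represents L f

/-- The sum of two squares `x ^ 2 + y ^ 2`. -/
def I2 : Matrix (Fin 2) (Fin 2) ℤ := 1

/-- `L` represents all proper sublattices of `I2 = ℤ²` of index at most `N`, but not `I2`.
A sublattice of finite index is spanned by the columns of an integral matrix `S` with
`det S ≠ 0`; its index is `|det S|` and its Gram matrix is `Sᵀ I2 S`. -/
def IsCandidate {k : ℕ} (N : ℕ) (L : Matrix (Fin k) (Fin k) ℤ) : Prop :=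
  IsForm L ∧
    (∀ S : Matrix (Fin 2) (Fin 2) ℤ, 1 < S.det.natAbs → S.det.natAbs ≤ N →
      Represents L (Sᵀ * I2 * S)) ∧
    ¬ Represents L I2

theorem Isometric.refl {n : ℕ} (f : Matrix (Fin n) (Fin n) ℤ) : Isometric f f :=
  ⟨1, 1, by simp, by simp, by simp⟩

theorem Isometric.symm {n m : ℕ} {f : Matrix (Fin n) (Fin n) ℤ} {g : Matrix (Fin m) (Fin m) ℤ}
    (h : Isometric f g) : Isometric g f := by
  obtain ⟨T, S, hTS, hST, rfl⟩ := h
  refine ⟨S, T, hST, hTS, ?_⟩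
  calc Sᵀ * (Tᵀ * f * T) * S = (T * S)ᵀ * f * (T * S) := by
        simp only [Matrix.transpose_mul, Matrix.mul_assoc]
    _ = f := by simp [hTS]

theorem Isometric.trans {n m l : ℕ} {f : Matrix (Fin n) (Fin n) ℤ}
    {g : Matrix (Fin m) (Fin m) ℤ} {h : Matrix (Fin l) (Fin l) ℤ}
    (hfg : Isometric f g) (hgh : Isometric g h) : Isometric f h := by
  obtain ⟨T, S, hTS, hST, rfl⟩ := hfg
  obtain ⟨U, V, hUV, hVU, rfl⟩ := hgh
  refine ⟨T * U, V * S, ?_, ?_, ?_⟩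
  · calc T * U * (V * S) = T * (U * V) * S := by simp only [Matrix.mul_assoc]
      _ = 1 := by simp [hUV, hTS]
  · calc V * S * (T * U) = V * (S * T) * U := by simp only [Matrix.mul_assoc]
      _ = 1 := by simp [hST, hVU]
  · simp only [Matrix.transpose_mul, Matrix.mul_assoc]

/-- Isometry as an equivalence relation on the integral positive definite forms of rank `n`. -/
def isometrySetoid (n : ℕ) : Setoid {M : Matrix (Fin n) (Fin n) ℤ // IsForm M} where
  r f g := Isometric f.1 g.1
  iseqv := ⟨fun f => Isometric.refl f.1, fun h => h.symm, fun h h' => h.trans h'⟩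

/-- Isometry classes of integral positive definite forms of rank `n`. -/
def IsometryClass (n : ℕ) : Type := Quotient (isometrySetoid n)

/-- The set of isometry classes of forms of rank `n` with the property `P`. -/
def classesOf {n : ℕ} (P : Matrix (Fin n) (Fin n) ℤ → Prop) : Set (IsometryClass n) :=
  {c | ∃ f : {M : Matrix (Fin n) (Fin n) ℤ // IsForm M},
    P f.1 ∧ Quotient.mk (isometrySetoid n) f = c}

/-- The Gram matrix of the orthogonal sum of `⟨1⟩` and the quaternary lattice with Gram rows
`(2,0,a₁,b₁), (0,2,a₂,b₂), (a₁,a₂,a₃,b₃), (b₁,b₂,b₃,b₄)`. -/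
def gram (a : ℤ × ℤ × ℤ) (b : ℤ × ℤ × ℤ × ℤ) : Matrix (Fin 5) (Fin 5) ℤ :=
  !![1, 0, 0, 0, 0;
     0, 2, 0, a.1, b.1;
     0, 0, 2, a.2.1, b.2.1;
     0, a.1, a.2.1, a.2.2, b.2.2.1;
     0, b.1, b.2.1, b.2.2.1, b.2.2.2]

/-- The table of candidates: each row consists of a triple `(a₁, a₂, a₃)` and the list of the
quadruples `(b₁, b₂, b₃, b₄)` that go with it. -/
def table : List ((ℤ × ℤ × ℤ) × List (ℤ × ℤ × ℤ × ℤ)) := [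
  ((1, 1, 2), [
    (1, 0, 0, 3), (0, 0, 0, 3), (1, -1, 0, 5)]),
  ((0, 1, 2), [
    (1, 1, 0, 3), (0, 0, 1, 3), (1, 0, 0, 3), (0, 0, 0, 3), (1, 1, 0, 5),
    (0, 1, 0, 5), (1, 0, 0, 5), (0, 0, 0, 5), (1, 1, 0, 7), (0, 1, 0, 7),
    (1, 0, 0, 7), (0, 0, 0, 7), (1, 1, 0, 9), (0, 1, 0, 9), (0, 0, 0, 9)]),
  ((0, 0, 2), [
    (0, 1, 1, 3), (0, 0, 1, 3), (0, 1, 1, 5), (1, 0, 0, 5)]),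
  ((1, 1, 3), [
    (1, -1, 0, 4), (1, 0, 0, 4), (1, -1, 1, 5), (1, -1, 0, 5)]),
  ((0, 1, 3), [
    (1, 1, 0, 3), (1, 0, 1, 3), (0, 1, 0, 3), (1, 0, 0, 3), (0, 0, 1, 3),
    (1, 1, 0, 4), (0, 1, 0, 4), (1, 0, 0, 4), (0, 0, 1, 4), (1, 1, 0, 5),
    (0, 0, 0, 4), (1, 0, 1, 5), (0, 1, 0, 5), (0, 0, 1, 5), (1, 1, 0, 6),
    (1, 0, 0, 6), (0, 0, 1, 6), (1, 1, 0, 7), (0, 0, 0, 6), (1, 0, 1, 7),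
    (0, 1, 0, 7), (1, 0, 0, 7), (0, 0, 1, 7), (1, 1, 0, 8), (0, 0, 0, 7),
    (1, 0, 1, 8), (0, 0, 1, 8), (0, 0, 0, 8), (1, 0, 1, 9), (0, 1, 0, 9),
    (1, 0, 0, 9), (0, 0, 1, 9), (1, 1, 0, 10), (0, 0, 0, 9), (0, 1, 0, 10),
    (0, 0, 1, 10), (0, 0, 0, 10), (1, 0, 1, 11), (0, 1, 0, 11), (1, 0, 0, 11),
    (0, 0, 1, 11), (1, 1, 0, 12), (1, 0, 1, 12), (0, 1, 0, 12), (0, 0, 1, 12),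
    (1, 1, 0, 13), (1, 0, 1, 13), (0, 1, 0, 13), (1, 0, 0, 13), (1, 0, 1, 4),
    (1, 0, 0, 5), (1, 1, 0, 9)]),
  ((0, 0, 3), [
    (1, 0, 0, 4), (1, 1, 0, 5), (1, 0, 0, 5), (0, 1, 1, 5)]),
  ((1, 1, 4), [
    (1, -1, 2, 5), (1, -1, 0, 5), (1, 0, 0, 5), (1, -1, 2, 7), (0, 0, 0, 5),
    (1, -1, 1, 5)]),
  ((0, 1, 4), [
    (0, -1, 2, 5), (1, 1, 2, 5), (0, 1, 2, 5), (1, 1, 0, 5), (1, 0, 1, 5),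
    (0, 1, 0, 5), (1, 0, 0, 5), (0, 0, 1, 5), (0, 0, 0, 5), (1, 1, 2, 7),
    (0, 1, 2, 7), (1, 1, 0, 7), (1, 0, 1, 7), (0, 1, 0, 7), (1, 0, 0, 7),
    (0, 0, 1, 7), (1, 1, 2, 9), (0, 1, 2, 9), (1, 1, 0, 9), (0, 1, 0, 9),
    (1, 0, 0, 9), (0, 0, 0, 9)]),
  ((0, 0, 4), [
    (1, 1, 0, 5), (1, 0, 0, 5), (1, 1, 2, 5)]),
  ((1, 1, 5), [
    (-1, -1, 2, 5), (-1, -1, 2, 6), (1, -1, 1, 5), (-1, -1, 2, 7), (1, -1, 0, 5),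
    (1, -1, 2, 6), (1, -1, 1, 6), (0, 0, 1, 5), (1, 0, 2, 6), (1, -1, 0, 6),
    (1, -1, 2, 7), (0, 0, 0, 5), (1, 0, 0, 6), (1, -1, 1, 7), (0, 0, 1, 6),
    (1, 0, 2, 7), (1, -1, 2, 8), (1, 0, 0, 7), (1, -1, 1, 8), (0, 0, 1, 7),
    (1, -1, 2, 9), (0, 0, 0, 7), (1, 0, 0, 8), (1, -1, 1, 9), (1, 0, 2, 9),
    (1, -1, 0, 9), (1, -1, 2, 10), (0, 0, 0, 8), (1, 0, 0, 9), (1, -1, 1, 10),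
    (0, 0, 1, 9), (1, 0, 2, 10), (0, 0, 0, 9), (1, 0, 0, 10), (0, 0, 1, 10),
    (1, 0, 2, 11), (1, 0, 0, 11), (1, -1, 1, 12), (0, 0, 1, 11), (1, 0, 2, 12),
    (1, -1, 0, 12), (1, -1, 2, 13), (1, 0, 0, 12), (1, -1, 1, 13), (1, 0, 2, 13),
    (1, -1, 0, 13), (1, -1, 2, 14), (0, 0, 0, 12), (1, 0, 0, 13), (1, -1, 1, 14),
    (0, 0, 1, 13), (1, 0, 2, 14), (1, -1, 0, 14), (1, 0, 0, 14), (0, 0, 1, 14),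
    (1, 0, 2, 15), (1, -1, 2, 16), (1, -1, 1, 16), (0, 0, 1, 15), (1, 0, 2, 16),
    (1, -1, 2, 17), (0, 0, 0, 15), (1, 0, 0, 16), (1, -1, 1, 17), (1, 0, 2, 17),
    (1, -1, 0, 17), (1, -1, 2, 18), (0, 0, 0, 16), (1, 0, 0, 17), (1, -1, 1, 18),
    (0, 0, 1, 17), (1, 0, 2, 18), (1, -1, 0, 18), (0, 0, 0, 17), (1, 0, 0, 18),
    (0, 0, 1, 18), (1, 0, 2, 19), (1, 0, 0, 19), (1, -1, 1, 20), (1, 0, 2, 20),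
    (1, -1, 0, 20), (1, -1, 2, 21), (1, 0, 0, 20), (1, -1, 1, 21), (1, 0, 2, 21),
    (1, -1, 0, 21), (1, -1, 2, 22), (0, 0, 0, 20), (1, 0, 0, 21), (1, -1, 1, 22),
    (0, 0, 1, 21), (1, 0, 2, 22), (1, -1, 0, 22), (0, 0, 0, 21), (1, 0, 0, 22),
    (0, 0, 1, 22), (1, 0, 2, 23), (1, -1, 2, 24), (1, 0, 0, 23), (1, -1, 1, 24),
    (0, 0, 1, 23), (1, 0, 2, 24), (1, -1, 2, 25), (0, 0, 0, 23), (1, -1, 1, 25),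
    (1, 0, 2, 25), (1, -1, 0, 25), (0, 0, 2, 25), (1, 0, 0, 25), (0, 0, 1, 25),
    (0, 0, 0, 25)]),
  ((0, 1, 5), [
    (1, 1, 2, 5), (1, 1, 0, 5), (0, 0, 2, 5), (0, 1, 0, 5), (1, 0, 0, 5),
    (0, 0, 1, 5), (0, 0, 0, 5)])]

/-- The Gram matrices of the lattices in the table. -/
def tableGrams : List (Matrix (Fin 5) (Fin 5) ℤ) :=
  table.flatMap fun row => row.2.map fun b => gram row.1 b

end QuadIsolation

/-! Call a quinary form `L` a candidate if it represents all sublattices of `ℤ²` of index 2 to 29,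
but not `I2`. From index 2, `L` represents `⟨1, 4⟩` and `⟨2, 2⟩`. The first gives a unit vector `e`,
and its complement `K` contains no unit vector, as otherwise `L` would represent `I2`. A vector of
norm 2 must then lie in `K`, so `K` contains an orthogonal pair `v₁, v₂` of norm 2 (`exists_frame`).

The rest of the classification is escalation. `⟨1⟩ ⊥ ⟨2, 2⟩` misses the sublattice with Gram entries
`(2, 1, 5)` of index 3, so `K` has a vector of norm at most 5 outside the plane of `v₁, v₂`. A
suitable shortest such vector `v₃` has inner products 0 or 1 with `v₁, v₂` and spans a saturated
sublattice with them (`Frame.exists_flag`); this leaves twelve ternary Gram matrices. For each of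
them, `⟨1⟩ ⊥` ternary again misses some sublattice of index at most 29, hence there is a new vector
`w` of bounded norm. Saturation turns `w` into a fourth basis vector `v₄`, and the norm of `w`
bounds the determinant of `K` (`Flag.exists_basis`). With the inner products of `v₄` reduced modulo
the ternary lattice, finitely many Gram matrices remain. Each one is in the table, can be moved into
it by a change of basis, has a vector contradicting the minimality of `v₃`, or misses a listed
sublattice (`forall_isClassified`, `IsCandidate.exists_isometric`).

Conversely, every sublattice of index 2 to 29 lies in one of prime index at most 29. Up to Gauss
reduction these give a short list of binary forms, and explicit vectors representing them are
verified for every entry of the table (`covers_correct`). Many of these representations use only a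
ternary sublattice common to many entries. That the entries do not represent `I2` is settled by a
complete search (`reps_iff`). They are pairwise non-isometric because their determinants, or the
answers for one of eight binary forms, differ.

A sublattice of index greater than 1 has determinant different from 1 and so is a proper subform of
`I2`. Hence isolations are candidates, which gives the bound 231. -/

namespace QuadIsolation

open Matrix

/-! ### Integer square roots and bounded enumeration -/

/-- `withNat n f = f n`, arranged so that the kernel evaluates `n` to a literal first. -/
def withNat {β : Type*} (n : ℕ) (f : ℕ → β) : β :=
  match n with
  | 0 => f 0
  | k + 1 => f (Nat.succ k)

/-- `withInt z f = f z`, arranged so that the kernel evaluates `z` to a literal first. -/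
def withInt {β : Type*} (z : ℤ) (f : ℤ → β) : β :=
  match z with
  | Int.ofNat n => withNat n fun n => f (Int.ofNat n)
  | Int.negSucc n => withNat n fun n => f (Int.negSucc n)

@[simp]
theorem withNat_eq {β : Type*} (n : ℕ) (f : ℕ → β) : withNat n f = f n := by
  cases n <;> rfl

@[simp]
theorem withInt_eq {β : Type*} (z : ℤ) (f : ℤ → β) : withInt z f = f z := by
  cases z <;> simp [withInt]

/-- A step of Newton's method for the square root of `n`. -/
def newtonStep (n k : ℕ) : ℕ := (k + n / k) / 2

/-- An upper bound for the integer square root, which is sharp for small numbers. -/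
def isqrt (n : ℕ) : ℕ :=
  withNat (newtonStep n (2 ^ (Nat.log2 n / 2 + 1))) fun k =>
  withNat (newtonStep n k) fun k => newtonStep n k

/-- By the inequality of arithmetic and geometric means, `k * (2 * x - k) ≤ x * x`, so a Newton step
from any positive `k` never falls below the root. Convergence plays no role. -/
theorem le_newtonStep {n k x : ℕ} (hx : x * x ≤ n) (hk : 0 < k ∨ x = 0) : x ≤ newtonStep n k := by
  obtain hk | rfl := hk
  · have h1 : 2 * x - k ≤ n / k := by
      refine (Nat.le_div_iff_mul_le hk).2 (le_trans ?_ hx)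
      zify
      obtain h | h := le_total k (2 * x)
      · push_cast [h]
        nlinarith [sq_nonneg ((x : ℤ) - k)]
      · simp [Nat.sub_eq_zero_of_le h, mul_self_nonneg]
    rw [newtonStep]
    omega
  · exact Nat.zero_le _

theorem le_isqrt {n x : ℕ} (hx : x * x ≤ n) : x ≤ isqrt n := by
  have h1 := le_newtonStep hx (k := 2 ^ (Nat.log2 n / 2 + 1)) (Or.inl (by positivity))
  -- The previous iterate is at least `x`, so it vanishes only if `x = 0`.
  have h2 := le_newtonStep hx (k := newtonStep n (2 ^ (Nat.log2 n / 2 + 1))) (by omega)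
  simp only [isqrt, withNat_eq]
  exact le_newtonStep hx (by omega)

/-- The first number `k + i` with `i ≤ f` whose successor has a square greater than `n`. -/
def rootFrom (n : ℕ) : ℕ → ℕ → ℕ
  | 0, k => k
  | f + 1, k =>
    bif Nat.ble (Nat.mul (Nat.succ k) (Nat.succ k)) n then rootFrom n f (Nat.succ k) else k

theorem rootFrom_eq {n x : ℕ} (hx : x * x = n) (f k : ℕ) (hk : k ≤ x) (h : x ≤ k + f) :
    rootFrom n f k = x := by
  induction f generalizing k with
  | zero => exact le_antisymm hk h
  | succ f ih =>
    rw [rootFrom]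
    cases hb : Nat.ble (Nat.mul (Nat.succ k) (Nat.succ k)) n with
    | true =>
      have h1 : Nat.succ k * Nat.succ k ≤ n := Nat.le_of_ble_eq_true hb
      exact ih _ (by rw [← hx] at h1; exact Nat.mul_self_le_mul_self_iff.1 h1) (by omega)
    | false =>
      rw [cond_false]
      by_contra hne
      have h1 : Nat.succ k ≤ x := by omega
      have h2 : Nat.succ k * Nat.succ k ≤ n := hx ▸ Nat.mul_le_mul h1 h1
      exact Bool.false_ne_true (hb.symm.trans (Nat.ble_eq_true_of_le h2))

/-- The integers `x` with `(2 * x + t) ^ 2 = N`. -/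
def halfRoots (t N : ℤ) : List ℤ :=
  match N with
  | Int.negSucc _ => []
  | Int.ofNat n =>
    withNat (rootFrom n n 0) fun S =>
    bif Nat.beq (Nat.mul S S) n then
      bif (S - t) % 2 == 0 then [(S - t) / 2, (-S - t) / 2] else []
    else []

/-- In contrast to `interval`, this list is exact. It solves for the last coordinate in `vecs`, so
that no test of the norm is needed there. -/
theorem mem_halfRoots {t N x : ℤ} : x ∈ halfRoots t N ↔ (2 * x + t) * (2 * x + t) = N := by
  cases N with
  | negSucc n =>
    have := mul_self_nonneg (2 * x + t)
    simp only [halfRoots, List.not_mem_nil, false_iff]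
    omega
  | ofNat n =>
    simp only [halfRoots, withNat_eq, Bool.cond_eq_ite, beq_iff_eq, Nat.mul_eq]
    constructor
    · intro h
      split_ifs at h with h1 h2
      · have h3 : ((rootFrom n n 0 : ℤ)) * rootFrom n n 0 = n := by
          exact_mod_cast Nat.eq_of_beq_eq_true h1
        generalize (rootFrom n n 0 : ℤ) = S at *
        rw [Int.ofNat_eq_natCast, ← h3]
        simp only [List.mem_cons, List.not_mem_nil, or_false] at h
        rcases h with rfl | rfl
        · have : 2 * ((S - t) / 2) + t = S := by omega
          rw [this]
        · have : 2 * ((-S - t) / 2) + t = -S := by omega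
          rw [this]; ring
      · simp at h
      · simp at h
    · intro h
      have h1 : (2 * x + t).natAbs * (2 * x + t).natAbs = n := by
        zify
        simpa using h
      -- The fuel `n` suffices, since a natural number is at most its square.
      have h2 := rootFrom_eq h1 n 0 (Nat.zero_le _) (by nlinarith)
      rw [h2, if_pos (Nat.beq_eq ▸ h1), if_pos (by omega)]
      simp only [List.mem_cons, List.not_mem_nil, or_false]
      omega

/-- A list of integers that contains all `x` with `(p * x + q) ^ 2 ≤ N`. -/
def interval (p q N : ℤ) : List ℤ :=
  withInt (isqrt N.toNat) fun S =>
  withInt (-((q + S) / p)) fun lo =>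
  (List.range ((S - q) / p + 1 - lo).toNat).map fun i : ℕ => lo + i

/-- One inclusion is enough: `isqrt` may overestimate, but superfluous members are harmless because
all later conditions are exact. -/
theorem mem_interval {p q N x : ℤ} (hp : 0 < p) (h : (p * x + q) * (p * x + q) ≤ N) :
    x ∈ interval p q N := by
  have hS : ((p * x + q).natAbs : ℤ) ≤ isqrt N.toNat := by
    refine Int.ofNat_le.2 (le_isqrt ?_)
    zify
    rw [Int.toNat_of_nonneg ((mul_self_nonneg _).trans h)]
    simpa using h
  simp only [interval, withInt_eq, List.mem_map, List.mem_range]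
  generalize (isqrt N.toNat : ℤ) = S at hS
  have h1 : -x ≤ (q + S) / p := (Int.le_ediv_iff_mul_le hp).2 (by
    linarith [Int.natAbs_neg (p * x + q) ▸ Int.le_natAbs (a := -(p * x + q))])
  have h2 : x ≤ (S - q) / p := (Int.le_ediv_iff_mul_le hp).2 (by
    linarith [Int.le_natAbs (a := p * x + q)])
  exact ⟨(x - -((q + S) / p)).toNat, by omega, by omega⟩

/-! ### Short vectors of quaternary lattices and representations of binary forms -/

/-- Coordinate vectors in a quaternary lattice. -/
abbrev Vec4 := ℤ × ℤ × ℤ × ℤ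

/-- The parameters `(a, b)` of a Gram matrix `gram a b`. -/
abbrev Param := (ℤ × ℤ × ℤ) × (ℤ × ℤ × ℤ × ℤ)

/-- The linear form `bil c u` of the quaternary lattice with parameters `c`. -/
def dual (c : Param) (u : Vec4) : Vec4 :=
  (2 * u.1 + c.1.1 * u.2.2.1 + c.2.1 * u.2.2.2,
   2 * u.2.1 + c.1.2.1 * u.2.2.1 + c.2.2.1 * u.2.2.2,
   c.1.1 * u.1 + c.1.2.1 * u.2.1 + c.1.2.2 * u.2.2.1 + c.2.2.2.1 * u.2.2.2,
   c.2.1 * u.1 + c.2.2.1 * u.2.1 + c.2.2.2.1 * u.2.2.1 + c.2.2.2.2 * u.2.2.2)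

/-- The bilinear form of the quaternary orthogonal summand of `gram c.1 c.2`. -/
def bil (c : Param) (u v : Vec4) : ℤ :=
  (dual c u).1 * v.1 + (dual c u).2.1 * v.2.1 + (dual c u).2.2.1 * v.2.2.1 +
    (dual c u).2.2.2 * v.2.2.2

/-- Twice the norm of the projection of the third basis vector to the orthogonal complement of the
first two. -/
def disc3 (a : ℤ × ℤ × ℤ) : ℤ := 2 * a.2.2 - a.1 * a.1 - a.2.1 * a.2.1

/-- Twice the inner product of the projections of the third and fourth basis vectors to the
orthogonal complement of the first two. -/
def mix (c : Param) : ℤ := 2 * c.2.2.2.1 - c.1.1 * c.2.1 - c.1.2.1 * c.2.2.1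

/-- Twice the norm of the projection of the fourth basis vector to the orthogonal complement of the
first two. -/
def last (c : Param) : ℤ := 2 * c.2.2.2.2 - c.2.1 * c.2.1 - c.2.2.1 * c.2.2.1

/-- The determinant of `gram c.1 c.2`. -/
def disc4 (c : Param) : ℤ := disc3 c.1 * last c - mix c * mix c

/-- Completing squares in the two basis vectors of norm 2. The remaining binary form in the last two
coordinates has determinant `disc4 c`. -/
theorem two_mul_bil_self (c : Param) (u : Vec4) :
    2 * bil c u u = (2 * u.1 + (c.1.1 * u.2.2.1 + c.2.1 * u.2.2.2)) ^ 2 +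
      (2 * u.2.1 + (c.1.2.1 * u.2.2.1 + c.2.2.1 * u.2.2.2)) ^ 2 +
      (disc3 c.1 * u.2.2.1 ^ 2 + 2 * mix c * u.2.2.1 * u.2.2.2 + last c * u.2.2.2 ^ 2) := by
  simp only [bil, dual, disc3, mix, last]
  ring

/-- The vectors of norm `n` in the quaternary lattice with parameters `c`. -/
def vecs (c : Param) (n : ℤ) : List Vec4 :=
  withInt (disc3 c.1) fun m => withInt (mix c) fun r => withInt (last c) fun l =>
  withInt (disc4 c) fun D =>
  (interval 1 0 (2 * m * n / D)).flatMap fun x₄ => withInt x₄ fun x₄ =>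
  withInt (r * x₄) fun rx =>
  (interval m rx (2 * m * n - D * x₄ * x₄)).flatMap fun x₃ => withInt x₃ fun x₃ =>
  withInt (2 * n - m * x₃ * x₃ - 2 * rx * x₃ - l * x₄ * x₄) fun N =>
  withInt (c.1.1 * x₃ + c.2.1 * x₄) fun s =>
  withInt (c.1.2.1 * x₃ + c.2.2.1 * x₄) fun t =>
  (interval 2 s N).flatMap fun x₁ => withInt x₁ fun x₁ =>
  withInt (N - (2 * x₁ + s) * (2 * x₁ + s)) fun N' =>
  (halfRoots t N').map fun x₂ => withInt x₂ fun x₂ => (x₁, x₂, x₃, x₄)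

/-- The squares of the diagonalised form bound `x₄`, then `x₃`, then `x₁`, so nothing is missed;
`x₂` solves the norm equation exactly, so nothing wrong is listed. -/
theorem mem_vecs {c : Param} (h3 : 0 < disc3 c.1) (h4 : 0 < disc4 c) {n : ℤ} {u : Vec4} :
    u ∈ vecs c n ↔ bil c u u = n := by
  obtain ⟨y₁, y₂, y₃, y₄⟩ := u
  have key := two_mul_bil_self c (y₁, y₂, y₃, y₄)
  simp only [vecs, withInt_eq, List.mem_flatMap, List.mem_map, mem_halfRoots, Prod.mk.injEq]
  simp only at key
  constructor
  · rintro ⟨x₄, -, x₃, -, x₁, -, x₂, h, rfl, rfl, rfl, rfl⟩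
    linarith
  · rintro rfl
    -- The last two coordinates are diagonalised as well, after multiplication by `disc3`.
    have hD : disc4 c * y₄ * y₄ + (disc3 c.1 * y₃ + mix c * y₄) ^ 2 =
        disc3 c.1 * (disc3 c.1 * y₃ ^ 2 + 2 * mix c * y₃ * y₄ + last c * y₄ ^ 2) := by
      simp only [disc4]; ring
    set R := disc3 c.1 * y₃ ^ 2 + 2 * mix c * y₃ * y₄ + last c * y₄ ^ 2 with hR
    set s := c.1.1 * y₃ + c.2.1 * y₄
    set t := c.1.2.1 * y₃ + c.2.2.1 * y₄
    have hle : disc4 c * y₄ * y₄ + (disc3 c.1 * y₃ + mix c * y₄) ^ 2 ≤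
        2 * disc3 c.1 * bil c (y₁, y₂, y₃, y₄) (y₁, y₂, y₃, y₄) := by
      have : 0 ≤ disc3 c.1 * ((2 * y₁ + s) ^ 2 + (2 * y₂ + t) ^ 2) := by positivity
      nlinarith
    refine ⟨y₄, mem_interval one_pos ?_, y₃, mem_interval h3 (by nlinarith), y₁,
      mem_interval two_pos (by nlinarith [sq_nonneg (2 * y₂ + t)]), y₂,
      by nlinarith, rfl, rfl, rfl, rfl⟩
    refine (Int.le_ediv_iff_mul_le h4).2 ?_
    nlinarith [sq_nonneg (disc3 c.1 * y₃ + mix c * y₄)]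

/-- The Gram matrix of a binary form. -/
def binary (g : ℤ × ℤ × ℤ) : Matrix (Fin 2) (Fin 2) ℤ := !![g.1, g.2.1; g.2.1, g.2.2]

/-- The columns of a representing matrix are `(x, u)` and `(y, v)`, split according to `⟨1⟩` and its
quaternary complement. -/
theorem represents_gram_iff {c : Param} {g : ℤ × ℤ × ℤ} :
    Represents (gram c.1 c.2) (binary g) ↔ ∃ (x y : ℤ) (u v : Vec4),
      x * x + bil c u u = g.1 ∧ bil c u v + x * y = g.2.1 ∧ y * y + bil c v v = g.2.2 := by
  constructor
  · rintro ⟨T, hT⟩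
    refine ⟨T 0 0, T 0 1, (T 1 0, T 2 0, T 3 0, T 4 0), (T 1 1, T 2 1, T 3 1, T 4 1), ?_, ?_, ?_⟩
    · have := congrFun (congrFun hT 0) 0
      simp [binary, gram, Matrix.mul_apply, Fin.sum_univ_succ] at this
      rw [← this]; simp [bil, dual]; ring
    · have := congrFun (congrFun hT 0) 1
      simp [binary, gram, Matrix.mul_apply, Fin.sum_univ_succ] at this
      rw [← this]; simp [bil, dual]; ring
    · have := congrFun (congrFun hT 1) 1
      simp [binary, gram, Matrix.mul_apply, Fin.sum_univ_succ] at this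
      rw [← this]; simp [bil, dual]; ring
  · rintro ⟨x, y, u, v, h1, h2, h3⟩
    refine ⟨!![x, y; u.1, v.1; u.2.1, v.2.1; u.2.2.1, v.2.2.1; u.2.2.2, v.2.2.2], ?_⟩
    ext i j
    fin_cases i <;> fin_cases j <;>
      simp [binary, gram, Matrix.mul_apply, Fin.sum_univ_succ, ← h1, ← h2, ← h3, bil, dual] <;>
      ring

/-- Decides whether the form `gram c.1 c.2` represents the binary form `g`. By symmetry, the first
and the last coordinate of the first vector may be assumed to be nonnegative. -/
def reps (c : Param) (g : ℤ × ℤ × ℤ) : Bool :=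
  (interval 1 0 g.1).any fun x => withInt x fun x => decide (0 ≤ x) &&
  (vecs c (g.1 - x * x)).any fun u => decide (0 ≤ u.2.2.2) &&
  withInt (dual c u).1 fun w₁ => withInt (dual c u).2.1 fun w₂ =>
  withInt (dual c u).2.2.1 fun w₃ => withInt (dual c u).2.2.2 fun w₄ =>
  (interval 1 0 g.2.2).any fun y => withInt y fun y => withInt (g.2.1 - x * y) fun k =>
  (vecs c (g.2.2 - y * y)).any fun v =>
    w₁ * v.1 + w₂ * v.2.1 + w₃ * v.2.2.1 + w₄ * v.2.2.2 == k

theorem bil_self_nonneg {c : Param} (h3 : 0 < disc3 c.1) (h4 : 0 < disc4 c) (u : Vec4) :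
    0 ≤ bil c u u := by
  have key := two_mul_bil_self c u
  have hD : disc4 c * u.2.2.2 ^ 2 + (disc3 c.1 * u.2.2.1 + mix c * u.2.2.2) ^ 2 =
      disc3 c.1 * (disc3 c.1 * u.2.2.1 ^ 2 + 2 * mix c * u.2.2.1 * u.2.2.2 +
        last c * u.2.2.2 ^ 2) := by
    simp only [disc4]; ring
  have hR := nonneg_of_mul_nonneg_right (hD ▸ (by positivity : 0 ≤ disc4 c * u.2.2.2 ^ 2 +
    (disc3 c.1 * u.2.2.1 + mix c * u.2.2.2) ^ 2)) h3
  nlinarith [sq_nonneg (2 * u.1 + (c.1.1 * u.2.2.1 + c.2.1 * u.2.2.2)),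
    sq_nonneg (2 * u.2.1 + (c.1.2.1 * u.2.2.1 + c.2.2.1 * u.2.2.2))]

/-- The sign changes of the summand `⟨1⟩` and of the quaternary summand are independent isometries;
they justify the two normalisations in the search. -/
theorem reps_iff {c : Param} (h3 : 0 < disc3 c.1) (h4 : 0 < disc4 c) {g : ℤ × ℤ × ℤ} :
    reps c g = true ↔ Represents (gram c.1 c.2) (binary g) := by
  rw [represents_gram_iff]
  simp only [reps, withInt_eq, List.any_eq_true, Bool.and_eq_true, decide_eq_true_eq,
    mem_vecs h3 h4, beq_iff_eq]
  constructor
  · rintro ⟨x, -, -, u, hu, -, y, -, v, hv, h⟩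
    exact ⟨x, y, u, v, by linarith, by rw [bil]; linarith, by linarith⟩
  · rintro ⟨x, y, u, v, h₁, h, h₂⟩
    have hneg : ∀ u v : Vec4, bil c (-u) (-v) = bil c u v := by
      intro u v
      simp only [bil, dual, Prod.fst_neg, Prod.snd_neg]
      ring
    wlog hx : 0 ≤ x generalizing x y
    · exact this (-x) (-y) (by linarith) (by linarith) (by linarith) (by omega)
    wlog hu : 0 ≤ u.2.2.2 generalizing u v
    · refine this (-u) (-v) (by rw [hneg, h₁]) (by rw [hneg, h]) (by rw [hneg, h₂]) ?_
      simp only [Prod.snd_neg]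
      omega
    rw [bil] at h
    exact ⟨x, mem_interval one_pos (by linarith [bil_self_nonneg h3 h4 u]), hx, u, by linarith, hu,
      y, mem_interval one_pos (by linarith [bil_self_nonneg h3 h4 v]), v, by linarith, by linarith⟩

end QuadIsolation
namespace QuadIsolation

open Matrix

/-! ### Saturated sublattices, frames and flags -/

section Lattice

variable {V : Type*} [AddCommGroup V]

/-- A saturated submodule `P` and a vector `w` outside of it, as witnessed by a functional: the
saturation of `P + ℤ w` is `P + ℤ v` for some `v`. -/
theorem exists_saturated_extension (P : Submodule ℤ V)
    (hP : ∀ (c : ℤ) (x : V), c ≠ 0 → c • x ∈ P → x ∈ P) (φ : V →ₗ[ℤ] ℤ)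
    (hφ : ∀ x ∈ P, φ x = 0) {w : V} (hw : φ w ≠ 0) :
    ∃ (v : V) (k : ℤ), k ≠ 0 ∧ w - k • v ∈ P ∧
      ∀ (x : V) (c j : ℤ), c ≠ 0 → c • x - j • w ∈ P → ∃ i : ℤ, x - i • v ∈ P := by
  -- `S` is the saturation of `P + ℤ w`. As `P` is saturated and `φ w ≠ 0`, the kernel of `φ` on `S`
  -- lies in `P`.
  let S : Submodule ℤ V :=
    { carrier := {x | ∃ c j : ℤ, c ≠ 0 ∧ c • x - j • w ∈ P}
      zero_mem' := ⟨1, 0, one_ne_zero, by simp⟩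
      add_mem' := by
        rintro x y ⟨c, j, hc, hx⟩ ⟨d, i, hd, hy⟩
        refine ⟨c * d, d * j + c * i, mul_ne_zero hc hd, ?_⟩
        have : (c * d) • (x + y) - (d * j + c * i) • w =
            d • (c • x - j • w) + c • (d • y - i • w) := by module
        rw [this]
        exact P.add_mem (P.smul_mem _ hx) (P.smul_mem _ hy)
      smul_mem' := by
        rintro a x ⟨c, j, hc, hx⟩
        refine ⟨c, a * j, hc, ?_⟩
        have : c • a • x - (a * j) • w = a • (c • x - j • w) := by module
        rw [this]
        exact P.smul_mem _ hx }
  have hker : ∀ x ∈ S, φ x = 0 → x ∈ P := by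
    rintro x ⟨c, j, hc, hx⟩ h0
    have h1 := hφ _ hx
    simp only [map_sub, map_smul, h0, smul_eq_mul, mul_zero, zero_sub, neg_eq_zero,
      mul_eq_zero, hw, or_false] at h1
    subst h1
    exact hP c x hc (by simpa using hx)
  -- `φ` maps `S` onto an ideal of `ℤ`; a preimage `v` of its generator spans `S` modulo `P`.
  obtain ⟨d, hd⟩ := (IsPrincipalIdealRing.principal (S.map φ)).principal
  obtain ⟨v, hv, hvd⟩ : d ∈ S.map φ := hd ▸ Submodule.mem_span_singleton_self d
  have hcoord : ∀ x ∈ S, ∃ i : ℤ, x - i • v ∈ P := by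
    intro x hx
    have h1 : φ x ∈ S.map φ := ⟨x, hx, rfl⟩
    rw [hd, Submodule.mem_span_singleton] at h1
    obtain ⟨i, hi⟩ := h1
    exact ⟨i, hker _ (S.sub_mem hx (S.smul_mem _ hv)) (by rw [map_sub, map_smul, hvd, hi, sub_self])⟩
  obtain ⟨k, hk⟩ := hcoord w ⟨1, 1, one_ne_zero, by simp⟩
  refine ⟨v, k, ?_, hk, fun x c j hc hx => hcoord x ⟨c, j, hc, hx⟩⟩
  rintro rfl
  exact hw (hφ _ (by simpa using hk))

variable (B : LinearMap.BilinForm ℤ V)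

/-- A symmetric positive definite bilinear form. -/
structure PosSymm : Prop where
  symm : ∀ x y, B x y = B y x
  pos : ∀ x, x ≠ 0 → 0 < B x x

variable {B}

theorem PosSymm.nonneg (h : PosSymm B) (x : V) : 0 ≤ B x x := by
  by_cases hx : x = 0
  · simp [hx]
  · exact (h.pos x hx).le

theorem PosSymm.eq_zero_of_smul (h : PosSymm B) {c : ℤ} (hc : c ≠ 0) {x : V} (hx : c • x = 0) :
    x = 0 := by
  by_contra h0
  have h1 : c * (c * B x x) = 0 := by
    have : B (c • x) (c • x) = 0 := by simp [hx]
    simpa using this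
  have h2 := h.pos x h0
  simp [hc, h2.ne'] at h1

variable (B)

/-- A unit vector `e` and two orthogonal vectors `v₁`, `v₂` of norm two in its orthogonal
complement, which does not contain any unit vector. -/
structure Frame (e v₁ v₂ : V) : Prop where
  ee : B e e = 1
  e1 : B e v₁ = 0
  e2 : B e v₂ = 0
  v11 : B v₁ v₁ = 2
  v12 : B v₁ v₂ = 0
  v22 : B v₂ v₂ = 2
  noUnit : ∀ x, B e x = 0 → B x x ≠ 1

variable {B}

theorem Frame.swap (h : PosSymm B) {e v₁ v₂ : V} (f : Frame B e v₁ v₂) : Frame B e v₂ v₁ :=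
  ⟨f.ee, f.e2, f.e1, f.v22, by rw [h.symm, f.v12], f.v11, f.noUnit⟩

/-- The plane spanned by the two vectors of norm two is saturated. -/
theorem Frame.saturated (h : PosSymm B) {e v₁ v₂ : V} (f : Frame B e v₁ v₂) (c : ℤ) (x : V)
    (hc : c ≠ 0) (hx : c • x ∈ Submodule.span ℤ {v₁, v₂}) :
    x ∈ Submodule.span ℤ {v₁, v₂} := by
  rw [Submodule.mem_span_pair] at hx
  obtain ⟨s, t, hst⟩ := hx
  have hex : B e x = 0 := by
    have := congrArg (B e) hst
    simp [f.e1, f.e2, hc] at this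
    exact this
  have h1 : c * B v₁ x = 2 * s := by
    have := congrArg (B v₁) hst
    simp [f.v11, f.v12] at this
    linarith
  have h2 : c * B v₂ x = 2 * t := by
    have := congrArg (B v₂) hst
    simp [f.v22, h.symm v₂ v₁, f.v12] at this
    linarith
  generalize B v₁ x = p at h1
  generalize B v₂ x = q at h2
  -- The factor `c` can be cancelled because a definite lattice is torsion-free.
  have h3 : (2 : ℤ) • x = p • v₁ + q • v₂ := by
    refine sub_eq_zero.1 (h.eq_zero_of_smul hc ?_)
    have : c • ((2 : ℤ) • x - (p • v₁ + q • v₂)) =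
        (2 : ℤ) • (c • x) - ((c * p) • v₁ + (c * q) • v₂) := by module
    rw [this, ← hst, h1, h2]
    module
  have h4 : (2 : ℤ) • (x - (p / 2) • v₁ - (q / 2) • v₂) = (p % 2) • v₁ + (q % 2) • v₂ := by
    have e1 := Int.emod_add_mul_ediv p 2
    have e2 := Int.emod_add_mul_ediv q 2
    generalize p / 2 = p' at *
    generalize q / 2 = q' at *
    rw [smul_sub, smul_sub, h3, ← e1, ← e2]
    simp only [Int.add_mul_emod_self_left, Int.emod_emod]
    module
  -- Modulo the plane, `x` becomes half of `0`, `v₁`, `v₂` or `v₁ + v₂`.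
  set y := x - (p / 2) • v₁ - (q / 2) • v₂ with hy
  have h5 : 2 * B y y = p % 2 * (p % 2) + q % 2 * (q % 2) := by
    have : B ((2 : ℤ) • y) ((2 : ℤ) • y) = 2 * (p % 2 * (p % 2) + q % 2 * (q % 2)) := by
      rw [h4]; simp [f.v11, f.v12, f.v22, h.symm v₂ v₁]; ring
    simp at this
    linarith
  have h6 : B y y ≠ 1 := f.noUnit y (by simp [hy, hex, f.e1, f.e2])
  -- A single odd residue contradicts parity; two odd residues would make `y` a unit vector
  -- orthogonal to `e`.
  have h7 : B y y = 0 := by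
    rcases Int.emod_two_eq_zero_or_one p with hp | hp <;>
      rcases Int.emod_two_eq_zero_or_one q with hq | hq <;> rw [hp, hq] at h5 <;> omega
  have h8 : y = 0 := by
    by_contra h0
    exact (h.pos y h0).ne' h7
  rw [Submodule.mem_span_pair]
  refine ⟨p / 2, q / 2, ?_⟩
  rw [hy, sub_sub, sub_eq_zero] at h8
  exact h8.symm

/-- Cauchy–Schwarz: the component of `x` orthogonal to `e` has nonnegative norm. -/
theorem PosSymm.sq_le (h : PosSymm B) {e : V} (he : B e e = 1) (x : V) :
    B e x * B e x ≤ B x x := by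
  have := h.nonneg (x - B e x • e)
  simp [he, h.symm x e] at this
  linarith

/-- A form that splits off a unit vector and represents `⟨2, 2⟩`, but not `⟨1, 1⟩`. -/
theorem exists_frame (h : PosSymm B) {e t₁ t₂ : V} (he : B e e = 1)
    (h1 : ∀ x, B e x = 0 → B x x ≠ 1) (h11 : B t₁ t₁ = 2) (h12 : B t₁ t₂ = 0)
    (h22 : B t₂ t₂ = 2) : Frame B e t₁ t₂ := by
  -- If `B e t = ±1`, then removing the component along `e` leaves a unit vector orthogonal to `e`.
  have key : ∀ t, B t t = 2 → B e t = 0 := by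
    intro t ht
    by_contra h0
    have h2 := h.sq_le he t
    have h3 : B e t * B e t = 1 := by
      have : B e t < 2 := by nlinarith
      have : -2 < B e t := by nlinarith
      obtain h4 | h4 : B e t = 1 ∨ B e t = -1 := by omega
      all_goals rw [h4]; rfl
    refine h1 (t - B e t • e) (by simp [he]) ?_
    simp [he, h.symm t e, ht]
    linarith
  exact ⟨he, key _ h11, key _ h22, h11, h12, h22, h1⟩

variable (B)

/-- A frame that is completed by a third vector `v₃` to a saturated sublattice, where `v₃` has
minimal norm outside of the plane spanned by the frame. -/
structure Flag (e v₁ v₂ v₃ : V) : Prop extends Frame B e v₁ v₂ where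
  e3 : B e v₃ = 0
  notMem : v₃ ∉ Submodule.span ℤ {v₁, v₂}
  saturated₃ : ∀ (c : ℤ) (x : V), c ≠ 0 → c • x ∈ Submodule.span ℤ {v₁, v₂, v₃} →
    x ∈ Submodule.span ℤ {v₁, v₂, v₃}
  minimal : ∀ x, B e x = 0 → x ∉ Submodule.span ℤ {v₁, v₂} → B v₃ v₃ ≤ B x x

variable {B}

theorem Flag.swap (h : PosSymm B) {e v₁ v₂ v₃ : V} (f : Flag B e v₁ v₂ v₃) :
    Flag B e v₂ v₁ v₃ where
  toFrame := f.toFrame.swap h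
  e3 := f.e3
  notMem := by rw [Set.pair_comm]; exact f.notMem
  saturated₃ := by rw [Set.insert_comm]; exact f.saturated₃
  minimal := by rw [Set.pair_comm]; exact f.minimal

/-- Twice the projection of `x` to the orthogonal complement of `v₁` and `v₂`. -/
theorem Frame.proj_ne_zero (h : PosSymm B) {e v₁ v₂ : V} (f : Frame B e v₁ v₂) {x : V}
    (hx : x ∉ Submodule.span ℤ {v₁, v₂}) : (2 : ℤ) • x - B v₁ x • v₁ - B v₂ x • v₂ ≠ 0 := by
  intro h0
  refine hx (f.saturated h 2 x two_ne_zero ?_)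
  rw [Submodule.mem_span_pair]
  exact ⟨B v₁ x, B v₂ x, by rw [sub_sub, sub_eq_zero] at h0; exact h0.symm⟩

theorem Frame.proj_self (h : PosSymm B) {e v₁ v₂ : V} (f : Frame B e v₁ v₂) (x : V) :
    B ((2 : ℤ) • x - B v₁ x • v₁ - B v₂ x • v₂) ((2 : ℤ) • x - B v₁ x • v₁ - B v₂ x • v₂) =
      2 * (2 * B x x - B v₁ x * B v₁ x - B v₂ x * B v₂ x) := by
  simp [f.v11, f.v12, f.v22, h.symm v₂ v₁, h.symm x v₁, h.symm x v₂]
  ring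

theorem mem_span_triple {x v₁ v₂ v₃ : V} : x ∈ Submodule.span ℤ {v₁, v₂, v₃} ↔
    ∃ s t k : ℤ, s • v₁ + t • v₂ + k • v₃ = x := by
  simp only [Submodule.mem_span_insert, Submodule.mem_span_singleton]
  constructor
  · rintro ⟨s, _, ⟨t, _, ⟨k, rfl⟩, rfl⟩, rfl⟩
    exact ⟨s, t, k, by abel⟩
  · rintro ⟨s, t, k, rfl⟩
    exact ⟨s, _, ⟨t, _, ⟨k, rfl⟩, rfl⟩, by abel⟩

/-- A shortest vector `w'` outside the plane determines a saturated rank-three lattice. A generator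
of it modulo the plane is translated until its products with `v₁, v₂` are 0 or 1. The point is that
this `v₃` is no longer than `w'`, hence also of minimal norm. -/
theorem Frame.exists_flag (h : PosSymm B) {e v₁ v₂ w : V} (f : Frame B e v₁ v₂)
    (hew : B e w = 0) (hw : w ∉ Submodule.span ℤ {v₁, v₂}) :
    ∃ v₃, Flag B e v₁ v₂ v₃ ∧ B v₃ v₃ ≤ B w w ∧ (B v₁ v₃ = 0 ∨ B v₁ v₃ = 1) ∧
      (B v₂ v₃ = 0 ∨ B v₂ v₃ = 1) := by
  obtain ⟨w', ⟨hew', hw'⟩, hmin⟩ := (InvImage.wf (fun x => (B x x).toNat) wellFounded_lt).has_min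
    {x | B e x = 0 ∧ x ∉ Submodule.span ℤ {v₁, v₂}} ⟨w, hew, hw⟩
  replace hmin : ∀ x, B e x = 0 → x ∉ Submodule.span ℤ {v₁, v₂} → B w' w' ≤ B x x := by
    intro x hx hx'
    have := hmin x ⟨hx, hx'⟩
    have h1 := h.nonneg x
    simp only [InvImage] at this
    omega
  have h21 : B v₂ v₁ = 0 := by rw [h.symm, f.v12]
  have hpw := f.proj_ne_zero h hw'
  have hpos := h.pos _ hpw
  have hself := f.proj_self h w'
  -- The functional is the pairing with the projection of `w'`: it vanishes on the plane and is
  -- positive on `w'`.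
  obtain ⟨v, k, hk, hwv, hsat⟩ := exists_saturated_extension (Submodule.span ℤ {v₁, v₂})
    (f.saturated h) (B ((2 : ℤ) • w' - B v₁ w' • v₁ - B v₂ w' • v₂))
    (by
      intro x hx
      obtain ⟨s, t, rfl⟩ := Submodule.mem_span_pair.1 hx
      simp [f.v11, f.v12, f.v22, h21, h.symm w' v₁, h.symm w' v₂]
      ring)
    (w := w') (by
      have h2 : B ((2 : ℤ) • w' - B v₁ w' • v₁ - B v₂ w' • v₂) w' =
          2 * B w' w' - B v₁ w' * B v₁ w' - B v₂ w' * B v₂ w' := by simp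
      rw [h2]
      intro h3
      rw [hself, h3] at hpos
      simp at hpos)
  set v₃ := v - (B v₁ v / 2) • v₁ - (B v₂ v / 2) • v₂ with hv₃
  have hvmem : v - v₃ ∈ Submodule.span ℤ {v₁, v₂} :=
    Submodule.mem_span_pair.2 ⟨B v₁ v / 2, B v₂ v / 2, by rw [hv₃]; abel⟩
  have ha1 : B v₁ v₃ = B v₁ v % 2 := by
    simp [hv₃, f.v11, f.v12]; omega
  have ha2 : B v₂ v₃ = B v₂ v % 2 := by
    simp [hv₃, f.v22, h21]; omega
  have ha1' : B v₁ v₃ = 0 ∨ B v₁ v₃ = 1 := by omega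
  have ha2' : B v₂ v₃ = 0 ∨ B v₂ v₃ = 1 := by omega
  have hwv₃ : w' - k • v₃ ∈ Submodule.span ℤ {v₁, v₂} := by
    have : w' - k • v₃ = (w' - k • v) + k • (v - v₃) := by module
    rw [this]
    exact Submodule.add_mem _ hwv (Submodule.smul_mem _ _ hvmem)
  obtain ⟨s, t, hst⟩ := Submodule.mem_span_pair.1 hwv₃
  have hweq : w' = k • v₃ + s • v₁ + t • v₂ := by rw [add_assoc, hst]; abel
  -- Since `w'` is `k • v₃` modulo the plane, multiplying a relation for `v₃` by `k` gives one for
  -- `w'`.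
  have hsat₃ : ∀ (x : V) (c j : ℤ), c ≠ 0 → c • x - j • v₃ ∈ Submodule.span ℤ {v₁, v₂} →
      ∃ i : ℤ, x - i • v₃ ∈ Submodule.span ℤ {v₁, v₂} := by
    intro x c j hc hx
    obtain ⟨i, hi⟩ := hsat x (k * c) j (mul_ne_zero hk hc) (by
      have : (k * c) • x - j • w' = k • (c • x - j • v₃) - j • (w' - k • v₃) := by module
      rw [this]
      exact Submodule.sub_mem _ (Submodule.smul_mem _ _ hx) (Submodule.smul_mem _ _ hwv₃))
    refine ⟨i, ?_⟩
    have : x - i • v₃ = (x - i • v) + i • (v - v₃) := by module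
    rw [this]
    exact Submodule.add_mem _ hi (Submodule.smul_mem _ _ hvmem)
  have he3 : B e v₃ = 0 := by
    have := hew'
    rw [hweq] at this
    simpa [f.e1, f.e2, hk] using this
  have hnot : v₃ ∉ Submodule.span ℤ {v₁, v₂} := by
    intro hmem
    apply hw'
    have : w' = (w' - k • v₃) + k • v₃ := by abel
    rw [this]
    exact Submodule.add_mem _ hwv₃ (Submodule.smul_mem _ _ hmem)
  have hle : B v₃ v₃ ≤ B w' w' := by
    have e0 : B w' w' = k * k * B v₃ v₃ + 2 * s * s + 2 * t * t + 2 * k * s * B v₁ v₃ +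
        2 * k * t * B v₂ v₃ := by
      rw [hweq]
      simp [f.v11, f.v12, f.v22, h21, h.symm v₃ v₁, h.symm v₃ v₂]
      ring
    have hp3 := h.pos _ (f.proj_ne_zero h hnot)
    rw [f.proj_self h] at hp3
    have hw2 : 2 ≤ B w' w' := by
      have h1 := f.noUnit w' hew'
      have h2 := h.pos w' (by rintro rfl; exact hw' (Submodule.zero_mem _))
      omega
    have e1 : 2 * B w' w' = k * k * (2 * B v₃ v₃ - B v₁ v₃ * B v₁ v₃ - B v₂ v₃ * B v₂ v₃) +
        (2 * s + k * B v₁ v₃) * (2 * s + k * B v₁ v₃) +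
        (2 * t + k * B v₂ v₃) * (2 * t + k * B v₂ v₃) := by rw [e0]; ring
    set m := 2 * B v₃ v₃ - B v₁ v₃ * B v₁ v₃ - B v₂ v₃ * B v₂ v₃ with hm
    -- For `k = ±1`, each of the two squares is at least that of the product 0 or 1, since it is odd
    -- in the latter case. Otherwise `4 * m ≤ 2 * B w' w'`, while `2 * B v₃ v₃ ≤ m + 2` and `2 ≤ B
    -- w' w'`.
    by_cases hk1 : k = 1 ∨ k = -1
    · have hkk : k * k = 1 := by rcases hk1 with rfl | rfl <;> rfl
      have aux : ∀ p a : ℤ, (a = 0 ∨ a = 1) →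
          a * a ≤ (2 * p + k * a) * (2 * p + k * a) := by
        rintro p a (rfl | rfl)
        · nlinarith [mul_self_nonneg (2 * p)]
        · have : 2 * p + k * 1 ≠ 0 := by omega
          have := mul_self_pos.2 this
          omega
      have := aux s _ ha1'
      have := aux t _ ha2'
      rw [hkk] at e1
      omega
    · have hkk : 4 ≤ k * k := by
        have : 2 ≤ k ∨ k ≤ -2 := by omega
        rcases this with h1 | h1 <;> nlinarith
      have h1 : 4 * m ≤ 2 * B w' w' := by
        nlinarith [mul_self_nonneg (2 * s + k * B v₁ v₃), mul_self_nonneg (2 * t + k * B v₂ v₃)]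
      rcases ha1' with h2 | h2 <;> rcases ha2' with h3 | h3 <;> rw [h2, h3] at hm <;> omega
  refine ⟨v₃, ⟨f, he3, hnot, ?_, fun x hx hx' => hle.trans (hmin x hx hx')⟩,
    hle.trans (hmin w hew hw), ha1', ha2'⟩
  intro c x hc hx
  obtain ⟨p, q, j, hj⟩ := mem_span_triple.1 hx
  obtain ⟨i, hi⟩ := hsat₃ x c j hc (Submodule.mem_span_pair.2 ⟨p, q, by rw [← hj]; abel⟩)
  obtain ⟨p', q', hpq⟩ := Submodule.mem_span_pair.1 hi
  exact mem_span_triple.2 ⟨p', q', i, by rw [hpq]; abel⟩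

end Lattice

end QuadIsolation
namespace QuadIsolation

open Matrix

/-! ### The fourth basis vector and the bound for the determinant -/

section Lattice

variable {V : Type*} [AddCommGroup V] (B : LinearMap.BilinForm ℤ V)

/-- The determinant of the Gram matrix of `v₁`, `v₂`, `v₃`, `x`, if `v₁`, `v₂` belong to a frame. -/
def relDisc (v₁ v₂ v₃ x : V) : ℤ :=
  (2 * B v₃ v₃ - B v₁ v₃ * B v₁ v₃ - B v₂ v₃ * B v₂ v₃) *
      (2 * B x x - B v₁ x * B v₁ x - B v₂ x * B v₂ x) -
    (2 * B v₃ x - B v₁ v₃ * B v₁ x - B v₂ v₃ * B v₂ x) *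
      (2 * B v₃ x - B v₁ v₃ * B v₁ x - B v₂ v₃ * B v₂ x)

variable {B}

theorem Flag.disc_pos (h : PosSymm B) {e v₁ v₂ v₃ : V} (f : Flag B e v₁ v₂ v₃) :
    0 < 2 * B v₃ v₃ - B v₁ v₃ * B v₁ v₃ - B v₂ v₃ * B v₂ v₃ := by
  have := h.pos _ (f.proj_ne_zero h f.notMem)
  rw [f.proj_self h] at this
  linarith

/-- The vector `x`, projected to the orthogonal complement of `v₁`, `v₂`, `v₃` and scaled. -/
theorem Flag.exists_orthogonal (h : PosSymm B) {e v₁ v₂ v₃ : V} (f : Flag B e v₁ v₂ v₃) {x : V}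
    (hx : x ∉ Submodule.span ℤ {v₁, v₂, v₃}) :
    0 < relDisc B v₁ v₂ v₃ x ∧ ∃ y : V, (∀ z ∈ Submodule.span ℤ {v₁, v₂, v₃}, B y z = 0) ∧
      B y x = relDisc B v₁ v₂ v₃ x := by
  have hm := f.disc_pos h
  set m := 2 * B v₃ v₃ - B v₁ v₃ * B v₁ v₃ - B v₂ v₃ * B v₂ v₃ with hmdef
  set r := 2 * B v₃ x - B v₁ v₃ * B v₁ x - B v₂ v₃ * B v₂ x with hr
  -- Gram–Schmidt orthogonalisation without denominators.
  set y := m • ((2 : ℤ) • x - B v₁ x • v₁ - B v₂ x • v₂) -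
    r • ((2 : ℤ) • v₃ - B v₁ v₃ • v₁ - B v₂ v₃ • v₂) with hy
  have h21 : B v₂ v₁ = 0 := by rw [h.symm, f.v12]
  have hyx : B y x = relDisc B v₁ v₂ v₃ x := by
    rw [hy, relDisc, ← hmdef, ← hr]
    simp only [map_sub, map_smul, LinearMap.sub_apply, LinearMap.smul_apply, smul_eq_mul]
    rw [hr]
  have hy1 : B y v₁ = 0 := by
    rw [hy]
    simp [f.v11, h21, h.symm x v₁, h.symm v₃ v₁]
    ring_nf
  have hy2 : B y v₂ = 0 := by
    rw [hy]
    simp [f.v22, f.v12, h.symm x v₂, h.symm v₃ v₂]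
    ring_nf
  have hy3 : B y v₃ = 0 := by
    rw [hy]
    simp only [map_sub, map_smul, LinearMap.sub_apply, LinearMap.smul_apply, smul_eq_mul,
      h.symm x v₃]
    rw [hr, hmdef]
    ring
  -- If `y = 0`, then `(2 * m) • x` lies in the span of the flag, and by saturation so does `x`.
  have hy0 : y ≠ 0 := by
    intro h0
    refine hx (f.saturated₃ (2 * m) x (by positivity) (mem_span_triple.2
      ⟨m * B v₁ x - r * B v₁ v₃, m * B v₂ x - r * B v₂ v₃, 2 * r, ?_⟩))
    rw [hy, sub_eq_zero] at h0
    have : (2 * m) • x = m • ((2 : ℤ) • x - B v₁ x • v₁ - B v₂ x • v₂) + m • (B v₁ x • v₁) +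
        m • (B v₂ x • v₂) := by module
    rw [this, h0]
    module
  -- `y` differs from `(2 * m) • x` by a vector of the span, to which `y` is orthogonal.
  have hyy : B y y = 2 * m * B y x := by
    nth_rw 2 [hy]
    simp only [map_sub, map_smul, smul_eq_mul, hy1, hy2, hy3]
    ring
  refine ⟨?_, y, ?_, hyx⟩
  · have := h.pos y hy0
    rw [hyy, hyx] at this
    exact pos_of_mul_pos_right this (by positivity)
  · intro z hz
    obtain ⟨s, t, k, rfl⟩ := mem_span_triple.1 hz
    simp [hy1, hy2, hy3]

/-- Six vectors in rank 5 are dependent. Pairing with `e` removes `e` from the relation, and the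
coefficient of `x` is nonzero because `v₁, v₂, v₃, w` are independent by saturation. -/
theorem Flag.exists_relation (h : PosSymm B) [Module.Free ℤ V] [Module.Finite ℤ V]
    (hrank : Module.finrank ℤ V = 5) {e v₁ v₂ v₃ w x : V} (f : Flag B e v₁ v₂ v₃)
    (hw : w ∉ Submodule.span ℤ {v₁, v₂, v₃}) (hew : B e w = 0) (hex : B e x = 0) :
    ∃ c j : ℤ, c ≠ 0 ∧ c • x - j • w ∈ Submodule.span ℤ {v₁, v₂, v₃} := by
  have hdep : ¬ LinearIndependent ℤ ![e, v₁, v₂, v₃, w, x] := by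
    intro hli
    have := hli.fintype_card_le_finrank
    rw [hrank] at this
    simp at this
  obtain ⟨g, hg, i, hi⟩ := Fintype.not_linearIndependent_iff.1 hdep
  replace hg : g 0 • e + g 1 • v₁ + g 2 • v₂ + g 3 • v₃ + g 4 • w + g 5 • x = 0 := by
    rw [← hg, Fin.sum_univ_six]
    rfl
  have h0 : g 0 = 0 := by
    have := congrArg (B e) hg
    simpa [f.ee, f.e1, f.e2, f.e3, hew, hex] using this
  rw [h0, zero_smul, zero_add] at hg
  by_cases h5 : g 5 = 0
  · exfalso
    rw [h5, zero_smul, add_zero] at hg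
    have h4 : g 4 = 0 := by
      by_contra h4
      refine hw (f.saturated₃ (g 4) w h4 (mem_span_triple.2 ⟨-g 1, -g 2, -g 3, ?_⟩))
      linear_combination (norm := module) (-1 : ℤ) • hg
    rw [h4, zero_smul, add_zero] at hg
    have h3 : g 3 = 0 := by
      by_contra h3
      refine f.notMem (f.saturated h (g 3) v₃ h3 (Submodule.mem_span_pair.2 ⟨-g 1, -g 2, ?_⟩))
      linear_combination (norm := module) (-1 : ℤ) • hg
    rw [h3, zero_smul, add_zero] at hg
    have h1 : g 1 = 0 := by
      have := congrArg (B v₁) hg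
      simpa [f.v11, f.v12] using this
    have h2 : g 2 = 0 := by
      have := congrArg (B v₂) hg
      simpa [f.v22, h1] using this
    exact hi (by fin_cases i <;> assumption)
  · refine ⟨g 5, -g 4, h5, mem_span_triple.2 ⟨-g 1, -g 2, -g 3, ?_⟩⟩
    linear_combination (norm := module) (-1 : ℤ) • hg

/-- `relDisc` sees only the projection of its last argument to the complement of `v₁, v₂, v₃`, and
is quadratic in it. -/
theorem Frame.relDisc_eq (h : PosSymm B) {e v₁ v₂ v₃ w v : V} (f : Frame B e v₁ v₂) {k s t j : ℤ}
    (hw : w = k • v + (s • v₁ + t • v₂ + j • v₃)) :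
    relDisc B v₁ v₂ v₃ w = k * k * relDisc B v₁ v₂ v₃ v := by
  subst hw
  simp [relDisc, f.v11, f.v12, f.v22, h.symm v₂ v₁, h.symm v₃ v₁, h.symm v₃ v₂, h.symm v v₁,
    h.symm v v₂, h.symm v v₃]
  ring

/-- A vector `w` outside of the span of a flag yields a vector `v₄` that completes the flag to a
basis of the orthogonal complement of the unit vector. Here `R` is any list of representatives for
the inner products of `v₄` with the flag. -/
theorem Flag.exists_basis (h : PosSymm B) [Module.Free ℤ V] [Module.Finite ℤ V]
    (hrank : Module.finrank ℤ V = 5) {e v₁ v₂ v₃ w : V} (f : Flag B e v₁ v₂ v₃)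
    (hw : w ∉ Submodule.span ℤ {v₁, v₂, v₃}) (hew : B e w = 0) {R : List (ℤ × ℤ × ℤ)}
    (hR : ∀ b₁ b₂ b₃ : ℤ, ∃ ε s t k : ℤ, ε * ε = 1 ∧
      (ε * b₁ + 2 * s + B v₁ v₃ * k, ε * b₂ + 2 * t + B v₂ v₃ * k,
        ε * b₃ + B v₁ v₃ * s + B v₂ v₃ * t + B v₃ v₃ * k) ∈ R) :
    ∃ v₄, B e v₄ = 0 ∧ (B v₁ v₄, B v₂ v₄, B v₃ v₄) ∈ R ∧ 0 < relDisc B v₁ v₂ v₃ v₄ ∧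
      relDisc B v₁ v₂ v₃ v₄ ≤
        2 * (2 * B v₃ v₃ - B v₁ v₃ * B v₁ v₃ - B v₂ v₃ * B v₂ v₃) * B w w ∧
      ∀ x, B e x = 0 → ∃ s t k l : ℤ, x = s • v₁ + t • v₂ + k • v₃ + l • v₄ := by
  obtain ⟨hpos, y, hy, hyw⟩ := f.exists_orthogonal h hw
  obtain ⟨v, k, hk, hwv, hsat⟩ := exists_saturated_extension _ f.saturated₃ (B y) hy
    (by rw [hyw]; exact hpos.ne')
  obtain ⟨s, t, j, hstj⟩ := mem_span_triple.1 hwv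
  have hweq : w = k • v + (s • v₁ + t • v₂ + j • v₃) := by rw [hstj]; abel
  have hev : B e v = 0 := by
    have := hew
    rw [hweq] at this
    simpa [f.e1, f.e2, f.e3, hk] using this
  have hD := f.relDisc_eq h hweq
  obtain ⟨ε, s', t', k', hε, hmem⟩ := hR (B v₁ v) (B v₂ v) (B v₃ v)
  -- A sign and a translation by the flag change neither the generated lattice nor `relDisc`.
  set v₄ := ε • v + (s' • v₁ + t' • v₂ + k' • v₃) with hv₄
  have hD4 := f.relDisc_eq h hv₄
  rw [hε, one_mul] at hD4
  have hk1 : 1 ≤ k * k := by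
    have := mul_self_pos.2 hk
    omega
  have hvpos : 0 < relDisc B v₁ v₂ v₃ v := by
    rw [hD] at hpos
    exact pos_of_mul_pos_right hpos (by positivity)
  refine ⟨v₄, by simp [hv₄, hev, f.e1, f.e2, f.e3], ?_, by rw [hD4]; exact hvpos, ?_, ?_⟩
  · convert hmem using 1
    simp [hv₄, f.v11, f.v12, f.v22, h.symm v₂ v₁, h.symm v₃ v₁, h.symm v₃ v₂]
    refine ⟨by ring, by ring, by ring⟩
  -- `w` is `k • v` modulo the flag with `k ≠ 0`, so its `relDisc` is at least that of `v`; dropping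
  -- the subtracted squares bounds it by the norm of `w`.
  · have hle : relDisc B v₁ v₂ v₃ v ≤ relDisc B v₁ v₂ v₃ w := by rw [hD]; nlinarith
    rw [hD4]
    refine hle.trans ?_
    have hm := f.disc_pos h
    rw [relDisc]
    set m := 2 * B v₃ v₃ - B v₁ v₃ * B v₁ v₃ - B v₂ v₃ * B v₂ v₃
    nlinarith [mul_nonneg hm.le (mul_self_nonneg (B v₁ w)),
      mul_nonneg hm.le (mul_self_nonneg (B v₂ w)),
      mul_self_nonneg (2 * B v₃ w - B v₁ v₃ * B v₁ w - B v₂ v₃ * B v₂ w)]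
  · intro x hx
    obtain ⟨c, i, hc, hci⟩ := f.exists_relation h hrank hw hew hx
    obtain ⟨i, hi⟩ := hsat x c i hc hci
    obtain ⟨p, q, r, hpqr⟩ := mem_span_triple.1 hi
    -- `v` is expressed through `v₄`, with `ε` as its own inverse.
    refine ⟨p - i * ε * s', q - i * ε * t', r - i * ε * k', i * ε, ?_⟩
    have h1 : x = i • v + (p • v₁ + q • v₂ + r • v₃) := by rw [hpqr]; abel
    have h2 : i • v = (i * (ε * ε)) • v := by rw [hε, mul_one]
    rw [h1, h2, hv₄]
    module

end Lattice

end QuadIsolation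
namespace QuadIsolation

open Matrix

/-! ### Forms and lattice vectors -/

/-- Positivity over `ℝ`, restricted to integral vectors, is all that the lattice arguments use. -/
theorem IsForm.posSymm {n : ℕ} {L : Matrix (Fin n) (Fin n) ℤ} (hL : IsForm L) :
    PosSymm (Matrix.toBilin' L) := by
  have hsymm : Lᵀ = L := by
    ext i j
    have := congrFun (congrFun hL.isHermitian i) j
    simpa using this
  refine ⟨fun x y => ?_, fun x hx => ?_⟩
  · rw [Matrix.toBilin'_apply', Matrix.toBilin'_apply', dotProduct_mulVec, ← mulVec_transpose,
      hsymm, dotProduct_comm]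
  · have h0 : (fun i => (x i : ℝ)) ≠ 0 := by
      intro h
      exact hx (funext fun i => by simpa using congrFun h i)
    have h1 := hL.dotProduct_mulVec_pos h0
    rw [Matrix.toBilin'_apply']
    have h2 : star (fun i => (x i : ℝ)) ⬝ᵥ L.map (Int.cast : ℤ → ℝ) *ᵥ (fun i => (x i : ℝ)) =
        ((x ⬝ᵥ L *ᵥ x : ℤ) : ℝ) := by
      simp [dotProduct, mulVec]
    rw [h2] at h1
    exact_mod_cast h1

theorem toBilin'_columns {n m : ℕ} (L : Matrix (Fin n) (Fin n) ℤ) (T : Matrix (Fin n) (Fin m) ℤ)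
    (i j : Fin m) : Matrix.toBilin' L (Tᵀ i) (Tᵀ j) = (Tᵀ * L * T) i j := by
  rw [Matrix.toBilin'_apply', dotProduct_mulVec]
  simp only [Matrix.mul_apply, dotProduct, vecMul, Matrix.transpose_apply]

theorem Represents.exists_vectors {n : ℕ} {L : Matrix (Fin n) (Fin n) ℤ} {g : ℤ × ℤ × ℤ}
    (h : Represents L (binary g)) : ∃ t₁ t₂ : Fin n → ℤ, Matrix.toBilin' L t₁ t₁ = g.1 ∧
      Matrix.toBilin' L t₁ t₂ = g.2.1 ∧ Matrix.toBilin' L t₂ t₂ = g.2.2 := by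
  obtain ⟨T, hT⟩ := h
  refine ⟨Tᵀ 0, Tᵀ 1, ?_, ?_, ?_⟩ <;> rw [toBilin'_columns, hT] <;> rfl

/-- The coordinates of the standard basis vectors form a right inverse of the matrix with columns `v
i`, which is two-sided as the matrix is square. -/
theorem isometric_of_basis {n m : ℕ} {L : Matrix (Fin n) (Fin n) ℤ}
    {M : Matrix (Fin m) (Fin m) ℤ} (hnm : n = m) (v : Fin m → Fin n → ℤ)
    (hv : ∀ i j, Matrix.toBilin' L (v i) (v j) = M i j)
    (hspan : ∀ x : Fin n → ℤ, ∃ c : Fin m → ℤ, x = ∑ i, c i • v i) : Isometric L M := by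
  subst hnm
  choose c hc using fun i : Fin n => hspan (Pi.single i 1)
  have hTS : (Matrix.of v)ᵀ * (Matrix.of c)ᵀ = 1 := by
    ext i j
    have := congrFun (hc j) i
    simp only [Finset.sum_apply, Pi.smul_apply, smul_eq_mul] at this
    simp only [Matrix.mul_apply, Matrix.transpose_apply, Matrix.of_apply, Matrix.one_apply]
    rw [Finset.sum_congr rfl fun k _ => mul_comm _ _, ← this, Pi.single_apply]
  refine ⟨(Matrix.of v)ᵀ, (Matrix.of c)ᵀ, hTS, mul_eq_one_comm.1 hTS, ?_⟩
  ext i j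
  rw [← hv, ← toBilin'_columns]
  rfl

theorem Represents.trans {n m l : ℕ} {f : Matrix (Fin n) (Fin n) ℤ}
    {g : Matrix (Fin m) (Fin m) ℤ} {h : Matrix (Fin l) (Fin l) ℤ}
    (hfg : Represents f g) (hgh : Represents g h) : Represents f h := by
  obtain ⟨T, rfl⟩ := hfg
  obtain ⟨U, rfl⟩ := hgh
  exact ⟨T * U, by simp only [Matrix.transpose_mul, Matrix.mul_assoc]⟩

theorem Isometric.represents {n m : ℕ} {f : Matrix (Fin n) (Fin n) ℤ}
    {g : Matrix (Fin m) (Fin m) ℤ} (h : Isometric f g) : Represents f g :=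
  let ⟨T, _, _, _, hT⟩ := h
  ⟨T, hT⟩

theorem Isometric.represents_iff {n m l : ℕ} {f : Matrix (Fin n) (Fin n) ℤ}
    {g : Matrix (Fin m) (Fin m) ℤ} {h : Matrix (Fin l) (Fin l) ℤ} (hfg : Isometric f g) :
    Represents f h ↔ Represents g h :=
  ⟨hfg.symm.represents.trans, hfg.represents.trans⟩

/-! ### Vectors outside of the span of a frame or a flag -/

section Lattice

variable {V : Type*} [AddCommGroup V] {B : LinearMap.BilinForm ℤ V}

/-- If all short vectors in the complement of a unit vector have coordinates in a quaternary
lattice, then a representation of a binary form yields one by the corresponding quinary form. -/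
theorem represents_gram_of_coordinates (h : PosSymm B) {e t₁ t₂ : V} (he : B e e = 1)
    {c : Param} {g : ℤ × ℤ × ℤ} (ht1 : B t₁ t₁ = g.1) (ht12 : B t₁ t₂ = g.2.1)
    (ht2 : B t₂ t₂ = g.2.2) (R : V → Vec4 → Prop)
    (hR : ∀ w u w' u', R w u → R w' u' → B w w' = bil c u u')
    (hmem : ∀ w, B e w = 0 → B w w ≤ max g.1 g.2.2 → ∃ u, R w u) :
    Represents (gram c.1 c.2) (binary g) := by
  have hsplit : ∀ t t', B (t - B e t • e) (t' - B e t' • e) = B t t' - B e t * B e t' := by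
    intro t t'
    simp [he, h.symm t e, mul_comm]
  have hperp : ∀ t, B e (t - B e t • e) = 0 := by
    intro t
    simp [he]
  have hle : ∀ t, B (t - B e t • e) (t - B e t • e) ≤ B t t := by
    intro t
    rw [hsplit]
    nlinarith [mul_self_nonneg (B e t)]
  obtain ⟨u, hu⟩ := hmem (t₁ - B e t₁ • e) (hperp _) ((hle _).trans (ht1 ▸ le_max_left _ _))
  obtain ⟨v, hv⟩ := hmem (t₂ - B e t₂ • e) (hperp _) ((hle _).trans (ht2 ▸ le_max_right _ _))
  refine represents_gram_iff.2 ⟨B e t₁, B e t₂, u, v, ?_, ?_, ?_⟩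
  · rw [← hR _ _ _ _ hu hu, hsplit, ht1]; ring
  · rw [← hR _ _ _ _ hu hv, hsplit, ht12]; ring
  · rw [← hR _ _ _ _ hv hv, hsplit, ht2]; ring

/-- If all short vectors of the complement of `e` lay in the plane, then `g` would be represented by
`⟨1⟩ ⊥ ⟨2, 2⟩`, hence by every `gram (0, 0, a) b`. So one form of this kind that fails forces a new
short vector. -/
theorem Frame.exists_notMem (h : PosSymm B) {e v₁ v₂ t₁ t₂ : V} (f : Frame B e v₁ v₂)
    {g : ℤ × ℤ × ℤ} (ht1 : B t₁ t₁ = g.1) (ht12 : B t₁ t₂ = g.2.1) (ht2 : B t₂ t₂ = g.2.2)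
    {a : ℤ} {b : ℤ × ℤ × ℤ × ℤ} (hg : ¬ Represents (gram (0, 0, a) b) (binary g)) :
    ∃ w, B e w = 0 ∧ B w w ≤ max g.1 g.2.2 ∧ w ∉ Submodule.span ℤ {v₁, v₂} := by
  by_contra! hcon
  refine hg (represents_gram_of_coordinates h f.ee (c := ((0, 0, a), b)) ht1 ht12 ht2
    (fun w u => w = u.1 • v₁ + u.2.1 • v₂ ∧ u.2.2 = 0) ?_ fun w h1 h2 => ?_)
  · rintro _ ⟨s, t, _⟩ _ ⟨s', t', _⟩ ⟨rfl, rfl⟩ ⟨rfl, rfl⟩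
    simp [bil, dual, f.v11, f.v12, f.v22, h.symm v₂ v₁]
    ring
  · obtain ⟨s, t, hst⟩ := Submodule.mem_span_pair.1 (hcon w h1 h2)
    exact ⟨(s, t, 0), hst.symm, rfl⟩

/-- The same argument with a ternary lattice; a single `b` suffices, since a representation by `⟨1⟩`
and the ternary part would serve every `b`. -/
theorem Flag.exists_notMem (h : PosSymm B) {e v₁ v₂ v₃ t₁ t₂ : V} (f : Flag B e v₁ v₂ v₃)
    {g : ℤ × ℤ × ℤ} (ht1 : B t₁ t₁ = g.1) (ht12 : B t₁ t₂ = g.2.1) (ht2 : B t₂ t₂ = g.2.2)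
    {b : ℤ × ℤ × ℤ × ℤ}
    (hg : ¬ Represents (gram (B v₁ v₃, B v₂ v₃, B v₃ v₃) b) (binary g)) :
    ∃ w, B e w = 0 ∧ B w w ≤ max g.1 g.2.2 ∧ w ∉ Submodule.span ℤ {v₁, v₂, v₃} := by
  by_contra! hcon
  refine hg (represents_gram_of_coordinates h f.ee (c := ((_, _, _), b)) ht1 ht12 ht2
    (fun w u => w = u.1 • v₁ + u.2.1 • v₂ + u.2.2.1 • v₃ ∧ u.2.2.2 = 0) ?_ fun w h1 h2 => ?_)
  · rintro _ ⟨s, t, k, _⟩ _ ⟨s', t', k', _⟩ ⟨rfl, rfl⟩ ⟨rfl, rfl⟩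
    simp [bil, dual, f.v11, f.v12, f.v22, h.symm v₂ v₁, h.symm v₃ v₁, h.symm v₃ v₂]
    ring
  · obtain ⟨s, t, k, hstk⟩ := mem_span_triple.1 (hcon w h1 h2)
    exact ⟨(s, t, k, 0), hstk.symm, rfl⟩

/-- The minimality of the third vector of a flag in terms of coordinates. -/
theorem Flag.le_norm (h : PosSymm B) {e v₁ v₂ v₃ v₄ : V} (f : Flag B e v₁ v₂ v₃)
    (he4 : B e v₄ = 0) (hD : 0 < relDisc B v₁ v₂ v₃ v₄) {s t k l : ℤ} (hkl : k ≠ 0 ∨ l ≠ 0) :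
    B v₃ v₃ ≤ B (s • v₁ + t • v₂ + k • v₃ + l • v₄) (s • v₁ + t • v₂ + k • v₃ + l • v₄) := by
  refine f.minimal _ (by simp [f.e1, f.e2, f.e3, he4]) fun hmem => ?_
  obtain ⟨p, q, hpq⟩ := Submodule.mem_span_pair.1 hmem
  -- If `l ≠ 0`, saturation puts `v₄` into the span of the flag, where `relDisc` vanishes.
  have hl : l = 0 := by
    by_contra hl
    obtain ⟨s', t', k', h'⟩ := mem_span_triple.1 (f.saturated₃ l v₄ hl (mem_span_triple.2
      ⟨p - s, q - t, -k, by linear_combination (norm := module) hpq⟩))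
    have h0 := f.relDisc_eq h (v₃ := v₃) (w := v₄) (v := v₄) (k := 0)
      (s := s') (t := t') (j := k') (by rw [zero_smul, zero_add, h'])
    rw [mul_zero, zero_mul] at h0
    exact hD.ne' h0
  have hk : k ≠ 0 := hkl.resolve_right (not_not.2 hl)
  subst hl
  exact f.notMem (f.saturated h k v₃ hk (Submodule.mem_span_pair.2
    ⟨p - s, q - t, by linear_combination (norm := module) hpq⟩))

end Lattice

theorem bil_comm (c : Param) (u v : Vec4) : bil c u v = bil c v u := by
  simp only [bil, dual]
  ring

theorem bil_zero_left (c : Param) (v : Vec4) : bil c (0, 0, 0, 0) v = 0 := by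
  simp [bil, dual]

theorem toBilin'_gram (c : Param) (x y : Fin 5 → ℤ) :
    Matrix.toBilin' (gram c.1 c.2) x y =
      x 0 * y 0 + bil c (x 1, x 2, x 3, x 4) (y 1, y 2, y 3, y 4) := by
  simp [Matrix.toBilin'_apply', dotProduct, mulVec, gram, Fin.sum_univ_succ, bil, dual]
  ring

end QuadIsolation
namespace QuadIsolation

open Matrix

/-! ### Escalation -/

/-- The Gram matrix of the sublattice of `ℤ²` spanned by `(S.1, S.2.1)` and `(S.2.2.1, S.2.2.2)`. -/
def sublattice (S : Vec4) : ℤ × ℤ × ℤ :=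
  (S.1 * S.1 + S.2.1 * S.2.1, S.1 * S.2.2.1 + S.2.1 * S.2.2.2,
    S.2.2.1 * S.2.2.1 + S.2.2.2 * S.2.2.2)

/-- The index of a sublattice of `ℤ²`. -/
def sublatticeIndex (S : Vec4) : ℕ := (S.1 * S.2.2.2 - S.2.2.1 * S.2.1).natAbs

/-- The data for a ternary lattice with the basis vectors `v₁`, `v₂` (orthogonal, of norm two) and
`v₃`: its parameters; a sublattice of `ℤ²` that is not represented by the orthogonal sum of `⟨1⟩`
and the lattice; sublattices of `ℤ²` that exclude non-candidates; representatives for the inner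
products of a further vector with the basis, up to sign and translation by the lattice; and changes
of basis, with their inverses, for the quaternary lattices that contain it. -/
structure Escalation where
  /-- the parameters -/
  a : ℤ × ℤ × ℤ
  /-- a sublattice that is not represented -/
  sub : Vec4
  /-- sublattices that exclude non-candidates -/
  tests : List Vec4
  /-- representatives for the inner products of a fourth vector with the basis -/
  residues : List (ℤ × ℤ × ℤ)
  /-- changes of basis and their inverses -/
  moves : List ((Vec4 × Vec4 × Vec4 × Vec4) × (Vec4 × Vec4 × Vec4 × Vec4))

/-- The escalations of `⟨1⟩ ⊥ ⟨2, 2⟩`. -/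
def escalations : List Escalation := [
  ⟨(0, 0, 2), (1, 1, 2, -1), [(1, 0, 0, 3), (1, 1, 2, -1)],
     [(0, 0, 0), (0, 0, 1), (0, 1, 0), (0, 1, 1), (1, 0, 0), (1, 0, 1), (1, 1, 0),
      (1, 1, 1)],
     [(((0, 0, 1, 0), (1, 0, 0, 0), (0, 1, 0, 0), (0, 0, 0, 1)),
       ((0, 1, 0, 0), (0, 0, 1, 0), (1, 0, 0, 0), (0, 0, 0, 1))),
      (((0, 1, 0, 0), (0, 0, 1, 0), (1, 0, 0, 0), (0, 0, 0, 1)),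
       ((0, 0, 1, 0), (1, 0, 0, 0), (0, 1, 0, 0), (0, 0, 0, 1))),
      (((1, 0, 0, 0), (0, 1, 0, 0), (0, 0, 0, 1), (-1, -1, -1, 1)),
       ((1, 0, 0, 0), (0, 1, 0, 0), (-1, -1, 1, -1), (0, 0, 1, 0)))]⟩,
  ⟨(0, 1, 2), (1, 0, 0, 3), [(1, 0, 0, 3), (2, 3, 3, -2)],
     [(0, 1, 0), (0, 0, 0), (1, 1, 0), (1, 0, 0)],
     [(((1, 0, 0, 0), (0, 0, 1, 0), (0, 1, 0, 0), (0, 0, 0, 1)),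
       ((1, 0, 0, 0), (0, 0, 1, 0), (0, 1, 0, 0), (0, 0, 0, 1)))]⟩,
  ⟨(1, 1, 2), (1, 1, 2, -1), [(1, 0, 0, 3), (1, 2, 2, -1), (1, 1, 2, -1)],
     [(0, 0, 0), (1, -1, 0), (1, 0, 0)],
     []⟩,
  ⟨(0, 0, 3), (1, 1, 2, -1), [(1, 2, 2, -1), (1, 1, 2, -1), (1, 1, 3, -2)],
     [(0, 0, 1), (0, 0, 0), (0, 1, 1), (0, 1, 0), (1, 0, 1), (1, 0, 0), (1, 1, 1),
      (1, 1, 0)],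
     [(((0, 1, 0, 0), (1, 0, 0, 0), (0, 0, 1, 0), (0, 0, 0, 1)),
       ((0, 1, 0, 0), (1, 0, 0, 0), (0, 0, 1, 0), (0, 0, 0, 1))),
      (((1, 0, 0, 0), (0, 1, 0, 0), (0, 0, 0, 1), (0, -1, -1, 1)),
       ((1, 0, 0, 0), (0, 1, 0, 0), (0, -1, 1, -1), (0, 0, 1, 0))),
      (((1, 0, 0, 0), (0, 1, 0, 0), (0, 0, 0, 1), (-1, -1, -1, 1)),
       ((1, 0, 0, 0), (0, 1, 0, 0), (-1, -1, 1, -1), (0, 0, 1, 0))),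
      (((1, 0, 0, 0), (0, 1, 0, 0), (0, 0, 0, 1), (0, 0, 1, 0)),
       ((1, 0, 0, 0), (0, 1, 0, 0), (0, 0, 0, 1), (0, 0, 1, 0))),
      (((0, 1, 0, 0), (1, 0, 0, 0), (0, 0, 0, 1), (0, 0, 1, 0)),
       ((0, 1, 0, 0), (1, 0, 0, 0), (0, 0, 0, 1), (0, 0, 1, 0))),
      (((0, 1, 0, 0), (1, 0, 0, 0), (0, 0, 0, 1), (-1, 0, -1, 1)),
       ((0, 1, 0, 0), (1, 0, 0, 0), (0, -1, 1, -1), (0, 0, 1, 0)))]⟩,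
  ⟨(0, 1, 3), (1, 1, 3, -2), [(1, 1, 3, -2), (4, 1, 1, -4)],
     [(0, 1, 0), (0, 0, 1), (0, 0, 0), (1, 1, 0), (1, 0, 1), (1, 0, 0)],
     []⟩,
  ⟨(1, 1, 3), (1, 1, 2, -1), [(1, 2, 2, -1), (1, 1, 2, -1)],
     [(0, 0, 0), (1, -1, 1), (1, -1, 0), (0, 1, 1), (1, 0, 0)],
     [(((0, 1, 0, 0), (1, 0, 0, 0), (0, 0, 0, 1), (0, 0, 1, 0)),
       ((0, 1, 0, 0), (1, 0, 0, 0), (0, 0, 0, 1), (0, 0, 1, 0))),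
      (((1, 0, 0, 0), (0, 1, 0, 0), (0, 0, 0, 1), (1, 1, -1, 0)),
       ((1, 0, 0, 0), (0, 1, 0, 0), (1, 1, 0, -1), (0, 0, 1, 0))),
      (((0, 1, 0, 0), (1, 0, 0, 0), (0, 0, 1, 0), (0, 1, 0, -1)),
       ((0, 1, 0, 0), (1, 0, 0, 0), (0, 0, 1, 0), (1, 0, 0, -1)))]⟩,
  ⟨(0, 0, 4), (1, 1, 2, -1), [(1, 0, 0, 3), (1, 2, 2, -1), (1, 1, 2, -1)],
     [(0, 0, 0), (0, 0, -1), (0, 0, 2), (0, 1, 0), (0, 1, -1), (0, 1, 2), (1, 0, 0),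
      (1, 0, -1), (1, 0, 2), (1, 1, 0), (1, 1, -1), (1, 1, 2)],
     [(((0, 1, 0, 0), (1, 0, 0, 0), (0, 0, 1, 0), (0, 0, 0, 1)),
       ((0, 1, 0, 0), (1, 0, 0, 0), (0, 0, 1, 0), (0, 0, 0, 1))),
      (((1, 0, 0, 0), (0, 1, 0, 0), (0, 0, 0, 1), (-1, -1, 1, 1)),
       ((1, 0, 0, 0), (0, 1, 0, 0), (1, 1, -1, 1), (0, 0, 1, 0)))]⟩,
  ⟨(0, 1, 4), (1, 0, 0, 3), [(1, 0, 0, 3), (1, 1, 4, -3), (5, 2, 2, -5)],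
     [(0, 1, 2), (0, 0, 1), (0, 0, 0), (0, 1, 0), (1, 1, 2), (1, 0, 1), (1, 0, 0),
      (1, 1, 0)],
     []⟩,
  ⟨(1, 1, 4), (1, 2, 2, -1), [(1, 0, 0, 3), (1, 2, 2, -1)],
     [(0, 0, 0), (1, -1, 2), (1, -1, 1), (1, -1, 0), (0, 1, 1), (1, 0, 2), (1, 0, 0)],
     [(((0, 1, 0, 0), (1, 0, 0, 0), (0, 0, 1, 0), (0, 1, 0, -1)),
       ((0, 1, 0, 0), (1, 0, 0, 0), (0, 0, 1, 0), (1, 0, 0, -1)))]⟩,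
  ⟨(0, 0, 5), (1, 1, 2, -1), [(1, 1, 2, -1), (1, 1, 3, -2)],
     [(0, 0, -1), (0, 0, -2), (0, 0, 0), (0, 1, -1), (0, 1, -2), (0, 1, 0), (1, 0, -1),
      (1, 0, -2), (1, 0, 0), (1, 1, -1), (1, 1, -2), (1, 1, 0)],
     [(((1, 0, 0, 0), (0, 1, 0, 0), (0, 0, 0, 1), (0, 0, -1, 0)),
       ((1, 0, 0, 0), (0, 1, 0, 0), (0, 0, 0, -1), (0, 0, 1, 0))),
      (((0, 1, 0, 0), (1, 0, 0, 0), (0, 0, 0, 1), (0, 0, -1, 0)),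
       ((0, 1, 0, 0), (1, 0, 0, 0), (0, 0, 0, -1), (0, 0, 1, 0))),
      (((1, 0, 0, 0), (0, 1, 0, 0), (0, 0, 0, 1), (0, -1, 1, 1)),
       ((1, 0, 0, 0), (0, 1, 0, 0), (0, 1, -1, 1), (0, 0, 1, 0)))]⟩,
  ⟨(0, 1, 5), (1, 2, 2, -1), [(1, 2, 2, -1)],
     [(0, 0, 2), (0, 0, 1), (0, 0, 0), (0, 1, 2), (0, 1, 0), (1, 0, 2), (1, 0, 1),
      (1, 0, 0), (1, 1, 2), (1, 1, 0)],
     []⟩,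
  ⟨(1, 1, 5), (1, 0, 0, 5), [(1, 0, 0, 5)],
     [(0, 0, 0), (0, 0, 1), (1, -1, 2), (1, -1, 1), (1, -1, 0), (0, 1, 1), (0, 1, -1),
      (1, 0, 2), (1, 0, 0)],
     [(((0, 1, 0, 0), (1, 0, 0, 0), (0, 0, 1, 0), (0, 1, 0, -1)),
       ((0, 1, 0, 0), (1, 0, 0, 0), (0, 0, 1, 0), (1, 0, 0, -1))),
      (((0, 1, 0, 0), (1, 0, 0, 0), (0, 0, 0, 1), (0, 0, 1, 0)),
       ((0, 1, 0, 0), (1, 0, 0, 0), (0, 0, 0, 1), (0, 0, 1, 0))),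
      (((1, 0, 0, 0), (0, 1, 0, 0), (0, 0, 0, 1), (1, 1, -1, 0)),
       ((1, 0, 0, 0), (0, 1, 0, 0), (1, 1, 0, -1), (0, 0, 1, 0))),
      (((1, 0, 0, 0), (0, 1, 0, 0), (0, 0, 1, 0), (0, -1, 1, -1)),
       ((1, 0, 0, 0), (0, 1, 0, 0), (0, 0, 1, 0), (0, -1, 1, -1)))]⟩]

/-- The change of basis of a quinary lattice that fixes the first vector and maps the others to the
vectors with the given coordinates. -/
def columns (T : Vec4 × Vec4 × Vec4 × Vec4) : Matrix (Fin 5) (Fin 5) ℤ :=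
  !![1, 0, 0, 0, 0;
     0, T.1.1, T.2.1.1, T.2.2.1.1, T.2.2.2.1;
     0, T.1.2.1, T.2.1.2.1, T.2.2.1.2.1, T.2.2.2.2.1;
     0, T.1.2.2.1, T.2.1.2.2.1, T.2.2.1.2.2.1, T.2.2.2.2.2.1;
     0, T.1.2.2.2, T.2.1.2.2.2, T.2.2.1.2.2.2, T.2.2.2.2.2.2]

/-- The parameters with respect to a new basis. -/
def transform (c : Param) (T : Vec4 × Vec4 × Vec4 × Vec4) : Param :=
  ((bil c T.1 T.2.2.1, bil c T.2.1 T.2.2.1, bil c T.2.2.1 T.2.2.1),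
   (bil c T.1 T.2.2.2, bil c T.2.1 T.2.2.2, bil c T.2.2.1 T.2.2.2, bil c T.2.2.2 T.2.2.2))

/-- Are the parameters in the table? -/
def inTable (c : Param) : Bool :=
  table.any fun row => decide (row.1 = c.1) && decide (c.2 ∈ row.2)

/-- Does a change of basis in the list lead to an entry of the table? -/
def movesToTable (c : Param)
    (l : List ((Vec4 × Vec4 × Vec4 × Vec4) × (Vec4 × Vec4 × Vec4 × Vec4))) : Bool :=
  l.any fun p => decide (bil c p.1.1 p.1.1 = 2) && decide (bil c p.1.1 p.1.2.1 = 0) &&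
    decide (bil c p.1.2.1 p.1.2.1 = 2) && inTable (transform c p.1)

/-- Is there a vector outside of the span of the first two basis vectors that is shorter than the
third? -/
def hasShorter (c : Param) : Bool :=
  (List.range c.1.2.2.toNat).any fun n => (vecs c n).any fun u => decide (u.2.2 ≠ (0, 0))

/-- Is there a sublattice in the list that the form does not represent? -/
def hasMissing (c : Param) (l : List Vec4) : Bool := l.any fun S => !reps c (sublattice S)

/-- The lattice is not positive definite, or it leads to an entry of the table, or it is excluded. -/
def Escalation.classifies (E : Escalation) (c : Param) : Bool :=
  decide (disc4 c ≤ 0) || inTable c || movesToTable c E.moves || hasShorter c || hasMissing c E.tests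

/-- Every lattice that arises from the escalation `E` leads to an entry of the table or is excluded. -/
def Escalation.isClassified (E : Escalation) : Bool :=
  E.residues.all fun r =>
    withInt (disc3 E.a) fun m => withInt (2 * m * (sublattice E.sub).2.2) fun bound =>
    withInt (2 * r.2.2 - E.a.1 * r.1 - E.a.2.1 * r.2.1) fun k =>
    withInt ((bound + k * k + m * (r.1 * r.1 + r.2.1 * r.2.1)) / (2 * m)) fun top =>
    (List.range (top.toNat + 1)).all fun n =>
      decide (bound < disc4 (E.a, r.1, r.2.1, r.2.2, n)) ||
        E.classifies (E.a, r.1, r.2.1, r.2.2, n)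

/-- Every residue class contains one of the representatives, up to sign. -/
def Escalation.residuesSuffice (E : Escalation) : Bool :=
  [0, 1].all fun b₁ => [0, 1].all fun b₂ => (List.range (disc3 E.a).toNat).all fun b₃ : ℕ =>
  E.residues.any fun r => [1, -1].any fun ε =>
  withInt (r.1 - ε * b₁) fun d₁ => withInt (r.2.1 - ε * b₂) fun d₂ =>
  withInt (r.2.2 - ε * b₃) fun d₃ =>
  withInt (((2 * E.a.2.2 - E.a.2.1 * E.a.2.1) * d₁ + E.a.1 * E.a.2.1 * d₂ - 2 * E.a.1 * d₃) /
    (2 * disc3 E.a)) fun s =>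
  withInt ((E.a.1 * E.a.2.1 * d₁ + (2 * E.a.2.2 - E.a.1 * E.a.1) * d₂ - 2 * E.a.2.1 * d₃) /
    (2 * disc3 E.a)) fun t =>
  withInt ((4 * d₃ - 2 * E.a.1 * d₁ - 2 * E.a.2.1 * d₂) / (2 * disc3 E.a)) fun k =>
  decide (2 * s + E.a.1 * k = d₁) && decide (2 * t + E.a.2.1 * k = d₂) &&
    decide (E.a.1 * s + E.a.2.1 * t + E.a.2.2 * k = d₃)

/-- The finite core of the classification: all Gram matrices allowed by the residues and the
determinant bound are examined. -/
theorem forall_isClassified : ∀ E ∈ escalations, E.isClassified = true := by decide +kernel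

theorem forall_residuesSuffice : ∀ E ∈ escalations, E.residuesSuffice = true := by decide +kernel

/-- A fourth vector orthogonal to the others and of norm 1000 is too long to take part, so this
concerns `⟨1⟩` and the ternary lattice alone. -/
theorem reps_sub_eq_false :
    ∀ E ∈ escalations, reps (E.a, 0, 0, 0, 1000) (sublattice E.sub) = false := by decide +kernel

theorem columns_mul_columns :
    ∀ E ∈ escalations, ∀ p ∈ E.moves, columns p.1 * columns p.2 = 1 := by decide +kernel

/-- This is where 29 enters: it bounds the indices of all sublattices used, and `(5, 2, 2, -5)`
attains it. -/
theorem sublatticeIndex_mem : ∀ E ∈ escalations, ∀ S ∈ E.sub :: E.tests,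
    1 < sublatticeIndex S ∧ sublatticeIndex S ≤ 29 := by decide +kernel

theorem sublattice_sub_le : ∀ E ∈ escalations, (sublattice E.sub).1 ≤ (sublattice E.sub).2.2 := by
  decide +kernel

theorem disc3_escalations : ∀ E ∈ escalations, 0 < disc3 E.a := by decide +kernel

/-! ### Every candidate is isometric to an entry of the table -/

theorem IsCandidate.represents_sublattice {k N : ℕ} {L : Matrix (Fin k) (Fin k) ℤ}
    (hL : IsCandidate N L) {S : Vec4} (h1 : 1 < sublatticeIndex S) (hN : sublatticeIndex S ≤ N) :
    Represents L (binary (sublattice S)) := by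
  have hdet : (!![S.1, S.2.2.1; S.2.1, S.2.2.2]).det.natAbs = sublatticeIndex S := by
    rw [det_fin_two_of, sublatticeIndex]
  have h := hL.2.1 !![S.1, S.2.2.1; S.2.1, S.2.2.2] (hdet ▸ h1) (hdet ▸ hN)
  convert h using 1
  ext i j
  fin_cases i <;> fin_cases j <;>
    (simp [binary, sublattice, I2, Matrix.mul_apply, Fin.sum_univ_two]; try ring)

theorem IsForm.of_isometric {n m : ℕ} {L : Matrix (Fin n) (Fin n) ℤ}
    {M : Matrix (Fin m) (Fin m) ℤ} (hL : IsForm L) (h : Isometric L M) : IsForm M := by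
  obtain ⟨T, S, hTS, hST, rfl⟩ := h
  have hinj : Function.Injective ((T.map (Int.cast : ℤ → ℝ)).mulVec) := by
    refine Function.LeftInverse.injective (g := (S.map (Int.cast : ℤ → ℝ)).mulVec) fun x => ?_
    have h1 : S.map (Int.cast : ℤ → ℝ) * T.map (Int.cast : ℤ → ℝ) = 1 := by
      have h2 := congrArg (fun M => Matrix.map M (Int.castRingHom ℝ)) hST
      rw [Matrix.map_mul] at h2
      simpa [Matrix.map_one] using h2
    rw [mulVec_mulVec, h1, one_mulVec]
  have h2 := hL.conjTranspose_mul_mul_same hinj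
  rw [IsForm]
  have h3 : (Tᵀ * L * T).map (Int.cast : ℤ → ℝ) = (T.map (Int.cast : ℤ → ℝ))ᴴ *
      L.map (Int.cast : ℤ → ℝ) * T.map (Int.cast : ℤ → ℝ) := by
    have h4 : ∀ {p q r : ℕ} (X : Matrix (Fin p) (Fin q) ℤ) (Y : Matrix (Fin q) (Fin r) ℤ),
        (X * Y).map (Int.cast : ℤ → ℝ) = X.map (Int.cast : ℤ → ℝ) * Y.map (Int.cast : ℤ → ℝ) :=
      fun X Y => Matrix.map_mul (f := Int.castRingHom ℝ)
    rw [h4, h4]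
    congr 2
  rw [h3]
  exact h2

theorem IsCandidate.of_isometric {n m N : ℕ} {L : Matrix (Fin n) (Fin n) ℤ}
    {M : Matrix (Fin m) (Fin m) ℤ} (hL : IsCandidate N L) (h : Isometric L M) :
    IsCandidate N M :=
  ⟨hL.1.of_isometric h, fun S h1 h2 => h.represents_iff.1 (hL.2.1 S h1 h2),
    fun h1 => hL.2.2 (h.represents_iff.2 h1)⟩

theorem gram_mem_tableGrams {c : Param} (h : inTable c = true) : gram c.1 c.2 ∈ tableGrams := by
  simp only [inTable, List.any_eq_true, Bool.and_eq_true, decide_eq_true_eq] at h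
  obtain ⟨row, h1, h2, h3⟩ := h
  rw [tableGrams, List.mem_flatMap]
  exact ⟨row, h1, List.mem_map.2 ⟨c.2, h3, by rw [h2]⟩⟩

/-- The first two new basis vectors need separate hypotheses because `transform` records only the
other entries of the Gram matrix. -/
theorem isometric_transform {c : Param} {T S : Vec4 × Vec4 × Vec4 × Vec4}
    (h : columns T * columns S = 1) (h11 : bil c T.1 T.1 = 2) (h12 : bil c T.1 T.2.1 = 0)
    (h22 : bil c T.2.1 T.2.1 = 2) :
    Isometric (gram c.1 c.2) (gram (transform c T).1 (transform c T).2) := by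
  refine ⟨columns T, columns S, h, mul_eq_one_comm.1 h, ?_⟩
  have h21 : bil c T.2.1 T.1 = 0 := by rw [bil_comm, h12]
  ext i j
  rw [← toBilin'_columns, toBilin'_gram]
  fin_cases i <;> fin_cases j <;>
    simp [columns, gram, transform, bil_zero_left, bil_comm c _ (0, 0, 0, 0), h11, h12, h21, h22,
      bil_comm c T.2.2.1 T.1, bil_comm c T.2.2.1 T.2.1, bil_comm c T.2.2.2 T.1,
      bil_comm c T.2.2.2 T.2.1, bil_comm c T.2.2.2 T.2.2.1]

theorem exists_isometric_of_movesToTable {E : Escalation} (hE : E ∈ escalations) {c : Param}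
    (h : movesToTable c E.moves = true) :
    ∃ M ∈ tableGrams, Isometric (gram c.1 c.2) M := by
  simp only [movesToTable, List.any_eq_true, Bool.and_eq_true, decide_eq_true_eq] at h
  obtain ⟨p, hp, ⟨⟨h11, h12⟩, h22⟩, ht⟩ := h
  exact ⟨_, gram_mem_tableGrams ht, isometric_transform (columns_mul_columns E hE p hp) h11 h12 h22⟩

/-- Reduction of the inner products of a fourth vector with the basis of a ternary lattice. -/
theorem exists_residue {E : Escalation} (hE : E ∈ escalations) (b₁ b₂ b₃ : ℤ) :
    ∃ ε s t k : ℤ, ε * ε = 1 ∧ (ε * b₁ + 2 * s + E.a.1 * k, ε * b₂ + 2 * t + E.a.2.1 * k,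
      ε * b₃ + E.a.1 * s + E.a.2.1 * t + E.a.2.2 * k) ∈ E.residues := by
  have hm := disc3_escalations E hE
  have hall := forall_residuesSuffice E hE
  simp only [Escalation.residuesSuffice, withInt_eq, List.all_eq_true, List.any_eq_true,
    Bool.and_eq_true, decide_eq_true_eq, List.mem_range] at hall
  -- `x` is the third inner product after `b₁ / 2` times `v₁` and `b₂ / 2` times `v₂` have been
  -- subtracted.
  obtain ⟨x, hx⟩ : ∃ x, x = b₃ - E.a.1 * (b₁ / 2) - E.a.2.1 * (b₂ / 2) := ⟨_, rfl⟩
  have hd : disc3 E.a = 2 * E.a.2.2 - E.a.1 * E.a.1 - E.a.2.1 * E.a.2.1 := rfl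
  have hx0 := Int.emod_nonneg x hm.ne'
  have hx1 := Int.emod_lt_of_pos x hm
  obtain ⟨r, hr, ε, hε, ⟨h1, h2⟩, h3⟩ := hall (b₁ % 2) (by simp; omega) (b₂ % 2) (by simp; omega)
    (x % disc3 E.a).toNat (by omega)
  rw [Int.toNat_of_nonneg hx0] at h1 h2 h3
  generalize ((2 * E.a.2.2 - E.a.2.1 * E.a.2.1) * _ + _ - _) / (2 * disc3 E.a) = s at h1 h2 h3
  generalize (E.a.1 * E.a.2.1 * _ + _ - _) / (2 * disc3 E.a) = t at h1 h2 h3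
  generalize (4 * _ - _ - _) / (2 * disc3 E.a) = k at h1 h2 h3
  have e1 := Int.emod_add_mul_ediv b₁ 2
  have e2 := Int.emod_add_mul_ediv b₂ 2
  have e3 := Int.emod_add_mul_ediv x (disc3 E.a)
  set q := x / disc3 E.a
  -- Besides these halves, `2 v₃ - a₁ v₁ - a₂ v₂` is subtracted `q` times. It is orthogonal to `v₁,
  -- v₂` and its product with `v₃` is `disc3`, so it reduces `x` modulo `disc3`.
  refine ⟨ε, s + ε * (E.a.1 * q - b₁ / 2), t + ε * (E.a.2.1 * q - b₂ / 2), k - 2 * ε * q, ?_, ?_⟩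
  · simp at hε
    rcases hε with rfl | rfl <;> rfl
  · convert hr using 1
    ext
    · simp only
      linear_combination h1 - ε * e1
    · simp only
      linear_combination h2 - ε * e2
    · simp only
      linear_combination h3 - ε * e3 + ε * q * hd - ε * hx

theorem exists_escalation {a : ℤ × ℤ × ℤ} (h1 : a.1 = 0 ∨ a.1 = 1) (h2 : a.2.1 = 0 ∨ a.2.1 = 1)
    (h12 : a.1 ≤ a.2.1) (h3 : 2 ≤ a.2.2) (h3' : a.2.2 ≤ 5) : ∃ E ∈ escalations, E.a = a := by
  have key : ∀ a₁ ∈ ([0, 1] : List ℤ), ∀ a₂ ∈ ([0, 1] : List ℤ), ∀ a₃ ∈ ([2, 3, 4, 5] : List ℤ),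
      a₁ ≤ a₂ → ∃ E ∈ escalations, E.a = (a₁, a₂, a₃) := by decide +kernel
  obtain ⟨a₁, a₂, a₃⟩ := a
  simp only at h1 h2 h12 h3 h3'
  exact key a₁ (by simpa) a₂ (by simpa) a₃ (by simp; omega) h12

/-- The sublattices of index 2 with forms `⟨1, 4⟩` and `⟨2, 2⟩` give the frame, and `(2, 1, 5)` of
index 3 gives a vector of norm at most 5 outside its plane. -/
theorem isCandidate_exists_flag {L : Matrix (Fin 5) (Fin 5) ℤ} (hL : IsCandidate 29 L) :
    ∃ e v₁ v₂ v₃, Flag (Matrix.toBilin' L) e v₁ v₂ v₃ ∧ ∃ E ∈ escalations,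
      E.a = (Matrix.toBilin' L v₁ v₃, Matrix.toBilin' L v₂ v₃, Matrix.toBilin' L v₃ v₃) := by
  have hB := hL.1.posSymm
  obtain ⟨e, -, he, -⟩ := (hL.represents_sublattice (S := (1, 0, 0, 2)) (by decide)
    (by decide)).exists_vectors
  obtain ⟨t₁, t₂, h11, h12, h22⟩ := (hL.represents_sublattice (S := (1, 1, 1, -1)) (by decide)
    (by decide)).exists_vectors
  obtain ⟨u₁, u₂, hu11, hu12, hu22⟩ := (hL.represents_sublattice (S := (1, 1, 2, -1)) (by decide)
    (by decide)).exists_vectors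
  simp only [sublattice] at he h11 h12 h22
  norm_num at he h11 h12 h22
  -- Together with `e`, such a unit vector would represent `I2`.
  have hunit : ∀ x, Matrix.toBilin' L e x = 0 → Matrix.toBilin' L x x ≠ 1 := by
    intro x hx h1
    have h2 : ∀ i j, Matrix.toBilin' L (![e, x] i) (![e, x] j) = I2 i j := by
      intro i j
      fin_cases i <;> fin_cases j <;> simp [I2, he, hx, h1, hB.symm x e]
    refine hL.2.2 ⟨(Matrix.of ![e, x])ᵀ, ?_⟩
    ext i j
    rw [← toBilin'_columns]
    exact h2 i j
  have f := exists_frame hB he hunit h11 h12 h22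
  -- The two vectors of norm 1000 are placeholders, too long to matter.
  have hno : ¬ Represents (gram (0, 0, 1000) (0, 0, 0, 1000)) (binary (sublattice (1, 1, 2, -1))) := by
    have h1 := reps_iff (c := ((0, 0, 1000), (0, 0, 0, 1000))) (by decide) (by decide)
      (g := sublattice (1, 1, 2, -1))
    rw [← h1]
    decide +kernel
  obtain ⟨w, hew, hww, hw⟩ := f.exists_notMem hB hu11 hu12 hu22 hno
  have hww' : Matrix.toBilin' L w w ≤ 5 := hww.trans (by decide)
  obtain ⟨v₃, fl, hv3, ha1, ha2⟩ := f.exists_flag hB hew hw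
  have h3 : 2 ≤ Matrix.toBilin' L v₃ v₃ := by
    have h1 := hunit v₃ fl.e3
    have h2 := hB.pos v₃ (by rintro rfl; exact fl.notMem (Submodule.zero_mem _))
    omega
  -- The escalations list only `a₁ ≤ a₂`; exchanging `v₁` and `v₂` achieves this.
  by_cases hle : Matrix.toBilin' L t₁ v₃ ≤ Matrix.toBilin' L t₂ v₃
  · exact ⟨e, t₁, t₂, v₃, fl, exists_escalation ha1 ha2 hle h3 (hv3.trans hww')⟩
  · exact ⟨e, t₂, t₁, v₃, fl.swap hB, exists_escalation ha2 ha1 (not_le.1 hle).le h3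
      (hv3.trans hww')⟩

/-- Every form that represents the proper sublattices of `I2` of index at most `29`, but not `I2`,
is isometric to an entry of the table. -/
theorem IsCandidate.exists_isometric {L : Matrix (Fin 5) (Fin 5) ℤ} (hL : IsCandidate 29 L) :
    ∃ M ∈ tableGrams, Isometric L M := by
  have hB := hL.1.posSymm
  obtain ⟨e, v₁, v₂, v₃, f, E, hE, hEa⟩ := isCandidate_exists_flag hL
  have hidx := sublatticeIndex_mem E hE
  obtain ⟨t₁, t₂, h11, h12, h22⟩ :=
    (hL.represents_sublattice (hidx E.sub (by simp)).1 (hidx E.sub (by simp)).2).exists_vectors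
  have hno : ¬ Represents (gram E.a (0, 0, 0, 1000)) (binary (sublattice E.sub)) := by
    have hm := disc3_escalations E hE
    rw [← reps_iff (c := (E.a, 0, 0, 0, 1000)) hm (by simp [disc4, last, mix]; omega),
      reps_sub_eq_false E hE]
    exact Bool.false_ne_true
  rw [hEa] at hno
  obtain ⟨w, hew, hww, hw⟩ := f.exists_notMem hB h11 h12 h22 hno
  rw [max_eq_right (sublattice_sub_le E hE)] at hww
  have ha1 : E.a.1 = Matrix.toBilin' L v₁ v₃ := by rw [hEa]
  have ha2 : E.a.2.1 = Matrix.toBilin' L v₂ v₃ := by rw [hEa]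
  have ha3 : E.a.2.2 = Matrix.toBilin' L v₃ v₃ := by rw [hEa]
  have hres := exists_residue hE
  simp only [ha1, ha2, ha3] at hres
  obtain ⟨v₄, he4, hmem, hpos, hbound, hspan⟩ :=
    f.exists_basis hB (by simp) hw hew hres
  set c : Param := (E.a, Matrix.toBilin' L v₁ v₄, Matrix.toBilin' L v₂ v₄,
    Matrix.toBilin' L v₃ v₄, Matrix.toBilin' L v₄ v₄) with hc
  have hdisc3 : disc3 E.a = 2 * Matrix.toBilin' L v₃ v₃ -
      Matrix.toBilin' L v₁ v₃ * Matrix.toBilin' L v₁ v₃ -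
      Matrix.toBilin' L v₂ v₃ * Matrix.toBilin' L v₂ v₃ := by rw [disc3, ha1, ha2, ha3]
  have hdisc4 : disc4 c = relDisc (Matrix.toBilin' L) v₁ v₂ v₃ v₄ := by
    rw [disc4, relDisc, hc, mix, last, hdisc3, ← ha1, ← ha2]
  have hiso : Isometric L (gram c.1 c.2) := by
    have hs := hB.symm
    refine isometric_of_basis rfl ![e, v₁, v₂, v₃, v₄] ?_ ?_
    · intro i j
      fin_cases i <;> fin_cases j <;>
        simp [gram, hc, ha1, ha2, ha3, f.ee, f.e1, f.e2, f.e3, he4, f.v11, f.v12, f.v22, hs v₁ e,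
          hs v₂ e, hs v₃ e, hs v₄ e, hs v₂ v₁, hs v₃ v₁, hs v₃ v₂, hs v₄ v₁, hs v₄ v₂, hs v₄ v₃]
    · intro x
      obtain ⟨s, t, k, l, hx⟩ := hspan (x - Matrix.toBilin' L e x • e) (by
        rw [map_sub, map_smul, f.ee, smul_eq_mul, mul_one, sub_self])
      refine ⟨![Matrix.toBilin' L e x, s, t, k, l], ?_⟩
      rw [sub_eq_iff_eq_add] at hx
      rw [Fin.sum_univ_five]
      simp only [Matrix.cons_val]
      refine hx.trans ?_
      abel
  have hcl := forall_isClassified E hE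
  simp only [Escalation.isClassified, withInt_eq, List.all_eq_true, List.mem_range,
    Bool.or_eq_true, decide_eq_true_eq] at hcl
  have hv4 : 0 ≤ Matrix.toBilin' L v₄ v₄ := hB.nonneg v₄
  have hm := disc3_escalations E hE
  have hb : disc4 c ≤ 2 * disc3 E.a * (sublattice E.sub).2.2 := by
    rw [hdisc4]
    refine hbound.trans ?_
    rw [← hdisc3]
    exact mul_le_mul_of_nonneg_left hww (by positivity)
  -- The determinant is linear in the norm of `v₄`; solving its bound for this norm gives the range
  -- enumerated in `isClassified`.
  have hcase := hcl _ hmem (Matrix.toBilin' L v₄ v₄).toNat (by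
    rw [Nat.lt_succ_iff]
    refine Int.toNat_le_toNat ((Int.le_ediv_iff_mul_le (by positivity)).2 ?_)
    have h1 : disc4 c = disc3 E.a * last c - mix c * mix c := rfl
    rw [h1] at hb
    simp only [last, mix, hc] at hb
    nlinarith)
  simp only [Int.toNat_of_nonneg hv4, ← hc, Escalation.classifies, Bool.or_eq_true,
    decide_eq_true_eq] at hcase
  have hm' : 0 < disc3 c.1 := hm
  have hD : 0 < disc4 c := hdisc4 ▸ hpos
  -- The first two cases violate the bounds for the determinant and the next two reach the table;
  -- then a shorter vector contradicts the minimality of `v₃`, and a missing sublattice contradicts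
  -- that `L` is a candidate.
  rcases hcase with h | ((((h | h) | h) | h) | h)
  · exact absurd hb h.not_ge
  · exact absurd hD h.not_gt
  · exact ⟨_, gram_mem_tableGrams h, hiso⟩
  · obtain ⟨M, hM, h1⟩ := exists_isometric_of_movesToTable hE h
    exact ⟨M, hM, hiso.trans h1⟩
  · exfalso
    simp only [hasShorter, List.any_eq_true, List.mem_range, decide_eq_true_eq] at h
    obtain ⟨n, hn, u, hu, hne⟩ := h
    rw [mem_vecs hm' hD] at hu
    have h1 := f.le_norm hB he4 hpos (s := u.1) (t := u.2.1) (k := u.2.2.1) (l := u.2.2.2) (by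
      by_contra! h0
      exact hne (Prod.ext h0.1 h0.2))
    have h2 : Matrix.toBilin' L (u.1 • v₁ + u.2.1 • v₂ + u.2.2.1 • v₃ + u.2.2.2 • v₄)
        (u.1 • v₁ + u.2.1 • v₂ + u.2.2.1 • v₃ + u.2.2.2 • v₄) = bil c u u := by
      have hs := hB.symm
      simp only [map_add, map_smul, LinearMap.add_apply, LinearMap.smul_apply, smul_eq_mul, bil,
        dual, hc, ha1, ha2, ha3, f.v11, f.v12, f.v22, hs v₂ v₁, hs v₃ v₁, hs v₃ v₂, hs v₄ v₁,
        hs v₄ v₂, hs v₄ v₃]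
      ring
    rw [h2, hu, ← ha3] at h1
    have h3 : c.1.2.2 = E.a.2.2 := rfl
    omega
  · exfalso
    simp only [hasMissing, List.any_eq_true] at h
    obtain ⟨S, hS, hS'⟩ := h
    have h1 := hidx S (List.mem_cons_of_mem _ hS)
    rw [(reps_iff hm' hD).2 (hiso.represents_iff.1 (hL.represents_sublattice h1.1 h1.2))] at hS'
    exact Bool.false_ne_true hS'

end QuadIsolation
namespace QuadIsolation

open Matrix

/-! ### The entries of the table are forms -/

/-- Multiplied by `2 * disc3`, the form is a sum of five squares of triangular linear forms with
positive weights. -/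
theorem isForm_gram {c : Param} (h3 : 0 < disc3 c.1) (h4 : 0 < disc4 c) :
    IsForm (gram c.1 c.2) := by
  obtain ⟨⟨a₁, a₂, a₃⟩, b₁, b₂, b₃, b₄⟩ := c
  refine Matrix.PosDef.of_dotProduct_mulVec_pos ?_ ?_
  · ext i j
    fin_cases i <;> fin_cases j <;> simp [gram]
  · intro x hx
    have h3' : (0 : ℝ) < 2 * a₃ - a₁ * a₁ - a₂ * a₂ := by
      exact_mod_cast h3
    have h4' : (0 : ℝ) < (2 * a₃ - a₁ * a₁ - a₂ * a₂) * (2 * b₄ - b₁ * b₁ - b₂ * b₂) -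
        (2 * b₃ - a₁ * b₁ - a₂ * b₂) * (2 * b₃ - a₁ * b₁ - a₂ * b₂) := by
      exact_mod_cast h4
    set m : ℝ := 2 * a₃ - a₁ * a₁ - a₂ * a₂ with hm
    set l : ℝ := 2 * b₄ - b₁ * b₁ - b₂ * b₂ with hl
    set r : ℝ := 2 * b₃ - a₁ * b₁ - a₂ * b₂ with hr
    have key : 2 * m * (star x ⬝ᵥ ((gram (a₁, a₂, a₃) (b₁, b₂, b₃, b₄)).map
        (Int.cast : ℤ → ℝ)) *ᵥ x) = 2 * m * x 0 ^ 2 + m * (2 * x 1 + (a₁ * x 3 + b₁ * x 4)) ^ 2 +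
        m * (2 * x 2 + (a₂ * x 3 + b₂ * x 4)) ^ 2 + (m * x 3 + r * x 4) ^ 2 +
        (m * l - r * r) * x 4 ^ 2 := by
      simp [dotProduct, mulVec, gram, Fin.sum_univ_succ]
      rw [hm, hl, hr]
      ring
    refine pos_of_mul_pos_right (a := 2 * m) ?_ (by positivity)
    rw [key]
    by_contra! hle
    -- The coordinates `x 4` and `x 3` come first because they occur in the squares for the others.
    have e4 : x 4 = 0 := by
      by_contra h
      have : 0 < (m * l - r * r) * x 4 ^ 2 := by positivity
      linarith [show 0 ≤ 2 * m * x 0 ^ 2 + m * (2 * x 1 + (a₁ * x 3 + b₁ * x 4)) ^ 2 +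
        m * (2 * x 2 + (a₂ * x 3 + b₂ * x 4)) ^ 2 + (m * x 3 + r * x 4) ^ 2 by positivity]
    simp only [e4, mul_zero, add_zero, ne_eq, OfNat.ofNat_ne_zero, not_false_eq_true,
      zero_pow] at hle
    have e3 : x 3 = 0 := by
      by_contra h
      have : 0 < (m * x 3) ^ 2 := by positivity
      linarith [show 0 ≤ 2 * m * x 0 ^ 2 + m * (2 * x 1 + a₁ * x 3) ^ 2 +
        m * (2 * x 2 + a₂ * x 3) ^ 2 by positivity]
    simp only [e3, mul_zero, add_zero, ne_eq, OfNat.ofNat_ne_zero, not_false_eq_true,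
      zero_pow] at hle
    have e2 : x 2 = 0 := by
      by_contra h
      have : 0 < m * (2 * x 2) ^ 2 := by positivity
      linarith [show 0 ≤ 2 * m * x 0 ^ 2 + m * (2 * x 1) ^ 2 by positivity]
    have e1 : x 1 = 0 := by
      by_contra h
      have : 0 < m * (2 * x 1) ^ 2 := by positivity
      linarith [show 0 ≤ 2 * m * x 0 ^ 2 + m * (2 * x 2) ^ 2 by positivity]
    have e0 : x 0 = 0 := by
      by_contra h
      have : 0 < 2 * m * x 0 ^ 2 := by positivity
      linarith [show 0 ≤ m * (2 * x 1) ^ 2 + m * (2 * x 2) ^ 2 by positivity]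
    refine hx (funext fun i => ?_)
    fin_cases i <;> simp [e0, e1, e2, e3, e4]

/-- The parameters of the entries of the table. -/
def tableParams : List Param := table.flatMap fun row => row.2.map fun b => (row.1, b)

theorem tableGrams_eq : tableGrams = tableParams.map fun c => gram c.1 c.2 := by
  simp only [tableGrams, tableParams, List.map_flatMap, List.map_map, Function.comp_def]

theorem tableParams_disc : ∀ c ∈ tableParams, 0 < disc3 c.1 ∧ 0 < disc4 c := by decide +kernel

/-- `(1, 0, 1)` is `I2`; the completeness of `reps` makes the negative answer conclusive. -/
theorem tableParams_reps_eq_false : ∀ c ∈ tableParams, reps c (1, 0, 1) = false := by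
  decide +kernel

theorem I2_eq_binary : I2 = binary (1, 0, 1) := by
  ext i j
  fin_cases i <;> fin_cases j <;> rfl

/-! ### Sublattices of prime index -/

/-- Bases of all sublattices of `ℤ²` whose index is a prime number less than `30`. -/
def primeSublattices : List Vec4 :=
  [2, 3, 5, 7, 11, 13, 17, 19, 23, 29].flatMap fun p : ℕ =>
    (1, 0, 0, (p : ℤ)) :: (List.range p).map fun k : ℕ => ((k : ℤ), 1, (p : ℤ), 0)

/-- A singular matrix over the field with `p` elements has proportional rows: the second is zero or
the first is a multiple of it. -/
theorem exists_row_relation {p : ℕ} [Fact p.Prime] {a b c d : ℤ} (h : (p : ℤ) ∣ a * d - b * c) :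
    ((p : ℤ) ∣ c ∧ (p : ℤ) ∣ d) ∨ ∃ k < p, (p : ℤ) ∣ a - k * c ∧ (p : ℤ) ∣ b - k * d := by
  simp only [← ZMod.intCast_zmod_eq_zero_iff_dvd] at h ⊢
  push_cast at h ⊢
  by_cases hc : (c : ZMod p) = 0
  · by_cases hd : (d : ZMod p) = 0
    · exact Or.inl ⟨hc, hd⟩
    · refine Or.inr ⟨((b : ZMod p) / d).val, ZMod.val_lt _, ?_, ?_⟩
      · rw [ZMod.natCast_zmod_val, hc, mul_zero, sub_zero]
        simpa [hc, hd] using h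
      · rw [ZMod.natCast_zmod_val]
        field_simp
        ring
  · refine Or.inr ⟨((a : ZMod p) / c).val, ZMod.val_lt _, ?_, ?_⟩
    · rw [ZMod.natCast_zmod_val]
      field_simp
      ring
    · rw [ZMod.natCast_zmod_val]
      field_simp
      linear_combination -h

theorem represents_binary {g : ℤ × ℤ × ℤ} {h : ℤ × ℤ × ℤ} (a b c d : ℤ)
    (h1 : g.1 * a ^ 2 + 2 * g.2.1 * a * c + g.2.2 * c ^ 2 = h.1)
    (h2 : g.1 * a * b + g.2.1 * (a * d + b * c) + g.2.2 * c * d = h.2.1)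
    (h3 : g.1 * b ^ 2 + 2 * g.2.1 * b * d + g.2.2 * d ^ 2 = h.2.2) :
    Represents (binary g) (binary h) := by
  refine ⟨!![a, b; c, d], ?_⟩
  ext i j
  fin_cases i <;> fin_cases j <;>
    simp [binary, Matrix.mul_apply, Fin.sum_univ_two, ← h1, ← h2, ← h3] <;> ring

theorem transpose_mul_I2_mul (S : Matrix (Fin 2) (Fin 2) ℤ) :
    Sᵀ * I2 * S = binary (sublattice (S 0 0, S 1 0, S 0 1, S 1 1)) := by
  ext i j
  fin_cases i <;> fin_cases j <;>
    (simp [binary, sublattice, I2, Matrix.mul_apply, Fin.sum_univ_two]; try ring)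

/-- Modulo a prime factor `p` of the index, the row relation is a congruence satisfied by all
columns of `S`. It defines a sublattice of index `p` that contains them, so only prime indices need
to be checked. -/
theorem exists_primeSublattice {S : Matrix (Fin 2) (Fin 2) ℤ} (h1 : 1 < S.det.natAbs)
    (h2 : S.det.natAbs ≤ 29) :
    ∃ P ∈ primeSublattices, Represents (binary (sublattice P)) (Sᵀ * I2 * S) := by
  have hp : S.det.natAbs.minFac.Prime := Nat.minFac_prime (by omega)
  have hdvd : S.det.natAbs.minFac ∣ S.det.natAbs := Nat.minFac_dvd _
  have hle : S.det.natAbs.minFac ≤ 29 := (Nat.minFac_le (by omega)).trans h2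
  generalize S.det.natAbs.minFac = p at hp hdvd hle
  have hmem : p ∈ [2, 3, 5, 7, 11, 13, 17, 19, 23, 29] := by
    revert hp
    interval_cases p <;> norm_num
  have : Fact p.Prime := ⟨hp⟩
  rw [← Int.natCast_dvd, det_fin_two] at hdvd
  rw [transpose_mul_I2_mul]
  simp only [primeSublattices, List.mem_flatMap]
  obtain ⟨⟨c, hc⟩, d, hd⟩ | ⟨k, hk, ⟨a, ha⟩, b, hb⟩ := exists_row_relation hdvd
  · refine ⟨_, ⟨p, hmem, List.mem_cons_self⟩, represents_binary (S 0 0) (S 0 1) c d ?_ ?_ ?_⟩ <;>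
      simp only [sublattice, hc, hd] <;> ring
  · refine ⟨_, ⟨p, hmem, List.mem_cons_of_mem _ (List.mem_map.2 ⟨k, List.mem_range.2 hk, rfl⟩)⟩,
      represents_binary (S 1 0) (S 1 1) a b ?_ ?_ ?_⟩ <;>
      simp only [sublattice, sub_eq_iff_eq_add.1 ha, sub_eq_iff_eq_add.1 hb] <;> ring

/-! ### Reduction of binary forms -/

/-- Gauss reduction of a binary form: exchanges the basis vectors such that the first is not longer
than the second, and translates the second. -/
def gaussStep (g : ℤ × ℤ × ℤ) : ℤ × ℤ × ℤ :=
  withInt (min g.1 g.2.2) fun A => withInt g.2.1 fun B => withInt (max g.1 g.2.2) fun C =>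
  withInt ((2 * B + A) / (2 * A)) fun k => (A, B - k * A, C - 2 * k * B + k ^ 2 * A)

/-- Repeated Gauss reduction, with a nonnegative middle coefficient. -/
def gaussReduce (g : ℤ × ℤ × ℤ) : ℕ → ℤ × ℤ × ℤ
  | 0 => (g.1, (g.2.1.natAbs : ℤ), g.2.2)
  | n + 1 => gaussReduce (gaussStep g) n

theorem represents_gaussStep (g : ℤ × ℤ × ℤ) : Represents (binary (gaussStep g)) (binary g) := by
  simp only [gaussStep, withInt_eq]
  generalize (2 * g.2.1 + min g.1 g.2.2) / (2 * min g.1 g.2.2) = k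
  rcases le_total g.1 g.2.2 with h | h
  · rw [min_eq_left h, max_eq_right h]
    exact represents_binary 1 k 0 1 (by ring) (by ring) (by ring)
  · rw [min_eq_right h, max_eq_left h]
    exact represents_binary k 1 1 0 (by ring) (by ring) (by ring)

/-- No claim is made that the result is reduced: it only has to represent `g` and to occur in the
certificates. -/
theorem represents_gaussReduce (g : ℤ × ℤ × ℤ) (n : ℕ) :
    Represents (binary (gaussReduce g n)) (binary g) := by
  induction n generalizing g with
  | zero =>
    rcases Int.natAbs_eq g.2.1 with h | h
    · exact represents_binary 1 0 0 1 (by simp [gaussReduce]) (by simp [gaussReduce, ← h])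
        (by simp [gaussReduce])
    · exact represents_binary 1 0 0 (-1) (by simp [gaussReduce])
        (by rw [h]; simp [gaussReduce]) (by simp [gaussReduce])
  | succ n ih => exact (ih (gaussStep g)).trans (represents_gaussStep g)

/-! ### Representations of the sublattices by the entries of the table -/

/-- A binary form with a representation `(x, u), (y, v)` by the orthogonal sum of `⟨1⟩` and a ternary
lattice. -/
abbrev TernaryRep := (ℤ × ℤ × ℤ) × ℤ × ℤ × (ℤ × ℤ × ℤ) × (ℤ × ℤ × ℤ)

/-- A basis of a ternary sublattice of a quaternary lattice. -/
abbrev Basis3 := Vec4 × Vec4 × Vec4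

/-- Vectors of a quaternary lattice `K`, and pairs of vectors `(x, u), (y, v)` of `⟨1⟩ ⊥ K`. -/
abbrev Reps := List Vec4 × List (ℤ × ℤ × Vec4 × Vec4)

/-- Certificates for the forms `⟨1⟩ ⊥ K`, where `K` contains the ternary lattice with the parameters
`a`: representations by the orthogonal sum of `⟨1⟩` and the ternary lattice; integers `n` and binary
forms such that `⟨1, n⟩` and the binary forms are represented by all `⟨1⟩ ⊥ K`; the last entries of
the parameters `(a, b)` of the lattices `K` that extend the basis of the ternary lattice, with their
representations of the integers and the binary forms; the parameters of further lattices `K` with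
bases of the ternary lattice and representations. -/
structure Cover where
  a : ℤ × ℤ × ℤ
  ternary : List TernaryRep
  squares : List ℤ
  forms : List (ℤ × ℤ × ℤ)
  own : List ((ℤ × ℤ × ℤ × ℤ) × Reps)
  others : List (Param × Basis3 × Reps)

/-- All lattices `K` of a certificate. -/
def Cover.lattices (G : Cover) : List (Param × Basis3 × Reps) :=
  (G.own.map fun d => ((G.a, d.1), ((1, 0, 0, 0), (0, 1, 0, 0), (0, 0, 1, 0)), d.2)) ++ G.others

/-- Do the vectors `(x, u)` and `(y, v)` represent the binary form `g`? -/
def isRepresentation (c : Param) (g : ℤ × ℤ × ℤ) (w : ℤ × ℤ × Vec4 × Vec4) : Bool :=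
  w.1 * w.1 + bil c w.2.2.1 w.2.2.1 == g.1 && (bil c w.2.2.1 w.2.2.2 + w.1 * w.2.1 == g.2.1 &&
    w.2.1 * w.2.1 + bil c w.2.2.2 w.2.2.2 == g.2.2)

/-- Are the inner products of the three vectors given by the parameters `a`? -/
def isTernaryBasis (c : Param) (a : ℤ × ℤ × ℤ) (t : Basis3) : Bool :=
  bil c t.1 t.1 == 2 && (bil c t.1 t.2.1 == 0 && (bil c t.2.1 t.2.1 == 2 &&
    (bil c t.1 t.2.2 == a.1 && (bil c t.2.1 t.2.2 == a.2.1 && bil c t.2.2 t.2.2 == a.2.2))))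

/-- The vector of the quaternary lattice with the coordinates `u` in the ternary lattice. -/
def combine (t : Basis3) (u : ℤ × ℤ × ℤ) : Vec4 :=
  u.1 • t.1 + u.2.1 • t.2.1 + u.2.2 • t.2.2

/-- Are the representations by the ternary lattice correct? -/
def Cover.ternaryCorrect (G : Cover) : Bool :=
  G.ternary.all fun d => isRepresentation (G.a, 0, 0, 0, 0) d.1
    (d.2.1, d.2.2.1, (d.2.2.2.1.1, d.2.2.2.1.2.1, d.2.2.2.1.2.2, 0),
      (d.2.2.2.2.1, d.2.2.2.2.2.1, d.2.2.2.2.2.2, 0))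

/-- Are the data for the lattices `K` correct? -/
def Cover.latticesCorrect (G : Cover) : Bool :=
  G.lattices.all fun d => isTernaryBasis d.1 G.a d.2.1 &&
    ((G.squares.all fun n => d.2.2.1.any fun v => bil d.1 v v == n) &&
    G.forms.all fun g => d.2.2.2.any fun w => isRepresentation d.1 g w)

/-- Does the certificate contain the binary form? -/
def Cover.hasForm (G : Cover) (g : ℤ × ℤ × ℤ) : Bool :=
  (G.ternary.any fun d => d.1 == g) || ((G.squares.any fun n => ((1, 0, n) : ℤ × ℤ × ℤ) == g) ||
    G.forms.any fun h => h == g)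

/-- Does the certificate contain all sublattices of prime index less than `30`? -/
def Cover.isComplete (G : Cover) : Bool :=
  primeSublattices.all fun P => G.hasForm (gaussReduce (sublattice P) 20)

theorem represents_of_isRepresentation {c : Param} {g : ℤ × ℤ × ℤ} {w : ℤ × ℤ × Vec4 × Vec4}
    (h : isRepresentation c g w = true) : Represents (gram c.1 c.2) (binary g) := by
  simp only [isRepresentation, Bool.and_eq_true, beq_iff_eq] at h
  exact represents_gram_iff.2 ⟨_, _, _, _, h⟩

/-- Bilinearity reduces this to the Gram matrix of the ternary basis, so a representation by the
ternary lattice transfers to every `K` that contains it. -/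
theorem bil_combine {c : Param} {a : ℤ × ℤ × ℤ} {t : Basis3}
    (h : isTernaryBasis c a t = true) (u v : ℤ × ℤ × ℤ) :
    bil c (combine t u) (combine t v) =
      bil (a, 0, 0, 0, 0) (u.1, u.2.1, u.2.2, 0) (v.1, v.2.1, v.2.2, 0) := by
  simp only [isTernaryBasis, Bool.and_eq_true, beq_iff_eq] at h
  obtain ⟨h11, h12, h22, h13, h23, h33⟩ := h
  have h21 := (bil_comm c _ _).trans h12
  have h31 := (bil_comm c _ _).trans h13
  have h32 := (bil_comm c _ _).trans h23
  have hl : ∀ x y z : Vec4, bil c (x + y) z = bil c x z + bil c y z := by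
    intro x y z
    simp only [bil, dual, Prod.fst_add, Prod.snd_add]
    ring
  have hs : ∀ (k : ℤ) (x y : Vec4), bil c (k • x) y = k * bil c x y := by
    intro k x y
    simp only [bil, dual, Prod.smul_fst, Prod.smul_snd, smul_eq_mul]
    ring
  have hr : ∀ x y z : Vec4, bil c z (x + y) = bil c z x + bil c z y := by
    intro x y z
    rw [bil_comm, hl, bil_comm c x, bil_comm c y]
  have hs' : ∀ (k : ℤ) (x y : Vec4), bil c y (k • x) = k * bil c y x := by
    intro k x y
    rw [bil_comm, hs, bil_comm]
  simp only [combine, hl, hr, hs, hs', h11, h12, h13, h21, h22, h23, h31, h32, h33]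
  simp only [bil, dual]
  ring

/-- Three sources: a shared ternary representation; the unit vector with a vector of norm `n` in
`K`, for `⟨1, n⟩`; or an individually listed pair of vectors. -/
theorem Cover.represents {G : Cover} (h1 : G.ternaryCorrect = true)
    (h2 : G.latticesCorrect = true)
    {d : Param × Basis3 × Reps}
    (hd : d ∈ G.lattices) {g : ℤ × ℤ × ℤ} (hg : G.hasForm g = true) :
    Represents (gram d.1.1 d.1.2) (binary g) := by
  simp only [Cover.latticesCorrect, List.all_eq_true, List.any_eq_true, Bool.and_eq_true,
    beq_iff_eq] at h2
  obtain ⟨ht, hs, hf⟩ := h2 d hd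
  simp only [Cover.hasForm, List.any_eq_true, Bool.or_eq_true, beq_iff_eq] at hg
  obtain ⟨w, hw, rfl⟩ | ⟨n, hn, rfl⟩ | ⟨_, hw, rfl⟩ := hg
  · have h := List.all_eq_true.1 h1 w hw
    simp only [isRepresentation, Bool.and_eq_true, beq_iff_eq] at h
    rw [represents_gram_iff]
    refine ⟨w.2.1, w.2.2.1, combine d.2.1 w.2.2.2.1, combine d.2.1 w.2.2.2.2, ?_⟩
    rw [bil_combine ht, bil_combine ht, bil_combine ht]
    exact h
  · obtain ⟨v, -, hv⟩ := hs n hn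
    rw [represents_gram_iff]
    exact ⟨1, 0, (0, 0, 0, 0), v, by simp [bil_zero_left], by simp [bil_zero_left], by simp [hv]⟩
  · obtain ⟨w, -, h⟩ := hf _ hw
    exact represents_of_isRepresentation h

/-! ### Certificate data, grouped by ternary sublattices -/

/-- Representations by the ternary lattice with the parameters `(0, 1, 2)`. -/
def cover012TernaryA : List TernaryRep := [
  ((2, 0, 2), 0, 0, (1, 0, 0), (0, 1, 0)), ((1, 0, 4), 1, 0, (0, 0, 0), (1, 1, 0)),
  ((2, 1, 5), 0, -1, (0, 1, 0), (1, 0, 1)), ((5, 0, 5), 1, -1, (1, 1, 0), (1, 0, -1)),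
  ((5, 1, 10), 1, -2, (1, 1, 0), (0, 1, 1)), ((2, 1, 13), 0, -3, (0, 1, 0), (1, 0, 1)),
  ((10, 3, 13), 0, -3, (2, 1, 0), (1, 0, -1)), ((10, 1, 17), 0, -3, (2, 1, 0), (1, -1, -1)),
  ((2, 1, 25), 0, -3, (0, 1, 0), (1, -1, 3)), ((5, 2, 25), 1, -1, (1, 1, 0), (3, -1, -1)),
  ((13, 6, 25), 3, -1, (1, 1, 0), (3, 1, 1)), ((17, 8, 25), 1, -3, (1, 2, 1), (-1, 1, 2)),
  ((25, 11, 26), 1, -4, (3, 1, 1), (2, 1, 0)), ((10, 1, 29), 0, -3, (2, 1, 0), (1, 0, -3)),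
  ((13, 4, 29), 3, -1, (1, 1, 0), (1, 1, 3)), ((29, 0, 29), 1, -5, (1, 3, 1), (-1, 1, 0)),
  ((5, 1, 34), 1, 0, (1, 1, 0), (-2, 1, 3)), ((17, 7, 34), 1, 0, (1, 2, 1), (4, -1, 1)),
  ((25, 3, 34), 1, 0, (3, 1, 1), (2, 1, -4)), ((10, 3, 37), 0, -3, (2, 1, 0), (-1, 3, 1)),
  ((26, 11, 37), 0, -3, (2, 3, 0), (-1, 1, 3)), ((13, 2, 41), 3, -3, (1, 1, 0), (3, 2, 1)),
  ((17, 3, 50), 1, -4, (1, 2, 1), (4, -1, 1)), ((10, 1, 53), 0, -5, (2, 1, 0), (-1, 1, 3)),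
  ((5, 1, 58), 1, 0, (1, 1, 0), (-2, 0, 5))]

/-- Representations by the ternary lattice with the parameters `(0, 1, 2)`. -/
def cover012TernaryB : List TernaryRep := [
  ((2, 1, 61), 0, -3, (0, 1, 0), (5, 0, 1)), ((13, 2, 65), 3, -3, (1, 1, 0), (1, 3, 3)),
  ((5, 2, 73), 1, -7, (1, 1, 0), (3, 1, 1)), ((2, 1, 85), 0, -9, (0, 1, 0), (1, 0, 1)),
  ((10, 3, 85), 0, -9, (2, 1, 0), (1, 0, -1)), ((5, 1, 106), 1, -8, (1, 1, 0), (0, 4, 1)),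
  ((2, 1, 145), 0, -9, (0, 1, 0), (5, -1, 3)), ((5, 2, 169), 1, -9, (1, 1, 0), (-1, 6, 1)),
  ((2, 1, 181), 0, -9, (0, 1, 0), (7, 0, 1)), ((2, 1, 265), 0, -15, (0, 1, 0), (1, -2, 5)),
  ((2, 1, 421), 0, -9, (0, 1, 0), (13, 0, 1))]

/-- Extensions of the basis of the ternary lattice with the parameters `(0, 1, 2)`. -/
def cover012Own : List ((ℤ × ℤ × ℤ × ℤ) × Reps) := [
  ((0, 0, 0, 5), [(1, 1, 0, 1), (3, 1, 0, 1), (1, 1, 0, 3), (1, 7, 1, 1), (9, 1, 0, 1), (1, 4, 1,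
   7), (1, 7, 1, 7), (1, 5, 4, 9), (1, 9, 3, 11)], [(0, -2, (1, 1, 1, 1), (1, 1, 0, -1)), (1, -2,
   (2, 2, 0, 0), (-1, 1, 1, 1))]),
  ((1, 1, 0, 7), [(0, 0, 1, 1), (0, 2, 1, 1), (4, 0, 1, 1), (4, 0, 1, 3), (-1, 0, 1, 5), (0, 4, 3,
   5), (1, 0, 1, 7), (-1, -2, -1, 9), (1, -2, -1, 11)], [(0, 0, (1, 0, 1, 1), (2, 0, 1, -1)), (0,
   -3, (0, 2, 1, -1), (0, 2, -2, 0))]),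
  ((0, 1, 0, 7), [(1, 0, 0, 1), (3, 0, 0, 1), (1, 4, 0, 1), (1, 4, 0, 3), (1, -1, 0, 5), (1, 5, 1,
   5), (1, 1, 0, 7), (1, -3, 1, 9), (1, -1, -2, 11)], [(0, -3, (1, 1, 0, 1), (1, -1, 1, 0)), (0,
   -3, (2, 0, 1, 1), (1, -1, -1, 0))]),
  ((1, 0, 0, 7), [(0, 1, 0, 1), (0, 3, 0, 1), (4, 1, 0, 1), (4, 1, 0, 3), (-1, 1, 0, 5), (5, 2, 1,
   5), (1, 1, 0, 7), (-4, 1, 0, 9), (-1, 2, 1, 11)], [(0, 0, (1, 1, 0, 1), (2, 1, 0, -1)), (0, -3,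
   (1, 1, 1, 1), (1, 1, -2, 0))]),
  ((0, 0, 0, 7), [(1, 0, 0, 1), (3, 0, 0, 1), (0, 4, 1, 1), (0, 7, 1, 1), (9, 0, 0, 1), (0, 7, 1,
   5), (3, 0, 0, 7), (0, 7, 4, 7), (2, 11, 1, 9)], [(0, -3, (0, 1, 1, 1), (1, 1, -1, 0)), (0, -1,
   (2, 1, 0, 1), (1, -1, -2, 0))]),
  ((1, 1, 0, 9), [(0, 0, 0, 1), (2, 1, 0, 1), (4, 0, 0, 1), (2, 2, 0, 3), (5, 1, 0, 3), (4, -1, 0,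
   5), (0, 4, 4, 5), (4, 0, 0, 7), (4, 0, 2, 9)], [(0, -3, (0, 1, 0, 1), (1, 0, -1, 0)), (0, -1,
   (1, 1, 0, 1), (2, -2, 0, 0))]),
  ((0, 1, 0, 9), [(0, 0, 0, 1), (0, 1, 2, 1), (0, 4, 0, 1), (4, 1, 0, 3), (2, 5, 0, 3), (2, 3, 1,
   5), (0, 4, 4, 5), (0, 4, 0, 7), (2, 4, 0, 9)], [(0, -3, (1, 0, 1, 1), (1, 0, -1, 0)), (0, -3,
   (2, 0, 0, 1), (0, 0, 2, 0))]),
  ((0, 0, 0, 9), [(0, 0, 0, 1), (2, 2, 0, 1), (4, 2, 0, 1), (4, 2, 0, 3), (1, 6, 1, 3), (1, 5, 1,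
   5), (8, 2, 0, 5), (1, 6, 1, 7), (7, 2, 1, 9)], [(0, -3, (1, 1, 0, 1), (1, -1, 0, 0)), (0, -3,
   (2, 0, 0, 1), (0, 2, 0, 0))])]

/-- The certificate for the ternary lattice with the parameters `(0, 1, 2)`. -/
def cover012 : Cover where
  a := (0, 1, 2)
  ternary := cover012TernaryA ++ cover012TernaryB
  squares := [9, 25, 49, 121, 169, 289, 361, 529, 841]
  forms := [(13, 0, 13), (17, 0, 17)]
  own := cover012Own
  others := []

/-- Representations by the ternary lattice with the parameters `(0, 1, 3)`. -/
def cover013TernaryA : List TernaryRep := [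
  ((2, 0, 2), 0, 0, (1, 0, 0), (0, 1, 0)), ((1, 0, 4), 1, 0, (0, 0, 0), (1, 1, 0)),
  ((2, 1, 5), 0, 0, (0, 1, 0), (1, 0, 1)), ((5, 0, 5), 0, 0, (1, 0, 1), (1, 1, -1)),
  ((1, 0, 9), 1, 0, (0, 0, 0), (1, 1, 1)), ((5, 1, 10), 0, -1, (1, 0, 1), (1, 2, -1)),
  ((10, 3, 13), 1, -2, (1, 1, 1), (-1, 1, 1)), ((13, 0, 13), 1, -2, (0, 0, 2), (1, -2, 1)),
  ((10, 1, 17), 0, 0, (2, 1, 0), (-1, 2, 1)), ((1, 0, 25), 1, 0, (0, 0, 0), (3, 1, 1)),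
  ((2, 1, 25), 0, -2, (0, 1, 0), (3, 0, 1)), ((5, 2, 25), 0, -4, (1, 0, 1), (-1, 1, 1)),
  ((13, 6, 25), 1, 2, (0, 0, 2), (3, -1, 1)), ((17, 8, 25), 0, -4, (1, 2, 1), (-1, 1, 1)),
  ((25, 11, 26), 0, -3, (3, 1, 1), (1, 3, -1)), ((10, 1, 29), 0, 0, (2, 1, 0), (1, 0, -3)),
  ((13, 4, 29), 1, 2, (0, 0, 2), (3, -2, 1)), ((5, 1, 34), 0, -5, (1, 0, 1), (1, 2, -1)),
  ((17, 7, 34), 0, -5, (1, 2, 1), (1, 2, -1)), ((25, 3, 34), 0, -3, (3, 1, 1), (-1, -1, 3)),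
  ((10, 3, 37), 1, -5, (1, 1, 1), (0, 0, 2)), ((26, 11, 37), 0, 0, (2, 3, 0), (-1, 1, 3)),
  ((13, 2, 41), 1, 4, (0, 0, 2), (3, 2, -1)), ((1, 0, 49), 1, 0, (0, 0, 0), (1, 2, 3)),
  ((17, 3, 50), 0, -5, (1, 2, 1), (-1, -2, 3))]

/-- Representations by the ternary lattice with the parameters `(0, 1, 3)`. -/
def cover013TernaryB : List TernaryRep := [
  ((10, 1, 53), 0, -6, (2, 1, 0), (-1, 2, 1)), ((5, 1, 58), 0, -7, (1, 0, 1), (1, 2, -1)),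
  ((2, 1, 61), 0, -6, (0, 1, 0), (1, -1, 3)), ((13, 2, 65), 1, -2, (0, 0, 2), (3, 5, -1)),
  ((5, 2, 73), 0, -8, (1, 0, 1), (-1, 1, 1)), ((2, 1, 85), 0, -8, (0, 1, 0), (3, 0, 1)),
  ((10, 3, 85), 0, -6, (2, 1, 0), (-1, 2, 3)), ((5, 1, 106), 0, -8, (1, 0, 1), (0, -5, 2)),
  ((1, 0, 121), 1, 0, (0, 0, 0), (3, 2, 5)), ((2, 1, 145), 0, -8, (0, 1, 0), (3, -2, 5)),
  ((1, 0, 169), 1, 0, (0, 0, 0), (9, 1, 1)), ((5, 2, 169), 0, -12, (1, 0, 1), (3, -1, -1)),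
  ((2, 1, 181), 0, -10, (0, 1, 0), (3, -2, 5)), ((2, 1, 265), 0, -12, (0, 1, 0), (7, -1, 3)),
  ((1, 0, 289), 1, 0, (0, 0, 0), (1, 2, 9)), ((1, 0, 361), 1, 0, (0, 0, 0), (3, 1, -11)),
  ((2, 1, 421), 0, -20, (0, 1, 0), (3, 0, 1)), ((1, 0, 529), 1, 0, (0, 0, 0), (11, 2, 9)),
  ((1, 0, 841), 1, 0, (0, 0, 0), (7, 2, 15))]

/-- Extensions of the basis of the ternary lattice with the parameters `(0, 1, 3)`. -/
def cover013OwnA : List ((ℤ × ℤ × ℤ × ℤ) × Reps) := [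
  ((1, 1, 0, 3), [], [(0, -3, (1, 0, 0, 0), (0, -1, 1, 1)), (0, 0, (1, 2, 1, 0), (3, 1, -1, -2)),
   (0, -4, (1, 0, 3, 0), (1, 3, -1, -2))]),
  ((1, 0, 1, 3), [], [(0, -3, (1, 0, 0, 0), (0, 0, -1, 1)), (0, -3, (2, 1, 0, 1), (1, 1, -1, -1)),
   (0, -3, (1, 0, 3, 0), (2, -3, 1, -1))]),
  ((0, 1, 0, 3), [], [(0, 0, (0, 1, 0, 0), (1, -1, 2, 1)), (0, -2, (1, 2, 1, 0), (1, 2, -2, -1)),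
   (0, -2, (1, 0, 3, 0), (3, -2, 0, 1))]),
  ((1, 0, 0, 3), [], [(0, 0, (1, 0, 0, 0), (0, 1, -2, 1)), (0, -2, (2, 1, 0, 1), (1, 1, -2, -1)),
   (0, -2, (1, 0, 3, 0), (1, 3, -1, -2))]),
  ((0, 0, 1, 3), [], [(0, -3, (0, 1, 0, 0), (0, 0, 1, -1)), (0, -2, (1, 2, 1, 0), (2, -1, 0, 1)),
   (0, -3, (1, 0, 3, 0), (0, 2, 0, -2))]),
  ((1, 1, 0, 4), [], [(0, -3, (1, 0, 0, 0), (0, 0, 0, 1)), (0, -3, (1, 2, 1, 0), (1, -1, 0, 1)),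
   (0, 0, (0, 1, -3, 1), (3, -1, 1, 1))]),
  ((0, 1, 0, 4), [], [(0, -3, (0, 1, 0, 0), (0, 0, 0, 1)), (0, 0, (2, 1, 1, -1), (1, -1, 1, 2)),
   (0, -5, (1, 0, 3, 0), (0, 0, 0, 1))]),
  ((1, 0, 0, 4), [], [(0, -3, (1, 0, 0, 0), (0, 0, 0, 1)), (0, 0, (1, 2, 1, 0), (1, 1, -1, -2)),
   (0, 0, (1, 0, 3, 0), (1, 3, -1, -2))]),
  ((0, 0, 1, 4), [], [(0, -2, (0, 1, 0, 0), (0, 0, 1, 1)), (0, -3, (2, 0, 1, 1), (1, 1, 0, -1)),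
   (0, -1, (1, 3, 1, 0), (2, -2, 2, -2))]),
  ((1, 1, 0, 5), [], [(0, -2, (1, 0, 0, 0), (0, 1, 0, 1)), (0, -3, (2, 0, 0, 1), (1, 2, -1, -1)),
   (0, -4, (3, 0, 0, 1), (1, 1, -2, -1))]),
  ((0, 0, 0, 4), [], [(0, -2, (0, 1, 0, 0), (1, 0, 1, 1)), (0, -1, (1, 2, 1, 0), (0, 0, 0, 2)),
   (0, -5, (1, 0, 3, 0), (0, 0, 0, 1))]),
  ((1, 0, 1, 5), [], [(0, 0, (1, 0, 0, 0), (0, 2, 0, 1)), (0, -3, (2, 0, 0, 1), (0, 2, 0, 0)), (0,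
   -3, (1, 3, 1, 0), (2, 0, 0, -2))])]

/-- Extensions of the basis of the ternary lattice with the parameters `(0, 1, 3)`. -/
def cover013OwnB : List ((ℤ × ℤ × ℤ × ℤ) × Reps) := [
  ((0, 1, 0, 5), [], [(0, 0, (0, 1, 0, 0), (2, 0, 0, 1)), (0, -3, (0, 2, 0, 1), (2, 0, 0, 0)), (0,
   -3, (1, 0, 3, 0), (0, 0, 0, 2))]),
  ((0, 0, 1, 5), [], [(0, -1, (0, 1, 0, 0), (1, 0, 1, 1)), (1, -3, (1, 1, 1, 1), (1, 0, -1, 1)),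
   (0, -2, (1, 0, 3, 0), (3, -1, 0, -1))]),
  ((1, 1, 0, 6), [], [(0, -2, (1, 0, 0, 0), (0, 0, 1, 1)), (0, -2, (1, 2, 1, 0), (1, 0, -1, 1)),
   (0, -4, (1, 0, 3, 0), (2, 2, -1, -1))]),
  ((1, 0, 0, 6), [], [(0, -2, (1, 0, 0, 0), (0, 0, 1, 1)), (0, -2, (1, 1, 1, 1), (0, 1, 1, -1)),
   (0, -1, (1, 3, 1, 0), (2, 1, -2, 1))]),
  ((0, 0, 1, 6), [], [(0, -2, (0, 1, 0, 0), (1, 0, 1, -1)), (0, -1, (1, 2, 1, 0), (2, -1, 0, 1)),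
   (0, -2, (1, 0, 3, 0), (3, 0, -1, 1))]),
  ((1, 1, 0, 7), [], [(0, -1, (1, 0, 0, 0), (0, 1, -1, 1)), (1, -1, (0, 1, 1, 1), (1, -1, -1, 1)),
   (0, 0, (1, 0, 3, 0), (1, 3, -1, -2))]),
  ((0, 0, 0, 6), [], [(0, -2, (0, 1, 0, 0), (0, 0, 1, 1)), (0, -1, (2, 0, 1, 1), (1, 2, 0, -1)),
   (0, -3, (1, 0, 1, 2), (2, 2, -2, 0))]),
  ((1, 0, 1, 7), [], [(0, -2, (1, 0, 0, 0), (0, 1, 0, 1)), (0, -3, (1, 2, 1, 0), (1, -1, 1, -1)),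
   (0, -2, (1, 0, 3, 0), (1, -1, 1, -2))]),
  ((0, 1, 0, 7), [], [(0, -2, (0, 1, 0, 0), (1, 0, 0, 1)), (0, 0, (1, 2, 1, 0), (1, 2, -2, -1)),
   (0, -1, (1, 0, 3, 0), (0, 0, 0, 2))]),
  ((1, 0, 0, 7), [], [(0, -2, (1, 0, 0, 0), (0, 1, 0, 1)), (0, -3, (0, 1, -2, 1), (0, 2, 0, 0)),
   (0, -4, (1, 0, 3, 0), (1, -1, 0, 1))]),
  ((0, 0, 1, 7), [], [(0, -1, (0, 1, 0, 0), (0, 0, 1, 1)), (0, 0, (2, 1, 0, 1), (1, -3, 1, 0)),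
   (0, -2, (1, 0, 1, -2), (1, 1, -3, 0))]),
  ((1, 1, 0, 8), [], [(0, -2, (1, 0, 0, 0), (0, -1, 1, 1)), (0, -2, (0, 1, 1, 1), (1, 1, 1, -1)),
   (0, -1, (2, 1, 1, 1), (3, 1, -2, -1))])]

/-- Extensions of the basis of the ternary lattice with the parameters `(0, 1, 3)`. -/
def cover013OwnC : List ((ℤ × ℤ × ℤ × ℤ) × Reps) := [
  ((0, 0, 0, 7), [], [(0, -1, (0, 1, 0, 0), (1, 0, 1, 1)), (0, -1, (2, 1, 0, 1), (1, 1, 1, -1)),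
   (0, -1, (1, 0, 3, 0), (0, 0, 0, 2))]),
  ((1, 0, 1, 8), [], [(0, -2, (1, 0, 0, 0), (0, 0, -1, 1)), (0, -2, (1, 0, 1, 1), (2, 0, 1, -1)),
   (0, -4, (1, 0, 3, 0), (1, 1, -1, 1))]),
  ((0, 0, 1, 8), [], [(0, -2, (0, 1, 0, 0), (0, 0, 1, -1)), (0, -3, (0, 1, 1, 1), (2, 0, 0, 0)),
   (0, -4, (1, 0, 3, 0), (0, 2, -1, 1))]),
  ((0, 0, 0, 8), [], [(0, 0, (0, 1, 0, 0), (1, 0, 1, 1)), (0, -3, (1, 2, 1, 0), (0, 0, 0, 1)), (0,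
   0, (1, 0, 3, 0), (3, 1, -1, 1))]),
  ((1, 0, 1, 9), [], [(0, -2, (1, 0, 0, 0), (0, 0, 0, 1)), (0, 0, (0, 2, 0, 1), (1, 2, 0, -1)),
   (0, -4, (1, 0, 3, 0), (2, 0, 0, -1))]),
  ((0, 1, 0, 9), [], [(0, -2, (0, 1, 0, 0), (0, 0, 0, 1)), (0, 0, (2, 0, 0, 1), (2, 1, 0, -1)),
   (0, -1, (1, 0, 3, 0), (3, 1, -1, -1))]),
  ((1, 0, 0, 9), [], [(0, -2, (1, 0, 0, 0), (0, 0, 0, 1)), (0, 0, (0, 2, 0, 1), (1, 2, 0, -1)),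
   (0, -3, (1, 0, 3, 0), (1, 2, -1, 1))]),
  ((0, 0, 1, 9), [], [(0, -1, (0, 1, 0, 0), (1, 0, 1, -1)), (0, -3, (2, 0, 0, 1), (0, 2, 0, 0)),
   (0, -1, (1, 0, 3, 0), (3, 0, -1, 1))]),
  ((1, 1, 0, 10), [], [(0, 0, (1, 0, 0, 0), (0, 0, 1, 1)), (0, 0, (1, 0, 1, 1), (1, -3, 1, 0)),
   (0, -2, (1, 0, 3, 0), (1, 2, -1, 1))]),
  ((0, 0, 0, 9), [], [(0, -1, (0, 1, 0, 0), (0, 0, 1, 1)), (0, -3, (2, 0, 0, 1), (0, 2, 0, 0)),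
   (0, -3, (3, 1, 0, 1), (1, -3, 0, 0))]),
  ((0, 1, 0, 10), [], [(0, -1, (0, 1, 0, 0), (1, 0, 0, 1)), (0, -2, (1, 2, 1, 0), (1, 1, -1, -1)),
   (0, 0, (1, 0, 3, 0), (3, 1, -1, -1))]),
  ((0, 0, 1, 10), [], [(0, 0, (0, 1, 0, 0), (1, 0, 1, -1)), (1, -2, (2, 2, 0, 0), (1, 0, -1, 1)),
   (0, 0, (1, 0, 3, 0), (3, 0, -1, 1))])]

/-- Extensions of the basis of the ternary lattice with the parameters `(0, 1, 3)`. -/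
def cover013OwnD : List ((ℤ × ℤ × ℤ × ℤ) × Reps) := [
  ((0, 0, 0, 10), [], [(0, 0, (0, 1, 0, 0), (0, 0, 1, 1)), (0, -3, (0, 1, 1, 1), (2, 0, 0, 0)),
   (0, -2, (1, 0, 3, 0), (0, 3, -1, 1))]),
  ((1, 0, 1, 11), [], [(0, -1, (1, 0, 0, 0), (0, 0, -1, 1)), (0, -1, (1, 2, 1, 0), (1, 1, -1,
   -1)), (0, -1, (1, 0, 3, 0), (2, -3, 1, -1))]),
  ((0, 1, 0, 11), [], [(0, 0, (0, 1, 0, 0), (1, 0, 0, 1)), (0, -2, (1, 2, 1, 0), (1, 0, 0, -1)),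
   (0, -1, (3, 0, 0, 1), (2, -1, -1, -1))]),
  ((1, 0, 0, 11), [], [(0, 0, (1, 0, 0, 0), (0, 1, 0, 1)), (1, -2, (2, 2, 0, 0), (0, 1, 0, -1)),
   (2, -2, (2, 1, 0, 1), (3, 1, 0, -1))]),
  ((0, 0, 1, 11), [], [(0, -1, (0, 1, 0, 0), (0, 0, 1, -1)), (0, -3, (0, 1, -2, 1), (2, 0, 0, 0)),
   (0, -1, (3, 0, 0, 1), (2, -1, -1, -1))]),
  ((1, 1, 0, 12), [], [(0, -1, (1, 0, 0, 0), (0, 0, 0, 1)), (0, -1, (1, 2, 1, 0), (1, -1, 0, 1)),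
   (0, -3, (1, 0, 3, 0), (2, -1, 0, -1))]),
  ((1, 0, 1, 12), [], [(0, -1, (1, 0, 0, 0), (0, 0, 0, 1)), (0, -1, (0, 0, 1, 1), (2, -2, 0, 0)),
   (0, -3, (2, 0, 1, 1), (1, 3, -2, 0))]),
  ((0, 1, 0, 12), [], [(0, -1, (0, 1, 0, 0), (0, 0, 0, 1)), (0, -1, (1, 0, 1, 1), (2, -2, 0, 0)),
   (0, -5, (2, 1, 1, 1), (1, -1, 0, 0))]),
  ((0, 0, 1, 12), [], [(0, 0, (0, 1, 0, 0), (0, 0, 1, -1)), (0, -3, (0, 0, 1, 1), (2, 0, 0, 0)),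
   (0, 0, (0, 2, 1, 1), (0, 1, -3, 1))]),
  ((1, 1, 0, 13), [], [(0, 0, (1, 0, 0, 0), (0, 0, 0, 1)), (0, 0, (1, 0, 0, 1), (1, -3, 1, 0)),
   (0, -3, (2, 1, 0, 1), (1, -1, -2, 0))]),
  ((1, 0, 1, 13), [], [(0, 0, (1, 0, 0, 0), (0, 0, 0, 1)), (0, -3, (1, 0, 0, 1), (0, 2, 0, 0)),
   (0, -2, (0, 0, 2, 1), (3, 2, -1, 0))]),
  ((0, 1, 0, 13), [], [(0, 0, (0, 1, 0, 0), (0, 0, 0, 1)), (0, -3, (0, 1, 0, 1), (2, 0, 0, 0)),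
   (0, -4, (1, 0, 3, 0), (0, 0, 0, 1))])]

/-- Extensions of the basis of the ternary lattice with the parameters `(0, 1, 3)`. -/
def cover013OwnE : List ((ℤ × ℤ × ℤ × ℤ) × Reps) := [
  ((1, 0, 0, 13), [], [(0, 0, (1, 0, 0, 0), (0, 0, 0, 1)), (0, -3, (1, 0, 0, 1), (0, 2, 0, 0)),
   (0, 0, (1, 0, 2, 1), (2, -2, 2, -1))]),
  ((1, 0, 1, 4), [], [(0, -3, (1, 0, 0, 0), (0, 0, 0, 1)), (0, -2, (2, 0, -1, 1), (1, 2, -1, -1)),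
   (0, -4, (1, 0, 3, 0), (1, -1, 1, -2))]),
  ((1, 0, 0, 5), [], [(0, -1, (1, 0, 0, 0), (0, 1, 1, 1)), (0, -3, (2, 0, 0, 1), (0, 2, 0, 0)),
   (0, -1, (3, 0, 0, 1), (0, 2, 2, 0))]),
  ((1, 1, 0, 9), [], [(0, -2, (1, 0, 0, 0), (0, 0, 0, 1)), (0, -1, (1, 1, 0, 1), (2, -2, 0, 0)),
   (0, -4, (1, 0, 3, 0), (1, -1, 0, 1))])]

/-- Lattices that contain the ternary lattice with the parameters `(0, 1, 3)`. -/
def cover013Others : List (Param × Basis3 × Reps) := [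
  (((1, 1, 2), (1, 0, 0, 3)), ((1, 0, 0, 0), (0, 1, 0, 0), (-1, 0, 1, 1)), [], [(0, -2, (1, 0, 0,
   0), (0, -1, 2, -1)), (0, -2, (2, 1, 0, 1), (1, 3, -2, -1)), (0, -4, (0, 1, 0, 3), (2, 3, -3,
   -1))]),
  (((0, 1, 2), (1, 1, 0, 3)), ((0, 1, 0, 0), (1, 0, 0, 0), (0, -1, 1, 1)), [], [(0, 0, (1, 0, 0,
   0), (0, 2, -1, 1)), (0, -3, (2, 0, 1, 1), (0, 2, -2, 0)), (0, -3, (0, 0, 1, 3), (2, 4, -2,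
   -2))]),
  (((0, 1, 2), (0, 0, 1, 3)), ((1, 0, 0, 0), (0, 1, 0, 0), (0, 0, 1, -1)), [], [(0, -3, (0, 1, 0,
   0), (1, 0, 1, 0)), (0, -1, (1, 0, 2, 1), (2, -2, 0, 0)), (0, -2, (1, 0, 0, 3), (3, 1, 1, -1))]),
  (((0, 1, 2), (1, 0, 0, 3)), ((0, 1, 0, 0), (1, 0, 0, 0), (0, 0, 0, 1)), [], [(0, -2, (1, 0, 0,
   0), (0, 1, 1, 1)), (0, -1, (2, 1, 0, 1), (1, -2, -1, 0)), (0, -4, (0, 1, 0, 3), (2, 1, 1,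
   -1))]),
  (((0, 0, 2), (0, 1, 1, 3)), ((1, 0, 0, 0), (0, 1, 0, 0), (0, 0, 0, 1)), [], [(0, -2, (0, 1, 0,
   0), (1, 0, 1, 1)), (0, -1, (1, 2, 0, 1), (2, 1, 1, -2)), (0, -5, (1, 0, 0, 3), (0, 1, -1, 0))]),
  (((0, 0, 2), (0, 0, 1, 3)), ((1, 0, 0, 0), (0, 0, 1, 0), (0, 0, 0, 1)), [], [(0, 0, (0, 0, 1,
   0), (2, 1, 0, 1)), (0, -3, (1, 0, 2, 1), (0, 2, 0, 0)), (0, -1, (1, 0, 0, 3), (3, 1, -2, 0))])]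

/-- The certificate for the ternary lattice with the parameters `(0, 1, 3)`. -/
def cover013 : Cover where
  a := (0, 1, 3)
  ternary := cover013TernaryA ++ cover013TernaryB
  squares := []
  forms := [(2, 1, 13), (17, 0, 17), (29, 0, 29)]
  own := cover013OwnA ++ cover013OwnB ++ cover013OwnC ++ cover013OwnD ++ cover013OwnE
  others := cover013Others

/-- Representations by the ternary lattice with the parameters `(0, 1, 4)`. -/
def cover014TernaryA : List TernaryRep := [
  ((2, 0, 2), 0, 0, (1, 0, 0), (0, 1, 0)), ((1, 0, 4), 1, 0, (0, 0, 0), (0, 0, 1)),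
  ((2, 1, 5), 0, -1, (0, 1, 0), (0, 0, 1)), ((5, 0, 5), 1, -1, (0, 0, 1), (1, 1, 0)),
  ((5, 1, 10), 1, -2, (0, 0, 1), (1, -1, 1)), ((2, 1, 13), 0, -3, (0, 1, 0), (0, 0, 1)),
  ((10, 3, 13), 2, 1, (1, 0, 1), (2, 1, -1)), ((13, 0, 13), 1, -3, (2, 0, 1), (1, -1, 0)),
  ((10, 1, 17), 0, -3, (1, 1, 1), (0, 2, -1)), ((5, 2, 25), 1, -3, (0, 0, 1), (2, 1, 1)),
  ((13, 6, 25), 1, -1, (2, 0, 1), (2, 3, -1)), ((17, 8, 25), 1, -3, (0, 2, 1), (2, 1, 1)),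
  ((25, 11, 26), 1, -4, (1, 1, 2), (1, 1, 1)), ((10, 1, 29), 0, -5, (2, 1, 0), (0, 0, 1)),
  ((13, 4, 29), 1, -3, (2, 0, 1), (1, 3, 0)), ((5, 1, 34), 1, 0, (0, 0, 1), (4, 1, 0)),
  ((17, 7, 34), 1, -2, (2, 1, 1), (2, -3, 2)), ((25, 3, 34), 1, -2, (1, 1, 2), (-1, 4, -1)),
  ((10, 3, 37), 0, -1, (2, 1, 0), (0, 0, 3)), ((26, 11, 37), 0, -5, (2, 3, 0), (2, 0, 1)),
  ((13, 2, 41), 1, -3, (2, 0, 1), (3, 1, -2)), ((17, 3, 50), 1, -2, (2, 1, 1), (0, 5, -2)),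
  ((10, 1, 53), 0, -7, (2, 1, 0), (0, 0, 1)), ((5, 1, 58), 1, -6, (0, 0, 1), (2, -1, 2)),
  ((2, 1, 61), 0, -7, (0, 1, 0), (2, 0, 1))]

/-- Representations by the ternary lattice with the parameters `(0, 1, 4)`. -/
def cover014TernaryB : List TernaryRep := [
  ((13, 2, 65), 1, -5, (2, 0, 1), (3, 3, -2)), ((5, 2, 73), 1, -7, (0, 0, 1), (1, 1, 2)),
  ((2, 1, 85), 0, -9, (0, 1, 0), (0, 0, 1)), ((10, 3, 85), 0, -7, (2, 1, 0), (0, 0, 3)),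
  ((5, 1, 106), 1, -2, (0, 0, 1), (7, -1, 1)), ((2, 1, 145), 0, -9, (0, 1, 0), (4, -1, 3)),
  ((5, 2, 169), 1, -7, (0, 0, 1), (7, 1, 2)), ((2, 1, 181), 0, -13, (0, 1, 0), (2, 0, 1)),
  ((2, 1, 265), 0, -15, (0, 1, 0), (2, -1, 3)), ((2, 1, 421), 0, -17, (0, 1, 0), (8, 0, 1))]

/-- Extensions of the basis of the ternary lattice with the parameters `(0, 1, 4)`. -/
def cover014OwnA : List ((ℤ × ℤ × ℤ × ℤ) × Reps) := [
  ((0, 0, 1, 5), [(1, 1, 0, 1), (0, 0, 2, 1), (1, 1, 0, 3), (1, 0, -1, 5), (2, 0, 6, 1), (0, 0, 2,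
   7), (1, -1, 4, 7), (3, 0, 11, 1), (3, 0, -1, 13)], [(0, -3, (0, 0, 2, -1), (2, 0, 0, 0)), (0,
   -4, (0, 1, 0, 0), (1, 0, 1, -1)), (0, -1, (3, 0, 1, 1), (2, 0, 0, -2))]),
  ((0, 0, 0, 5), [(0, 0, 1, 1), (3, 1, 0, 1), (0, 0, 1, 3), (1, 1, 4, 3), (0, 1, 3, 5), (0, 1, 3,
   7), (4, 0, 9, 1), (0, 0, 11, 3), (2, 3, -15, 1)], [(0, -2, (2, 0, 1, 1), (0, 1, 1, -1)), (0,
   -4, (0, 1, 0, 0), (0, 0, 1, 1)), (0, -1, (2, 0, 2, 1), (0, 1, 1, -2))]),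
  ((1, 1, 2, 7), [(0, 1, -1, 1), (1, 1, 1, 1), (0, -1, 3, 1), (0, 3, 1, 3), (0, 1, -1, 5), (0, 1,
   3, 5), (0, -1, 1, 7), (1, 1, 9, 3), (2, -1, -1, 11)], [(0, -3, (1, -1, 1, 1), (0, 2, 0, 0)),
   (0, -4, (1, 0, 0, 0), (0, 1, -1, 1)), (0, -1, (1, 3, -1, 1), (2, 2, 0, -2))]),
  ((0, 1, 2, 7), [(1, 0, 0, 1), (3, 0, 0, 1), (0, -1, 3, 1), (0, 3, 1, 3), (1, -1, 0, 5), (0, 1,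
   3, 5), (1, 1, 0, 7), (2, -1, -1, 9), (0, -3, 1, 11)], [(0, -1, (1, 0, 1, 1), (2, -2, 0, 0)),
   (0, -4, (0, 1, 0, 0), (1, 0, 0, 1)), (0, -5, (3, 1, 0, 1), (0, 1, -1, 0))]),
  ((1, 1, 0, 7), [(0, -1, 1, 1), (2, 1, -1, 1), (0, -1, -3, 1), (0, 1, 5, 1), (0, -1, 1, 5), (0,
   5, 1, 5), (0, 1, -1, 7), (0, -3, 1, 9), (-2, 1, 1, 11)], [(0, 0, (0, 1, 1, 1), (1, -1, -1, 1)),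
   (0, -4, (1, 0, 0, 0), (0, -1, 1, 1)), (1, -1, (0, 3, 1, 0), (0, 2, -1, -2))]),
  ((1, 0, 1, 7), [(0, 1, 0, 1), (2, 0, 1, 1), (0, 0, 3, 1), (1, 0, 5, 1), (0, 0, -1, 5), (0, 1, 4,
   5), (0, 0, 1, 7), (1, 0, 5, 7), (0, -2, -1, 11)], [(0, -2, (1, 0, 1, 1), (1, 1, 1, -1)), (0,
   -4, (1, 0, 0, 0), (0, 1, 0, 1)), (0, 0, (2, 1, 1, 1), (1, -1, -2, 1))]),
  ((0, 1, 0, 7), [(1, 0, 0, 1), (3, 0, 0, 1), (0, -1, -3, 1), (0, 1, 5, 1), (1, -1, 0, 5), (0, 5,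
   1, 5), (1, 1, 0, 7), (0, -3, 1, 9), (2, -1, -1, 11)], [(0, -3, (0, 1, 1, 1), (2, 0, 0, 0)), (0,
   -4, (0, 1, 0, 0), (1, 0, 0, 1)), (0, -2, (3, 1, 0, 1), (1, 0, 2, -1))]),
  ((1, 0, 0, 7), [(0, 1, 0, 1), (0, 3, 0, 1), (4, 1, 0, 1), (4, 1, 0, 3), (-1, 1, 0, 5), (5, 1,
   -2, 5), (1, 1, 0, 7), (-4, 1, 0, 9), (-1, 1, -2, 11)], [(1, -2, (0, 0, 2, 0), (1, 1, 0, 1)),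
   (0, -4, (1, 0, 0, 0), (0, 1, 0, 1)), (0, 0, (0, 1, 2, 1), (1, -3, 2, -1))]),
  ((0, 0, 1, 7), [(1, 0, 0, 1), (3, 0, 0, 1), (0, 0, 3, 1), (0, 3, 4, 1), (0, 0, -1, 5), (0, 1, 4,
   5), (0, 0, 1, 7), (0, 1, 8, 5), (0, -2, -1, 11)], [(0, -3, (0, 1, 1, 1), (2, 0, 0, 0)), (0, -4,
   (0, 1, 0, 0), (0, 0, 1, -1)), (0, -5, (1, 0, 2, 1), (1, -1, 0, 0))]),
  ((1, 1, 2, 9), [(0, 0, 0, 1), (2, 1, 0, 1), (4, 0, 0, 1), (0, 0, 2, 3), (0, 3, 2, 3), (-1, 1, 2,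
   5), (0, 2, 3, 5), (1, 0, 2, 7), (0, 1, 2, 9)], [(0, -1, (0, 0, 1, 1), (0, 3, -1, 0)), (0, -4,
   (1, 0, 0, 0), (0, 0, 0, 1)), (0, -2, (2, 0, 1, 1), (3, -1, 0, -1))]),
  ((0, 1, 2, 9), [(0, 0, 0, 1), (2, 0, 1, 1), (0, 4, 0, 1), (0, 0, 2, 3), (1, 1, 3, 3), (2, 0, 2,
   5), (0, 2, 3, 5), (0, 4, 0, 7), (0, 1, 2, 9)], [(0, -3, (0, 0, 1, 1), (2, 0, 0, 0)), (0, -4,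
   (0, 1, 0, 0), (0, 0, 0, 1)), (0, 0, (0, 1, -2, -1), (1, 3, 1, -1))]),
  ((1, 1, 0, 9), [(0, 0, 0, 1), (0, 0, 2, 1), (4, 0, 0, 1), (3, 0, 1, 3), (0, 1, 6, 1), (0, 0, 4,
   5), (6, 0, 1, 5), (4, 0, 0, 7), (3, 1, 2, 9)], [(0, -1, (1, 1, 0, 1), (2, -2, 0, 0)), (0, -4,
   (1, 0, 0, 0), (0, 0, 0, 1)), (0, -5, (1, 0, 2, 1), (1, -1, 0, 0))])]

/-- Extensions of the basis of the ternary lattice with the parameters `(0, 1, 4)`. -/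
def cover014OwnB : List ((ℤ × ℤ × ℤ × ℤ) × Reps) := [
  ((0, 1, 0, 9), [(0, 0, 0, 1), (0, 0, 2, 1), (0, 4, 0, 1), (4, 1, 0, 3), (0, 1, 6, 1), (0, 0, 4,
   5), (0, 5, 2, 5), (0, 4, 0, 7), (2, 4, 0, 9)], [(0, -1, (2, 0, 0, 1), (0, 0, 2, 0)), (0, -4,
   (0, 1, 0, 0), (0, 0, 0, 1)), (0, -5, (0, 2, 1, 1), (0, 1, -1, 0))]),
  ((1, 0, 0, 9), [(0, 0, 0, 1), (0, 0, 2, 1), (4, 0, 0, 1), (3, 0, 1, 3), (0, 2, 4, 3), (0, 0, 4,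
   5), (6, 0, 1, 5), (4, 0, 0, 7), (4, 2, 0, 9)], [(0, 0, (1, 0, 1, 1), (2, 0, 1, -1)), (0, -4,
   (1, 0, 0, 0), (0, 0, 0, 1)), (0, -1, (1, 0, 2, 1), (0, 4, -1, 0))]),
  ((0, 0, 0, 9), [(0, 0, 0, 1), (0, 0, 2, 1), (4, 2, 0, 1), (0, 1, 5, 1), (1, 1, 6, 1), (0, 0, 4,
   5), (2, 1, 9, 1), (0, 2, 4, 7), (0, 1, 5, 9)], [(0, -3, (2, 0, 0, 1), (0, 2, 0, 0)), (0, -2,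
   (0, 1, 0, 0), (2, 0, 1, 1)), (0, -3, (3, 1, 0, 1), (1, -3, 0, 0))])]

/-- Lattices that contain the ternary lattice with the parameters `(0, 1, 4)`. -/
def cover014Others : List (Param × Basis3 × Reps) := [
  (((0, 0, 3), (1, 0, 0, 4)), ((0, 1, 0, 0), (1, 0, 0, 0), (0, 0, 0, 1)), [(0, 1, 1, 1), (1, 0, 1,
   2), (3, 0, 1, 2), (0, 3, 1, 5), (1, 2, 1, 6), (4, 1, 1, 7), (-3, 0, 1, 10), (1, 3, 1, 11), (1,
   0, 3, 14)], [(0, -3, (1, 0, 1, -2), (2, 0, 0, 0)), (0, -4, (1, 0, 0, 0), (0, 1, 1, 1)), (0, -5,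
   (0, 1, 3, 0), (0, 0, 0, 1))])]

/-- The certificate for the ternary lattice with the parameters `(0, 1, 4)`. -/
def cover014 : Cover where
  a := (0, 1, 4)
  ternary := cover014TernaryA ++ cover014TernaryB
  squares := [9, 25, 49, 121, 169, 289, 361, 529, 841]
  forms := [(17, 0, 17), (2, 1, 25), (29, 0, 29)]
  own := cover014OwnA ++ cover014OwnB
  others := cover014Others

/-- Representations by the ternary lattice with the parameters `(1, 1, 4)`. -/
def cover114TernaryA : List TernaryRep := [
  ((2, 0, 2), 0, 0, (1, 0, 0), (0, 1, 0)), ((1, 0, 4), 1, 0, (0, 0, 0), (0, 0, 1)),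
  ((2, 1, 5), 0, -1, (1, 0, 0), (0, 0, 1)), ((5, 1, 10), 1, 0, (0, 0, 1), (2, -1, 0)),
  ((2, 1, 13), 0, -3, (1, 0, 0), (0, 0, 1)), ((10, 3, 13), 0, -3, (2, 1, 0), (0, 0, 1)),
  ((13, 0, 13), 1, -3, (1, 1, 1), (0, -1, 1)), ((10, 1, 17), 0, -3, (2, 1, 0), (0, 2, -1)),
  ((2, 1, 25), 0, -3, (1, 0, 0), (0, 2, 1)), ((5, 2, 25), 1, -3, (0, 0, 1), (2, -1, 1)),
  ((13, 6, 25), 1, -3, (1, 1, 1), (2, -1, 1)), ((17, 8, 25), 3, 3, (1, 0, 1), (-1, -3, 1)),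
  ((25, 11, 26), 3, -2, (2, 0, 1), (1, 0, 2)), ((10, 1, 29), 0, -5, (2, 1, 0), (1, 0, -1)),
  ((13, 4, 29), 1, 1, (1, 1, 1), (2, -3, 1)), ((5, 1, 34), 1, -2, (0, 0, 1), (-1, -4, 2)),
  ((17, 7, 34), 1, -2, (2, 0, 1), (-1, 2, 2)), ((25, 3, 34), 3, -4, (2, 0, 1), (3, 0, 0)),
  ((10, 3, 37), 0, -5, (2, 1, 0), (2, -1, -1)), ((26, 11, 37), 0, -3, (3, 2, 0), (0, 4, -1)),
  ((13, 2, 41), 1, -1, (1, 1, 1), (-1, -4, 3)), ((17, 3, 50), 1, -2, (2, 0, 1), (-2, 3, 2)),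
  ((10, 1, 53), 0, -7, (2, 1, 0), (1, 0, -1)), ((5, 1, 58), 1, -6, (0, 0, 1), (1, -2, 2)),
  ((2, 1, 61), 0, -3, (1, 0, 0), (-1, 2, 3))]

/-- Representations by the ternary lattice with the parameters `(1, 1, 4)`. -/
def cover114TernaryB : List TernaryRep := [
  ((13, 2, 65), 1, -7, (1, 1, 1), (2, -1, 1)), ((5, 2, 73), 1, -1, (0, 0, 1), (-3, -6, 3)),
  ((2, 1, 85), 0, -9, (1, 0, 0), (0, 0, 1)), ((10, 3, 85), 0, -9, (2, 1, 0), (0, 0, 1)),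
  ((5, 1, 106), 1, -2, (0, 0, 1), (2, -7, 2)), ((2, 1, 145), 0, -9, (1, 0, 0), (0, 5, 1)),
  ((5, 2, 169), 1, -7, (0, 0, 1), (7, -2, 1)), ((2, 1, 181), 0, -9, (1, 0, 0), (-2, 1, 5)),
  ((2, 1, 265), 0, -15, (1, 0, 0), (-1, 1, 3)), ((2, 1, 421), 0, -9, (1, 0, 0), (-1, 11, 3))]

/-- Extensions of the basis of the ternary lattice with the parameters `(1, 1, 4)`. -/
def cover114Own : List ((ℤ × ℤ × ℤ × ℤ) × Reps) := [
  ((1, -1, 2, 7), [(1, 0, -1, 1), (3, 0, -1, 1), (0, 1, -1, 3), (3, 0, 1, 3), (1, 0, -1, 5), (1,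
   0, 3, 5), (-1, 0, 1, 7), (1, -2, 11, 1), (0, 1, 5, 9)], [(0, -1, (0, 1, -1, 1), (1, 1, 0, 0)),
   (0, -1, (0, 1, 1, 1), (2, -2, 0, 0)), (0, -5, (1, 2, 1, 1), (1, -1, 0, 0))]),
  ((0, 0, 0, 5), [(0, 0, 1, 1), (3, 1, 0, 1), (0, 0, 1, 3), (7, 0, 1, 1), (1, 0, 3, 5), (1, 0, 3,
   7), (7, 0, 1, 7), (0, 0, 11, 3), (2, 2, 13, 3)], [(0, -1, (0, 0, 0, 1), (0, 0, 1, 0)), (0, -3,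
   (1, 1, 1, 1), (2, 0, -1, 0)), (1, -1, (3, 0, 1, 0), (-1, 1, 1, 2))])]

/-- Lattices that contain the ternary lattice with the parameters `(1, 1, 4)`. -/
def cover114Others : List (Param × Basis3 × Reps) := [
  (((1, 1, 3), (1, -1, 0, 4)), ((1, 0, 0, 0), (0, 1, 0, 0), (1, 0, 0, -1)), [(1, 0, -1, 1), (3, 0,
   -1, 1), (1, 0, 1, 3), (5, 0, 3, 1), (1, 0, 7, 1), (10, -1, -1, 3), (2, 1, 1, 9), (1, 0, -3,
   11), (1, 0, -17, 1)], [(0, -1, (1, 0, -1, -1), (1, 1, 0, 0)), (1, -2, (0, 0, 0, 2), (0, 3, -1,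
   1)), (0, -1, (1, 0, -3, 1), (0, 4, -2, 0))])]

/-- The certificate for the ternary lattice with the parameters `(1, 1, 4)`. -/
def cover114 : Cover where
  a := (1, 1, 4)
  ternary := cover114TernaryA ++ cover114TernaryB
  squares := [9, 25, 49, 121, 169, 289, 361, 529, 841]
  forms := [(5, 0, 5), (17, 0, 17), (29, 0, 29)]
  own := cover114Own
  others := cover114Others

/-- Representations by the ternary lattice with the parameters `(0, 1, 5)`. -/
def cover015TernaryA : List TernaryRep := [
  ((2, 0, 2), 0, 0, (1, 0, 0), (0, 1, 0)), ((1, 0, 4), 1, 0, (0, 0, 0), (1, 1, 0)),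
  ((2, 1, 5), 0, 0, (0, 1, 0), (0, 0, 1)), ((1, 0, 9), 1, 0, (0, 0, 0), (0, 1, 1)),
  ((5, 1, 10), 0, 0, (0, 0, 1), (2, 1, 0)), ((2, 1, 13), 0, 0, (0, 1, 0), (2, 0, 1)),
  ((10, 3, 13), 0, -2, (2, 1, 0), (0, 1, 1)), ((10, 1, 17), 1, -2, (0, 1, 1), (2, -1, 1)),
  ((17, 0, 17), 0, -3, (0, 2, 1), (2, 0, 0)), ((1, 0, 25), 1, 0, (0, 0, 0), (2, 2, 1)),
  ((5, 2, 25), 0, -3, (0, 0, 1), (2, 2, 0)), ((13, 6, 25), 0, -4, (2, 0, 1), (0, 1, 1)),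
  ((17, 8, 25), 0, 0, (0, 2, 1), (2, 3, -1)), ((25, 11, 26), 0, -3, (2, 2, 1), (2, 2, -1)),
  ((10, 1, 29), 1, -2, (0, 1, 1), (2, 3, -1)), ((13, 4, 29), 0, -4, (2, 0, 1), (2, 1, -1)),
  ((5, 1, 34), 0, 0, (0, 0, 1), (4, 1, 0)), ((17, 7, 34), 0, 0, (2, 1, 1), (-2, 1, 2)),
  ((25, 3, 34), 0, -5, (2, 2, 1), (0, 2, -1)), ((10, 3, 37), 1, -3, (0, 1, 1), (2, -2, 2)),
  ((26, 11, 37), 0, 0, (0, 1, 2), (4, 0, 1)), ((13, 2, 41), 2, -2, (0, 1, 1), (4, 0, 1)),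
  ((1, 0, 49), 1, 0, (0, 0, 0), (2, 1, -3)), ((17, 3, 50), 0, -3, (0, 2, 1), (4, 2, -1)),
  ((10, 1, 53), 0, -4, (2, 1, 0), (2, -3, -1))]

/-- Representations by the ternary lattice with the parameters `(0, 1, 5)`. -/
def cover015TernaryB : List TernaryRep := [
  ((13, 2, 65), 2, -5, (0, 1, 1), (2, 4, 0)), ((2, 1, 85), 0, -6, (0, 1, 0), (2, -1, 3)),
  ((10, 3, 85), 1, -3, (0, 1, 1), (2, 6, -2)), ((5, 1, 106), 0, -3, (0, 0, 1), (4, 6, -1)),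
  ((1, 0, 121), 1, 0, (0, 0, 0), (2, 2, -5)), ((2, 1, 145), 0, 0, (0, 1, 0), (4, -2, 5)),
  ((1, 0, 169), 1, 0, (0, 0, 0), (4, 1, 5)), ((5, 2, 169), 0, -12, (0, 0, 1), (2, -3, 1)),
  ((2, 1, 181), 0, -12, (0, 1, 0), (4, 0, 1)), ((2, 1, 265), 0, -12, (0, 1, 0), (2, -2, 5)),
  ((1, 0, 289), 1, 0, (0, 0, 0), (2, 2, 7)), ((1, 0, 361), 1, 0, (0, 0, 0), (8, 1, -7)),
  ((2, 1, 421), 0, 0, (0, 1, 0), (10, -3, 7)), ((1, 0, 529), 1, 0, (0, 0, 0), (16, 2, 1)),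
  ((1, 0, 841), 1, 0, (0, 0, 0), (4, 6, 11))]

/-- Extensions of the basis of the ternary lattice with the parameters `(0, 1, 5)`. -/
def cover015Own : List ((ℤ × ℤ × ℤ × ℤ) × Reps) := [
  ((1, 1, 2, 5), [], [(0, -1, (0, 0, 0, 1), (1, -1, 0, 0)), (0, -3, (1, 1, 0, 1), (1, -1, 0, 0)),
   (0, -4, (1, 0, 0, 0), (0, 1, 0, 1)), (0, -3, (3, 0, 0, 1), (2, 2, 0, -2)), (0, -7, (0, 0, 1,
   0), (1, -1, 0, 1)), (0, -7, (1, 0, 0, 0), (0, -1, 1, 1)), (0, -8, (0, 0, 1, 0), (1, 0, 0, 1))]),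
  ((1, 1, 0, 5), [], [(0, 0, (0, 0, 1, 0), (0, 0, 0, 1)), (0, -2, (2, 0, 1, 0), (0, 2, 0, -1)),
   (0, -4, (1, 0, 0, 0), (0, 1, 0, 1)), (0, -3, (3, 0, 0, 1), (0, 0, 2, 0)), (0, -7, (0, 0, 1, 0),
   (0, 1, 0, 1)), (0, -7, (1, 0, 0, 0), (0, 1, -1, 1)), (0, -8, (0, 0, 1, 0), (0, 2, 0, -1))]),
  ((0, 0, 2, 5), [], [(0, -1, (0, 0, 0, 1), (1, 1, 0, 0)), (0, -1, (2, 0, 1, 0), (1, -1, -1, 1)),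
   (0, -3, (0, 1, 0, 0), (1, 0, 1, 1)), (0, -2, (0, 3, 1, 0), (2, 2, -2, 1)), (0, -7, (0, 0, 1,
   0), (1, -1, 0, 1)), (0, -6, (0, 1, 0, 0), (2, 0, 1, -2)), (0, -7, (0, 0, 1, 0), (3, -1, 1,
   -1))]),
  ((0, 1, 0, 5), [], [(0, 0, (0, 0, 1, 0), (0, 0, 0, 1)), (1, -2, (0, 1, 1, -1), (0, -1, 0, -1)),
   (0, -2, (0, 1, 0, 0), (0, -1, 2, 1)), (0, 0, (0, 3, 1, 0), (2, 2, -1, -2)), (0, -7, (0, 0, 1,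
   0), (0, 1, 0, 1)), (0, -6, (0, 1, 0, 0), (0, 0, 2, -1)), (0, -8, (0, 0, 1, 0), (0, 2, 0, -1))]),
  ((1, 0, 0, 5), [], [(0, 0, (0, 0, 1, 0), (0, 0, 0, 1)), (0, 0, (2, 0, 1, 0), (0, 2, 0, -1)), (0,
   0, (1, 0, 0, 0), (0, 0, 2, 1)), (0, -3, (3, 0, 0, 1), (0, 0, 2, 0)), (0, -6, (0, 0, 1, 0), (0,
   1, 0, 2)), (0, -6, (1, 0, 0, 0), (0, 0, 2, 1)), (0, -6, (0, 0, 1, 0), (3, 2, 0, 1))]),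
  ((0, 0, 1, 5), [], [(0, -1, (0, 0, 0, 1), (1, 1, 0, 0)), (1, -1, (0, 0, 1, 1), (0, 1, 1, -1)),
   (0, -3, (0, 1, 0, 0), (2, 0, 1, -1)), (0, -3, (0, 0, 2, 1), (2, 2, -1, 1)), (0, -6, (0, 0, 1,
   0), (0, -1, 0, 2)), (0, -7, (0, 1, 0, 0), (0, 0, 1, 1)), (0, -8, (0, 0, 1, 0), (1, 1, 0, 1))]),
  ((0, 0, 0, 5), [], [(0, 0, (0, 0, 1, 0), (0, 0, 0, 1)), (0, -1, (2, 0, 1, 0), (1, 1, -1, 1)),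
   (0, 0, (0, 1, 0, 0), (0, 0, 1, 2)), (0, -4, (0, 3, 1, 0), (2, 0, 0, 1)), (0, -7, (0, 0, 1, 0),
   (1, 1, 0, 1)), (0, -7, (0, 1, 0, 0), (1, 0, 1, 1)), (0, -7, (0, 0, 1, 0), (1, -3, 1, 1))])]

/-- Lattices that contain the ternary lattice with the parameters `(0, 1, 5)`. -/
def cover015OthersA : List (Param × Basis3 × Reps) := [
  (((0, 1, 2), (0, 0, 0, 3)), ((1, 0, 0, 0), (0, 1, 0, 0), (0, 0, 1, 1)), [], [(1, -1, (1, 1, 0,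
   0), (1, 0, -1, 0)), (0, -2, (2, 1, 0, 1), (0, 1, 1, -1)), (0, -3, (0, 1, 0, 0), (1, 0, 1, 2)),
   (0, -3, (3, 2, 0, 1), (1, 0, -3, 0)), (0, -3, (1, 0, 0, 1), (2, 3, 2, -1)), (0, -6, (0, 1, 0,
   0), (2, -1, 3, 1)), (0, -3, (1, 0, 0, 1), (1, 5, 1, 0))]),
  (((0, 1, 2), (0, 1, 0, 5)), ((1, 0, 0, 0), (0, 1, 0, 0), (0, 0, 0, 1)), [], [(0, -1, (0, 0, 0,
   1), (1, 0, 1, 0)), (0, 0, (0, 1, 1, 1), (0, 0, 2, -1)), (0, -4, (0, 1, 0, 0), (0, -1, 2, 1)),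
   (1, -4, (2, 0, 0, 2), (0, -3, 1, 1)), (0, -6, (0, 0, 0, 1), (2, 1, 2, 0)), (0, -6, (0, 1, 0,
   0), (0, -2, 4, 1)), (0, -7, (0, 0, 0, 1), (0, 2, 2, 0))]),
  (((0, 1, 2), (1, 0, 0, 5)), ((0, 1, 0, 0), (1, 0, 0, 0), (0, 0, 0, 1)), [], [(1, -1, (1, 1, 0,
   0), (1, 0, -1, 0)), (0, 0, (0, 2, 0, 1), (1, 0, 2, -1)), (0, -3, (0, 1, 0, 0), (1, -1, 3, 0)),
   (1, -5, (1, 1, 0, 2), (1, 0, 1, 0)), (0, 0, (0, 0, 0, 1), (1, 4, 2, 0)), (0, 0, (1, 0, 0, 0),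
   (0, 4, 2, 1)), (0, -3, (0, 0, 0, 1), (2, 4, 2, 0))]),
  (((0, 0, 2), (1, 0, 0, 5)), ((0, 1, 0, 0), (1, 0, 0, 0), (0, 0, 0, 1)), [], [(0, -1, (0, 0, 0,
   1), (0, 1, 1, 0)), (0, -2, (0, 2, 0, 1), (1, 1, 1, -1)), (0, -4, (1, 0, 0, 0), (0, 1, 1, 1)),
   (0, -5, (3, 0, 0, 1), (0, 1, 1, 0)), (0, -6, (0, 0, 0, 1), (1, 3, 1, 0)), (0, -6, (1, 0, 0, 0),
   (0, 3, 1, 1)), (0, -7, (0, 0, 0, 1), (2, 2, 2, 0))]),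
  (((1, 1, 3), (1, 0, 0, 4)), ((1, 0, 0, 0), (0, 1, 0, 0), (-1, 0, 1, 1)), [], [(1, -1, (0, 0, 0,
   1), (1, 1, 0, 0)), (0, -1, (1, 0, 1, 1), (2, 0, -2, 0)), (0, -3, (1, 0, 0, 0), (0, 0, 2, -1)),
   (0, -4, (1, 0, -3, 1), (1, -1, 1, 1)), (0, -7, (1, 0, -1, -1), (1, 0, 1, -1)), (0, -7, (1, 0,
   0, 0), (0, 2, 0, 1)), (0, -8, (1, 0, -1, -1), (1, -1, 1, -1))]),
  (((0, 0, 3), (1, 0, 0, 5)), ((0, 1, 0, 0), (1, 0, 0, 0), (0, 0, 0, 1)), [], [(0, 0, (0, 0, 0,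
   1), (0, 1, 1, 0)), (0, -1, (0, 2, 0, 1), (0, 0, 2, 0)), (0, -3, (1, 0, 0, 0), (0, 2, 1, 1)),
   (0, -3, (3, 0, 0, 1), (0, 2, 2, 0)), (0, -6, (0, 0, 0, 1), (1, 2, 2, 0)), (0, -6, (1, 0, 0, 0),
   (0, 2, 2, 1)), (0, -6, (0, 0, 0, 1), (2, 1, 3, 0))]),
  (((0, 0, 3), (0, 1, 1, 5)), ((1, 0, 0, 0), (0, 1, 0, 0), (0, 0, 0, 1)), [], [(0, 0, (0, 0, 0,
   1), (0, 1, -1, 0)), (0, -1, (1, 2, 1, 0), (1, 1, -1, -1)), (0, -2, (0, 1, 0, 0), (0, 0, 2, 1)),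
   (0, -1, (1, 0, 3, 0), (3, 1, -1, 1)), (0, -6, (0, 0, 0, 1), (2, -1, 2, 0)), (0, -7, (0, 1, 0,
   0), (1, 0, 1, 1)), (0, -6, (0, 0, 0, 1), (4, 1, 1, 0))]),
  (((1, 1, 4), (1, 0, 0, 5)), ((0, 1, 0, 0), (1, 0, 0, 0), (0, 0, 0, 1)), [], [(0, -1, (0, 0, 0,
   1), (0, 0, 1, 0)), (0, -3, (0, 1, 1, 1), (1, 1, -1, 0)), (0, -3, (1, 0, 0, 0), (0, 2, 1, 0)),
   (0, 0, (1, 0, 2, 1), (4, 2, -2, -1)), (0, -6, (0, 0, 0, 1), (1, 0, 2, 0)), (0, -5, (1, 0, 0,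
   0), (0, -2, -1, 2)), (0, -6, (0, 0, 0, 1), (-3, 2, 2, 1))]),
  (((0, 1, 4), (0, -1, 2, 5)), ((1, 0, 0, 0), (0, 1, 0, 0), (0, 0, 0, -1)), [], [(0, -1, (0, 0, 1,
   -1), (0, 1, -1, 0)), (0, -3, (0, 0, 1, 1), (1, 1, 0, 0)), (0, -4, (0, 1, 0, 0), (0, -1, 2,
   -1)), (0, -3, (0, 0, 2, 1), (2, 2, -2, 2)), (0, -7, (0, 0, 0, 1), (0, -2, 2, -1)), (0, -7, (0,
   1, 0, 0), (2, 0, 1, 0)), (0, -6, (0, 0, 0, 1), (1, -5, 1, -1))]),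
  (((0, 1, 4), (0, 1, 2, 5)), ((1, 0, 0, 0), (0, 1, 0, 0), (0, 0, 0, 1)), [], [(0, -1, (0, 0, 1,
   -1), (1, 1, 0, 0)), (0, -2, (2, 0, 0, 1), (1, -1, 1, -1)), (0, -3, (0, 1, 0, 0), (0, 0, -1,
   2)), (0, -2, (0, 0, 2, 1), (2, 3, 0, -1)), (0, -6, (0, 0, 0, 1), (3, -1, 1, 0)), (0, -7, (0, 1,
   0, 0), (2, 0, 1, 0)), (0, -8, (0, 0, 0, 1), (1, -1, -1, 1))]),
  (((0, 1, 4), (1, 0, 1, 5)), ((0, 1, 0, 0), (1, 0, 0, 0), (0, 0, 0, 1)), [], [(1, -1, (0, 0, 1,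
   0), (1, 1, 0, 0)), (1, -3, (2, 0, 1, 0), (1, -1, 0, 0)), (0, 0, (1, 0, 0, 0), (0, 0, 2, 1)),
   (0, -1, (3, 0, 0, 1), (2, 0, 2, -2)), (0, -1, (0, 0, 0, 1), (4, 2, 2, -1)), (0, -6, (1, 0, 0,
   0), (0, 0, 2, 1)), (0, -5, (0, 0, 0, 1), (4, 0, -2, 0))]),
  (((0, 1, 4), (0, 1, 0, 5)), ((1, 0, 0, 0), (0, 1, 0, 0), (0, 0, 0, 1)), [], [(0, -1, (0, 0, 0,
   1), (0, 0, 1, 0)), (0, -3, (2, 0, 0, 1), (0, 0, 1, 0)), (0, -2, (0, 1, 0, 0), (0, 0, 2, -1)),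
   (0, -2, (0, 3, 0, 1), (2, 2, -2, -1)), (0, -6, (0, 0, 0, 1), (0, 1, 2, 0)), (0, -7, (0, 1, 0,
   0), (2, 0, 1, 0)), (0, -7, (0, 0, 0, 1), (2, 2, 1, 0))])]

/-- Lattices that contain the ternary lattice with the parameters `(0, 1, 5)`. -/
def cover015OthersB : List (Param × Basis3 × Reps) := [
  (((0, 1, 4), (1, 0, 0, 5)), ((0, 1, 0, 0), (1, 0, 0, 0), (0, 0, 0, 1)), [], [(0, -1, (0, 0, 0,
   1), (0, 0, 1, 0)), (0, -2, (1, 0, 1, 1), (2, 0, 0, -1)), (0, -4, (1, 0, 0, 0), (0, 0, 1, 1)),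
   (0, -5, (3, 0, 0, 1), (0, 0, 1, 0)), (0, -5, (0, 0, 0, 1), (-4, 0, 1, 1)), (0, -4, (1, 0, 0,
   0), (-1, 0, 1, 3)), (0, -7, (0, 0, 0, 1), (2, 0, 2, 0))]),
  (((0, 0, 4), (1, 0, 0, 5)), ((0, 1, 0, 0), (1, 0, 0, 0), (0, 0, 0, 1)), [], [(0, -1, (0, 0, 0,
   1), (0, 0, 1, 0)), (0, -2, (1, 0, 1, 1), (2, 0, 0, -1)), (0, -4, (1, 0, 0, 0), (0, 0, 1, 1)),
   (0, -5, (3, 0, 0, 1), (0, 0, 1, 0)), (0, -5, (0, 0, 0, 1), (-4, 0, 1, 1)), (0, -4, (1, 0, 0,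
   0), (-1, 0, 1, 3)), (0, -7, (0, 0, 0, 1), (2, 0, 2, 0))])]

/-- The certificate for the ternary lattice with the parameters `(0, 1, 5)`. -/
def cover015 : Cover where
  a := (0, 1, 5)
  ternary := cover015TernaryA ++ cover015TernaryB
  squares := []
  forms := [(5, 0, 5), (13, 0, 13), (2, 1, 25), (29, 0, 29), (5, 1, 58), (2, 1, 61), (5, 2, 73)]
  own := cover015Own
  others := cover015OthersA ++ cover015OthersB

/-- Representations by the ternary lattice with the parameters `(1, 1, 5)`. -/
def cover115TernaryA : List TernaryRep := [
  ((2, 0, 2), 0, 0, (1, 0, 0), (0, 1, 0)), ((1, 0, 4), 1, 0, (0, 0, 0), (1, 1, 0)),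
  ((2, 1, 5), 0, 0, (1, 0, 0), (0, 0, 1)), ((5, 0, 5), 0, -1, (0, 0, 1), (1, -1, 0)),
  ((1, 0, 9), 1, 0, (0, 0, 0), (1, 0, 1)), ((5, 1, 10), 0, 0, (0, 0, 1), (2, -1, 0)),
  ((2, 1, 13), 0, -2, (1, 0, 0), (0, 1, 1)), ((10, 3, 13), 0, 0, (2, 1, 0), (2, -1, -1)),
  ((13, 0, 13), 0, -3, (1, 1, 1), (1, -1, 0)), ((10, 1, 17), 1, 2, (1, 0, 1), (2, -1, -1)),
  ((17, 0, 17), 2, -3, (1, 1, 1), (2, 0, 0)), ((2, 1, 25), 0, -4, (1, 0, 0), (0, 1, 1)),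
  ((5, 2, 25), 0, -4, (0, 0, 1), (-1, -2, 1)), ((13, 6, 25), 2, -2, (1, 0, 1), (2, -2, 1)),
  ((17, 8, 25), 0, -4, (2, 0, 1), (0, 1, 1)), ((25, 11, 26), 4, 0, (1, 0, 1), (3, 2, 0)),
  ((10, 1, 29), 1, -3, (1, 0, 1), (-2, -2, 2)), ((13, 4, 29), 0, -4, (1, 1, 1), (1, -2, 1)),
  ((29, 0, 29), 0, -3, (3, 0, 1), (2, 2, -2)), ((5, 1, 34), 0, -1, (0, 0, 1), (4, 2, -1)),
  ((17, 7, 34), 0, -4, (2, 0, 1), (-1, -2, 2)), ((25, 3, 34), 1, 1, (1, -1, 2), (-2, 3, 1)),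
  ((10, 3, 37), 0, 0, (2, 1, 0), (-1, -1, 3)), ((26, 11, 37), 3, 1, (2, 0, 1), (4, 2, -2)),
  ((13, 2, 41), 2, 3, (1, 0, 1), (0, -4, 0))]

/-- Representations by the ternary lattice with the parameters `(1, 1, 5)`. -/
def cover115TernaryB : List TernaryRep := [
  ((1, 0, 49), 1, 0, (0, 0, 0), (1, -1, 3)), ((17, 3, 50), 2, -3, (1, 1, 1), (-1, -3, 3)),
  ((10, 1, 53), 0, -4, (2, 1, 0), (2, 1, -3)), ((5, 1, 58), 0, -5, (0, 0, 1), (4, 2, -1)),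
  ((2, 1, 61), 0, -4, (1, 0, 0), (0, 4, 1)), ((13, 2, 65), 0, -3, (1, 1, 1), (1, -5, 2)),
  ((5, 2, 73), 0, -8, (0, 0, 1), (-1, -2, 1)), ((2, 1, 85), 0, -6, (1, 0, 0), (-1, 1, 3)),
  ((10, 3, 85), 0, -6, (2, 1, 0), (-2, 1, 3)), ((5, 1, 106), 0, -4, (0, 0, 1), (-2, -7, 2)),
  ((1, 0, 121), 1, 0, (0, 0, 0), (7, 1, 1)), ((2, 1, 145), 0, -10, (1, 0, 0), (0, 4, 1)),
  ((5, 2, 169), 0, -9, (0, 0, 1), (-1, -7, 2)), ((2, 1, 181), 0, -12, (1, 0, 0), (-1, -1, 3)),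
  ((2, 1, 265), 0, -16, (1, 0, 0), (0, 1, 1)), ((1, 0, 361), 1, 0, (0, 0, 0), (2, 1, -9)),
  ((2, 1, 421), 0, -18, (1, 0, 0), (-1, 4, 3)), ((1, 0, 529), 1, 0, (0, 0, 0), (4, 1, 9))]

/-- Extensions of the basis of the ternary lattice with the parameters `(1, 1, 5)`. -/
def cover115OwnA : List ((ℤ × ℤ × ℤ × ℤ) × Reps) := [
  ((-1, -1, 2, 5), [(0, -1, -1, 2), (0, -5, -1, 4), (1, 0, 5, 4), (2, 0, 4, 11)], []),
  ((-1, -1, 2, 6), [(2, 1, 1, 1), (1, 0, 1, 5), (0, -1, -1, 7), (1, -1, 9, 6)], []),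
  ((1, -1, 1, 5), [(1, 0, -1, 2), (1, 1, 4, 3), (2, 0, 5, 4), (2, 0, 11, 4)], []),
  ((-1, -1, 2, 7), [(0, 0, -1, 2), (0, -3, 1, 4), (0, -3, -7, 2), (1, 1, 3, 10)], []),
  ((1, -1, 0, 5), [(0, 0, 2, 1), (1, 1, 5, 2), (2, 1, -8, 1), (4, 1, 1, 12)], []),
  ((1, -1, 2, 6), [(1, 0, -1, 2), (0, 1, 1, 5), (0, -1, -1, 7), (2, -1, 3, 10)], []),
  ((1, -1, 1, 6), [(0, 0, -1, 2), (0, 0, 5, 2), (0, -1, 7, 2), (-1, 0, -13, 2)], []),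
  ((0, 0, 1, 5), [(0, -1, -1, 2), (2, 0, 3, 4), (1, 1, 6, 3), (0, -1, -13, 2)], []),
  ((1, 0, 2, 6), [(1, 1, 1, 1), (-1, 1, 1, 5), (1, -1, -1, 7), (0, -1, 7, 8)], []),
  ((1, -1, 0, 6), [(0, 1, -1, 2), (1, 0, 1, 5), (0, 1, 1, 7), (0, 1, -13, 2)], []),
  ((1, -1, 2, 7), [(0, 0, -1, 2), (2, -1, 1, 4), (1, 1, 1, 6), (-1, 0, 3, 10)], []),
  ((0, 0, 0, 5), [(0, 0, 2, 1), (2, 0, -6, 1), (2, -1, 7, 2), (1, 0, -13, 2)], [])]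

/-- Extensions of the basis of the ternary lattice with the parameters `(1, 1, 5)`. -/
def cover115OwnB : List ((ℤ × ℤ × ℤ × ℤ) × Reps) := [
  ((1, 0, 0, 6), [(-1, 0, 1, 2), (1, 0, 1, 5), (-1, 0, -1, 7), (-1, 0, 13, 2)], []),
  ((1, -1, 1, 7), [(0, 1, -1, 2), (0, -1, 5, 2), (2, -1, -1, 6), (0, -2, 3, 10)], []),
  ((0, 0, 1, 6), [(0, 0, -1, 2), (1, 0, 1, 5), (0, -1, -1, 7), (1, -1, 3, 11)], []),
  ((1, 0, 2, 7), [(0, 0, -1, 2), (-1, 1, 0, 5), (-1, -1, 6, 3), (-1, 0, 3, 10)], []),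
  ((1, -1, 2, 8), [(1, 1, 1, 1), (1, -1, 1, 4), (3, -1, 1, 5), (1, 2, 1, 10)], []),
  ((1, 0, 0, 7), [(0, 3, 0, 1), (-1, 1, 0, 5), (2, -1, -1, 6), (-1, -1, 2, 11)], []),
  ((1, -1, 1, 8), [(2, -1, -1, 1), (2, 0, 1, 4), (-1, -1, -1, 6), (2, 3, 1, 10)], []),
  ((0, 0, 1, 7), [(3, 0, 0, 1), (9, 0, 0, 1), (1, 0, 5, 4), (3, 0, 12, 1)], []),
  ((1, -1, 2, 9), [(2, -1, 0, 1), (3, 0, -1, 4), (4, 1, 0, 5), (1, 0, -3, 10)], []),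
  ((0, 0, 0, 7), [(3, 0, 0, 1), (9, 0, 0, 1), (1, 0, 7, 2), (3, -1, -13, 2)], []),
  ((1, 0, 0, 8), [(0, 2, 1, 1), (3, 0, -1, 4), (-1, -1, -1, 6), (1, 2, 1, 10)], []),
  ((1, -1, 1, 9), [(0, 0, -2, 1), (1, 0, 1, 4), (1, -1, 2, 5), (2, 0, 5, 8)], [])]

/-- Extensions of the basis of the ternary lattice with the parameters `(1, 1, 5)`. -/
def cover115OwnC : List ((ℤ × ℤ × ℤ × ℤ) × Reps) := [
  ((1, 0, 2, 9), [(-1, 0, -2, 1), (0, 1, 1, 4), (-1, 2, 2, 5), (1, 0, -3, 10)], []),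
  ((1, -1, 0, 9), [(2, -1, 0, 1), (2, 0, -1, 4), (4, 1, 0, 5), (-1, 3, -1, 10)], []),
  ((1, -1, 2, 10), [(1, 0, 1, 1), (2, 0, -1, 4), (1, 0, 1, 5), (2, -1, -1, 9)], []),
  ((0, 0, 0, 8), [(2, 0, 1, 1), (1, 0, 5, 2), (2, 0, 7, 1), (1, 0, -3, 10)], []),
  ((1, 0, 0, 9), [(-1, 0, 2, 1), (2, 0, -1, 4), (1, 0, 5, 4), (4, 2, 0, 9)], []),
  ((1, -1, 1, 10), [(1, 1, 1, 1), (0, 1, 1, 4), (1, -1, 1, 5), (1, 1, 1, 9)], []),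
  ((0, 0, 1, 9), [(0, 0, -2, 1), (2, 0, 1, 4), (2, 0, -8, 1), (3, 1, 5, 8)], []),
  ((1, 0, 2, 10), [(1, 0, 1, 1), (2, 0, -1, 4), (1, 0, 1, 5), (2, 1, 3, 8)], []),
  ((0, 0, 0, 9), [(2, 2, 0, 1), (1, 1, -6, 1), (1, 1, 6, 3), (2, 2, 12, 1)], []),
  ((1, 0, 0, 10), [(1, 1, 1, 1), (0, 1, 1, 4), (1, 1, 7, 1), (1, 1, 1, 9)], []),
  ((0, 0, 1, 10), [(1, 1, 1, 1), (0, -2, -1, 4), (3, 0, 1, 5), (1, 1, 1, 9)], []),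
  ((1, 0, 2, 11), [(2, 1, 0, 1), (0, -1, -1, 4), (1, 1, 0, 5), (0, -1, 3, 8)], [])]

/-- Extensions of the basis of the ternary lattice with the parameters `(1, 1, 5)`. -/
def cover115OwnD : List ((ℤ × ℤ × ℤ × ℤ) × Reps) := [
  ((1, 0, 0, 11), [(2, 1, 0, 1), (0, 0, 5, 2), (1, 1, 0, 5), (0, 1, 5, 8)], []),
  ((1, -1, 1, 12), [(1, 0, 1, 1), (0, -1, -5, 2), (-1, 0, -1, 5), (-1, 0, 3, 8)], []),
  ((0, 0, 1, 11), [(1, 0, -2, 1), (1, 0, -6, 1), (1, -2, -2, 5), (3, 1, 3, 8)], []),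
  ((1, 0, 2, 12), [(0, 1, 1, 1), (0, 1, 5, 1), (0, -1, -1, 5), (0, -2, 5, 7)], []),
  ((1, -1, 0, 12), [(2, 0, -1, 1), (2, 0, 5, 1), (0, 2, -1, 5), (2, 0, -3, 8)], []),
  ((1, -1, 2, 13), [(2, 0, 0, 1), (0, 0, -6, 1), (-1, 0, 3, 4), (2, 0, -1, 8)], []),
  ((1, 0, 0, 12), [(2, 0, -1, 1), (2, 0, 5, 1), (-2, 0, 1, 5), (2, 0, -3, 8)], []),
  ((1, -1, 1, 13), [(2, 0, 0, 1), (4, 1, 0, 3), (0, -2, 3, 4), (0, 1, 1, 8)], []),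
  ((1, 0, 2, 13), [(2, 0, 0, 1), (0, 0, -6, 1), (-1, 0, 3, 4), (2, 0, -1, 8)], []),
  ((1, -1, 0, 13), [(2, 0, 0, 1), (4, 1, 0, 3), (2, 0, 3, 4), (0, 2, -3, 8)], []),
  ((1, -1, 2, 14), [(0, 1, 1, 1), (1, -2, 1, 3), (3, 1, 1, 4), (0, 2, -1, 8)], []),
  ((0, 0, 0, 12), [(1, 1, 1, 1), (1, 1, 3, 3), (1, 1, 7, 1), (2, 1, 3, 8)], [])]

/-- Extensions of the basis of the ternary lattice with the parameters `(1, 1, 5)`. -/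
def cover115OwnE : List ((ℤ × ℤ × ℤ × ℤ) × Reps) := [
  ((1, 0, 0, 13), [(2, 0, 0, 1), (0, 1, -5, 2), (2, 0, 3, 4), (0, 1, 1, 8)], []),
  ((1, -1, 1, 14), [(2, 0, -1, 1), (1, -1, -3, 3), (4, -1, -1, 4), (-2, 0, 5, 7)], []),
  ((0, 0, 1, 13), [(1, 1, -2, 1), (0, -1, -5, 2), (1, 1, -8, 1), (7, 3, 2, 7)], []),
  ((1, 0, 2, 14), [(-1, 1, 1, 1), (3, -1, 3, 2), (-1, 1, 7, 1), (0, 1, -3, 8)], []),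
  ((1, -1, 0, 14), [(1, 0, 1, 1), (0, 1, -5, 2), (1, -1, 3, 4), (5, -2, -1, 7)], []),
  ((1, 0, 0, 14), [(1, 0, 1, 1), (1, 1, -3, 3), (0, 2, 3, 4), (3, 0, -5, 7)], []),
  ((0, 0, 1, 14), [(1, 0, 1, 1), (-1, -1, -3, 3), (0, -1, 3, 4), (0, -2, 13, 1)], []),
  ((1, 0, 2, 15), [(0, 1, -2, 1), (-1, -1, 2, 3), (2, 0, 1, 4), (0, 3, 2, 7)], []),
  ((1, -1, 2, 16), [(0, 0, 1, 1), (1, 1, 1, 3), (1, 0, 1, 4), (4, 0, -1, 7)], []),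
  ((1, -1, 1, 16), [(0, 1, 1, 1), (2, -1, -1, 3), (1, -1, 1, 4), (0, -3, -1, 7)], []),
  ((0, 0, 1, 15), [(2, 1, 0, 1), (4, 1, 0, 3), (3, 2, 1, 4), (7, 2, 0, 7)], []),
  ((1, 0, 2, 16), [(0, 0, 1, 1), (2, 1, 3, 2), (1, 0, 1, 4), (0, 3, 1, 7)], [])]

/-- Extensions of the basis of the ternary lattice with the parameters `(1, 1, 5)`. -/
def cover115OwnF : List ((ℤ × ℤ × ℤ × ℤ) × Reps) := [
  ((1, -1, 2, 17), [(1, -1, 0, 1), (1, -1, 0, 3), (0, 1, 1, 4), (0, -2, -2, 7)], []),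
  ((0, 0, 0, 15), [(2, 1, 0, 1), (4, 1, 0, 3), (1, -1, 3, 4), (7, 2, 0, 7)], []),
  ((1, 0, 0, 16), [(0, 1, 1, 1), (2, -1, -1, 3), (2, 0, 1, 4), (2, 2, 1, 7)], []),
  ((1, -1, 1, 17), [(1, -1, 0, 1), (1, -1, 0, 3), (2, 0, -1, 4), (-2, 2, 2, 7)], []),
  ((1, 0, 2, 17), [(0, 2, 0, 1), (1, 2, 0, 3), (-1, 1, 1, 4), (0, 2, 0, 7)], []),
  ((1, -1, 0, 17), [(1, -1, 0, 1), (1, -1, 0, 3), (1, 0, 1, 4), (0, 2, 2, 7)], []),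
  ((1, -1, 2, 18), [(0, -1, -1, 1), (2, 0, 3, 2), (0, -1, -1, 4), (-3, 0, -1, 7)], []),
  ((0, 0, 0, 16), [(1, 0, 1, 1), (2, 0, 5, 1), (3, 1, 1, 4), (4, 2, 1, 7)], []),
  ((1, 0, 0, 17), [(0, 2, 0, 1), (1, 2, 0, 3), (1, 0, 1, 4), (0, 2, 0, 7)], []),
  ((1, -1, 1, 18), [(0, 0, 1, 1), (-1, -1, -1, 3), (-1, 1, 1, 4), (0, 4, -1, 7)], []),
  ((0, 0, 1, 17), [(2, 0, 0, 1), (2, 2, 0, 3), (1, 0, 1, 4), (2, 0, 0, 7)], []),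
  ((1, 0, 2, 18), [(-1, 0, 1, 1), (2, 0, 3, 2), (1, -1, -1, 4), (-3, 0, -1, 7)], [])]

/-- Extensions of the basis of the ternary lattice with the parameters `(1, 1, 5)`. -/
def cover115OwnG : List ((ℤ × ℤ × ℤ × ℤ) × Reps) := [
  ((1, -1, 0, 18), [(1, 0, -1, 1), (3, 1, 3, 2), (0, 1, 1, 4), (-2, 3, -1, 7)], []),
  ((0, 0, 0, 17), [(2, 0, 0, 1), (2, 2, 0, 3), (2, 0, 1, 4), (2, 0, 0, 7)], []),
  ((1, 0, 0, 18), [(1, 0, -1, 1), (-1, -1, -1, 3), (-1, 0, -1, 4), (5, 1, 3, 6)], []),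
  ((0, 0, 1, 18), [(0, 0, 1, 1), (-1, -1, -1, 3), (0, -1, -1, 4), (-1, -1, -7, 6)], []),
  ((1, 0, 2, 19), [(1, 1, 0, 1), (-1, 1, 0, 3), (-1, 0, -1, 4), (2, -1, 3, 6)], []),
  ((1, 0, 0, 19), [(1, 1, 0, 1), (-1, 1, 0, 3), (5, -1, 2, 3), (4, 1, 3, 6)], []),
  ((1, -1, 1, 20), [(1, 0, -1, 1), (1, 0, 5, 1), (1, 0, -7, 2), (2, 1, 3, 6)], []),
  ((1, 0, 2, 20), [(0, -1, -1, 1), (1, 1, 3, 2), (2, -1, 3, 3), (4, 1, 1, 6)], []),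
  ((1, -1, 0, 20), [(0, 0, 1, 1), (1, 1, 5, 1), (1, 1, -5, 3), (5, -1, -1, 6)], []),
  ((1, -1, 2, 21), [(1, 0, 0, 1), (1, 1, 3, 2), (5, -2, 0, 3), (-2, 1, 3, 6)], []),
  ((1, 0, 0, 20), [(0, 0, 1, 1), (-2, 0, -5, 1), (6, 0, 5, 1), (1, 1, -5, 6)], []),
  ((1, -1, 1, 21), [(1, 0, 0, 1), (2, 0, 3, 2), (5, -2, 0, 3), (-1, -2, 3, 6)], [])]

/-- Extensions of the basis of the ternary lattice with the parameters `(1, 1, 5)`. -/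
def cover115OwnH : List ((ℤ × ℤ × ℤ × ℤ) × Reps) := [
  ((1, 0, 2, 21), [(1, 0, 0, 1), (0, 0, -5, 2), (0, -1, -7, 2), (1, 4, 1, 6)], []),
  ((1, -1, 0, 21), [(1, 0, 0, 1), (5, 0, 1, 2), (1, 1, 4, 3), (4, 1, 1, 6)], []),
  ((1, -1, 2, 22), [(1, 0, -1, 1), (1, 0, 3, 2), (2, 0, 5, 2), (4, -1, -3, 6)], []),
  ((0, 0, 0, 20), [(0, 0, 1, 1), (1, 1, 5, 1), (1, 1, -5, 3), (7, 1, 1, 6)], []),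
  ((1, 0, 0, 21), [(1, 0, 0, 1), (5, 0, 1, 2), (4, 0, 6, 1), (2, -1, 3, 6)], []),
  ((1, -1, 1, 22), [(0, 0, -1, 1), (1, 2, 3, 2), (4, -2, 1, 3), (2, -1, -3, 6)], []),
  ((0, 0, 1, 21), [(1, 1, 0, 1), (2, 1, 3, 2), (1, 0, -7, 2), (1, -1, 3, 6)], []),
  ((1, 0, 2, 22), [(1, 0, -1, 1), (1, 0, 3, 2), (1, -1, 3, 3), (1, 1, 1, 6)], []),
  ((1, -1, 0, 22), [(0, 1, -1, 1), (1, 3, 3, 2), (4, -1, -3, 3), (2, -1, -1, 6)], []),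
  ((0, 0, 0, 21), [(1, 1, 0, 1), (2, 2, 3, 2), (1, 1, 4, 3), (2, 2, 3, 6)], []),
  ((1, 0, 0, 22), [(-1, 0, 1, 1), (2, 1, 3, 2), (-1, 4, 3, 3), (1, 1, -3, 6)], []),
  ((0, 0, 1, 22), [(0, 0, -1, 1), (1, 0, 5, 1), (2, 1, 3, 3), (1, 1, -5, 6)], [])]

/-- Extensions of the basis of the ternary lattice with the parameters `(1, 1, 5)`. -/
def cover115OwnI : List ((ℤ × ℤ × ℤ × ℤ) × Reps) := [
  ((1, 0, 2, 23), [(0, 1, 0, 1), (0, 1, 3, 2), (5, 1, 0, 3), (2, -1, -1, 6)], []),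
  ((1, -1, 2, 24), [(0, 0, -1, 1), (0, 1, 3, 2), (-1, 1, 3, 3), (2, 1, -3, 6)], []),
  ((1, 0, 0, 23), [(0, 1, 0, 1), (1, 2, 3, 2), (5, 1, 0, 3), (-2, -1, 3, 6)], []),
  ((1, -1, 1, 24), [(0, 1, -1, 1), (1, 1, 3, 2), (4, 1, 1, 3), (-1, 2, -3, 6)], []),
  ((0, 0, 1, 23), [(1, 0, 0, 1), (2, 0, 3, 2), (2, 0, -7, 2), (1, -1, -3, 6)], []),
  ((1, 0, 2, 24), [(0, 0, -1, 1), (0, 0, 5, 1), (1, 1, 5, 2), (-1, -1, -1, 6)], []),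
  ((1, -1, 2, 25), [(0, 0, 0, 1), (0, 0, 3, 2), (4, -1, 0, 3), (-1, 2, -3, 6)], []),
  ((0, 0, 0, 23), [(1, 0, 0, 1), (3, -1, 3, 2), (2, -1, -4, 3), (1, 1, 1, 6)], []),
  ((1, -1, 1, 25), [(0, 0, 0, 1), (1, 0, 3, 2), (4, -1, 0, 3), (0, 1, -8, 5)], []),
  ((1, 0, 2, 25), [(0, 0, 0, 1), (0, 0, 3, 2), (4, 2, 0, 3), (6, 0, 2, 5)], []),
  ((1, -1, 0, 25), [(0, 0, 0, 1), (1, 2, 3, 2), (4, -1, 0, 3), (7, 0, 2, 5)], []),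
  ((0, 0, 2, 25), [(0, 0, 0, 1), (0, 0, 3, 2), (1, 1, 5, 2), (4, -2, 4, 5)], [])]

/-- Extensions of the basis of the ternary lattice with the parameters `(1, 1, 5)`. -/
def cover115OwnJ : List ((ℤ × ℤ × ℤ × ℤ) × Reps) := [
  ((1, 0, 0, 25), [(0, 0, 0, 1), (2, -1, 3, 2), (4, 2, 0, 3), (7, 0, 2, 5)], []),
  ((0, 0, 1, 25), [(0, 0, 0, 1), (5, 0, 1, 2), (2, 2, 2, 3), (2, 0, -8, 5)], []),
  ((0, 0, 0, 25), [(0, 0, 0, 1), (5, 1, 1, 2), (4, 4, 0, 3), (9, -1, 2, 5)], [])]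

/-- Lattices that contain the ternary lattice with the parameters `(1, 1, 5)`. -/
def cover115OthersA : List (Param × Basis3 × Reps) := [
  (((1, 1, 2), (0, 0, 0, 3)), ((1, 0, 0, 0), (0, 1, 0, 0), (0, 0, 1, 1)), [(2, -1, 2, 1), (8, -1,
   2, 1), (10, 1, 3, 1), (19, 1, 1, 5)], []),
  (((1, 1, 2), (1, -1, 0, 5)), ((1, 0, 0, 0), (0, 1, 0, 0), (1, 0, 0, -1)), [(3, 0, -1, 1), (3, 0,
   -1, 5), (2, 1, 2, 7), (6, 0, 2, 11)], []),
  (((0, 1, 2), (1, 1, 0, 5)), ((1, 0, 0, 0), (0, 1, 0, 0), (0, 0, 0, 1)), [(2, 1, 1, 1), (2, 1, 1,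
   5), (2, 0, 2, 7), (-2, 1, 2, 13)], []),
  (((0, 0, 2), (0, 1, 1, 5)), ((0, 1, 0, 0), (0, 0, 1, 0), (0, 0, 0, 1)), [(2, 2, 0, 1), (4, 1, 0,
   5), (2, 2, 0, 7), (2, 6, 1, 11)], []),
  (((1, 1, 3), (1, -1, 1, 5)), ((1, 0, 0, 0), (0, 1, 0, 0), (1, 0, 0, -1)), [(0, 1, 2, 1), (1, 1,
   2, 5), (3, -1, 4, 5), (5, 0, 2, 11)], []),
  (((1, 1, 3), (1, -1, 0, 5)), ((1, 0, 0, 0), (0, 1, 0, 0), (1, 0, 0, -1)), [(1, 0, 2, 1), (2, 1,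
   2, 5), (1, -1, 2, 7), (1, 3, 2, 13)], []),
  (((0, 0, 3), (1, 1, 0, 5)), ((1, 0, 0, 0), (0, 1, 0, 0), (0, 0, 0, 1)), [(1, 1, 2, 1), (1, 1, 6,
   3), (1, 1, 2, 7), (1, -2, 2, 13)], []),
  (((1, 1, 4), (1, -1, 2, 5)), ((1, 0, 0, 0), (0, 1, 0, 0), (1, 0, 0, -1)), [(-1, 0, 2, 1), (-1,
   0, 2, 5), (1, 0, 4, 5), (3, 0, -2, 13)], []),
  (((1, 1, 4), (1, -1, 0, 5)), ((1, 0, 0, 0), (0, 1, 0, 0), (1, 0, 0, -1)), [(2, 0, 1, 1), (8, 0,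
   1, 1), (2, 0, 1, 7), (0, 1, 2, 13)], []),
  (((1, 1, 4), (1, -1, 1, 5)), ((1, 0, 0, 0), (0, 1, 0, 0), (1, 0, 0, -1)), [(0, 0, 2, 1), (0, -1,
   2, 5), (0, 0, 2, 7), (0, -1, -2, 13)], []),
  (((0, 1, 4), (1, 1, 2, 5)), ((1, 0, 0, 0), (0, 1, 0, 0), (0, 0, 0, 1)), [(2, 0, 1, 1), (0, -1,
   2, 5), (0, 1, 4, 5), (1, 0, 11, 5)], []),
  (((0, 1, 4), (1, 1, 0, 5)), ((1, 0, 0, 0), (0, 1, 0, 0), (0, 0, 0, 1)), [(1, 0, 2, 1), (2, 0, 2,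
   5), (0, 2, 1, 7), (0, -1, -2, 13)], [])]

/-- Lattices that contain the ternary lattice with the parameters `(1, 1, 5)`. -/
def cover115OthersB : List (Param × Basis3 × Reps) := [
  (((0, 0, 4), (1, 1, 0, 5)), ((1, 0, 0, 0), (0, 1, 0, 0), (0, 0, 0, 1)), [(1, 0, 2, 1), (2, 1, 1,
   5), (3, 1, 8, 1), (7, -1, 1, 11)], []),
  (((0, 0, 4), (1, 1, 2, 5)), ((1, 0, 0, 0), (0, 1, 0, 0), (0, 0, 0, 1)), [(2, 0, 1, 1), (2, -1,
   1, 5), (2, 1, 6, 3), (1, 0, 11, 5)], [])]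

/-- The certificate for the ternary lattice with the parameters `(1, 1, 5)`. -/
def cover115 : Cover where
  a := (1, 1, 5)
  ternary := cover115TernaryA ++ cover115TernaryB
  squares := [25, 169, 289, 841]
  forms := []
  own := cover115OwnA ++ cover115OwnB ++ cover115OwnC ++ cover115OwnD ++ cover115OwnE ++
   cover115OwnF ++ cover115OwnG ++ cover115OwnH ++ cover115OwnI ++ cover115OwnJ
  others := cover115OthersA ++ cover115OthersB

/-- The certificates for the entries of the table. -/
def covers : List Cover := [cover012, cover013, cover014, cover114, cover015, cover115]

/-- The representations are verified by substituting the listed vectors, without any search. -/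
theorem covers_correct : ∀ G ∈ covers,
    G.ternaryCorrect = true ∧ G.latticesCorrect = true ∧ G.isComplete = true := by decide +kernel

/-- Is there a certificate for the parameters? -/
def isCovered (c : Param) : Bool := covers.any fun G => G.lattices.any fun d => d.1 == c

theorem tableParams_isCovered : ∀ c ∈ tableParams, isCovered c = true := by decide +kernel

/-- The entries of the table represent all proper sublattices of `I2` of index at most `29`, but not
`I2`. -/
theorem isCandidate_of_mem_tableGrams {M : Matrix (Fin 5) (Fin 5) ℤ} (hM : M ∈ tableGrams) :
    IsCandidate 29 M := by
  rw [tableGrams_eq] at hM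
  obtain ⟨c, hc, rfl⟩ := List.mem_map.1 hM
  obtain ⟨h3, h4⟩ := tableParams_disc c hc
  refine ⟨isForm_gram h3 h4, fun S h1 h2 => ?_, fun h => ?_⟩
  · obtain ⟨P, hP, hPS⟩ := exists_primeSublattice h1 h2
    have hcov := tableParams_isCovered c hc
    simp only [isCovered, List.any_eq_true, beq_iff_eq] at hcov
    obtain ⟨G, hG, d, hd, rfl⟩ := hcov
    obtain ⟨hG1, hG2, hG3⟩ := covers_correct G hG
    -- From the entry to the reduced form, to the sublattice of prime index, to the given
    -- sublattice.
    exact ((Cover.represents hG1 hG2 hd (List.all_eq_true.1 hG3 P hP)).trans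
      (represents_gaussReduce _ _)).trans hPS
  · rw [I2_eq_binary, ← reps_iff h3 h4, tableParams_reps_eq_false c hc] at h
    exact Bool.false_ne_true h

end QuadIsolation
namespace QuadIsolation

open Matrix

/-! ### Isolations are candidates -/

/-- A base change has determinant `±1`, which enters squared. -/
theorem Isometric.det_eq {n : ℕ} {f g : Matrix (Fin n) (Fin n) ℤ} (h : Isometric f g) :
    f.det = g.det := by
  obtain ⟨T, S, hTS, -, rfl⟩ := h
  have h1 : T.det * T.det = 1 := by
    have h2 : IsUnit T.det := IsUnit.of_mul_eq_one S.det (by rw [← det_mul, hTS, det_one])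
    rcases Int.isUnit_iff.1 h2 with h | h <;> simp [h]
  rw [det_mul, det_mul, det_transpose, mul_right_comm, h1, one_mul]

theorem isForm_transpose_mul_mul {n : ℕ} {f S : Matrix (Fin n) (Fin n) ℤ} (hf : IsForm f)
    (hS : S.det ≠ 0) : IsForm (Sᵀ * f * S) := by
  have hinj : Function.Injective (S.map (Int.cast : ℤ → ℝ)).mulVec := by
    rw [Matrix.mulVec_injective_iff_isUnit, Matrix.isUnit_iff_isUnit_det, isUnit_iff_ne_zero]
    have : (S.map (Int.cast : ℤ → ℝ)).det = (S.det : ℝ) := (Int.cast_det S).symm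
    rw [this]
    exact_mod_cast hS
  have h := Matrix.PosDef.conjTranspose_mul_mul_same hf hinj
  have e : (Sᵀ * f * S).map (Int.cast : ℤ → ℝ) =
      (S.map (Int.cast : ℤ → ℝ))ᴴ * f.map (Int.cast : ℤ → ℝ) * S.map (Int.cast : ℤ → ℝ) := by
    ext i j
    simp [Matrix.mul_apply]
  rw [IsForm, e]
  exact h

theorem isForm_I2 : IsForm I2 := by
  have : I2.map (Int.cast : ℤ → ℝ) = 1 := by
    rw [I2, Matrix.map_one _ Int.cast_zero Int.cast_one]
  rw [IsForm, this]
  exact Matrix.PosDef.one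

/-- The Gram matrix of a sublattice has determinant `(det S) ^ 2`. For index greater than 1 this is
not 1, so the sublattice is a proper subform of `I2`. -/
theorem IsIsolation.isCandidate {k : ℕ} {L : Matrix (Fin k) (Fin k) ℤ} (hL : IsIsolation L I2)
    (N : ℕ) : IsCandidate N L := by
  refine ⟨hL.1, fun S h1 _ => hL.2.1 2 _ ⟨isForm_transpose_mul_mul isForm_I2 ?_, ⟨S, rfl⟩,
    fun h => ?_⟩, hL.2.2⟩
  · rintro h
    simp [h] at h1
  · have h2 := h.det_eq
    rw [I2, mul_one, det_one, det_mul, det_transpose] at h2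
    rcases Int.isUnit_iff.1 (IsUnit.of_mul_eq_one S.det h2.symm) with h | h <;> simp [h] at h1

/-- The table consists exactly of the quinary forms that represent all proper sublattices of `I2` of
index at most `29`, but not `I2`. -/
theorem isCandidate_iff {L : Matrix (Fin 5) (Fin 5) ℤ} :
    IsCandidate 29 L ↔ ∃ M ∈ tableGrams, Isometric L M :=
  ⟨IsCandidate.exists_isometric, fun ⟨_, hM, h⟩ =>
    (isCandidate_of_mem_tableGrams hM).of_isometric h.symm⟩

/-! ### The entries of the table are pairwise non-isometric -/

theorem det_gram (c : Param) : (gram c.1 c.2).det = disc4 c := by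
  simp [gram, det_succ_row_zero, Fin.sum_univ_succ, Fin.succAbove, disc4, disc3, last, mix]
  ring

/-- Do the determinants or the representations of some small binary forms differ? -/
def isSeparated (c d : Param) : Bool :=
  !(disc4 c == disc4 d) ||
    ([(1, 0, 3), (1, 0, 23), (1, 0, 30), (1, 0, 6), (1, 0, 27), (1, 0, 7), (1, 0, 15),
      (2, 1, 4)] : List (ℤ × ℤ × ℤ)).any fun g => reps c g ^^ reps d g

/-- Eight binary forms are enough to tell apart the entries with equal determinant. -/
theorem tableParams_pairwise : tableParams.Pairwise fun c d => isSeparated c d = true := by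
  decide +kernel

theorem not_isometric_of_isSeparated {c d : Param} (hc : 0 < disc3 c.1 ∧ 0 < disc4 c)
    (hd : 0 < disc3 d.1 ∧ 0 < disc4 d) (h : isSeparated c d = true) :
    ¬ Isometric (gram c.1 c.2) (gram d.1 d.2) := by
  intro hcd
  have hdet := hcd.det_eq
  rw [det_gram, det_gram] at hdet
  simp only [isSeparated, hdet, beq_self_eq_true, Bool.not_true, Bool.false_or,
    List.any_eq_true] at h
  obtain ⟨g, -, hg⟩ := h
  have hiff : reps c g = reps d g :=
    Bool.eq_iff_iff.2 ((reps_iff hc.1 hc.2).trans (hcd.represents_iff.trans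
      (reps_iff hd.1 hd.2).symm))
  simp [hiff] at hg

/-- The isometry class of a form. -/
def isometryClass {n : ℕ} (M : Matrix (Fin n) (Fin n) ℤ) (hM : IsForm M) : IsometryClass n :=
  Quotient.mk (isometrySetoid n) ⟨M, hM⟩

/-- The isometry classes of the entries of the table. -/
def tableClasses : List (IsometryClass 5) :=
  tableParams.pmap (fun c hc => isometryClass (gram c.1 c.2) hc)
    fun c hc => isForm_gram (tableParams_disc c hc).1 (tableParams_disc c hc).2

theorem tableParams_length : tableParams.length = 231 := by decide +kernel

theorem tableClasses_length : tableClasses.length = 231 := by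
  rw [tableClasses, List.length_pmap, tableParams_length]

theorem tableClasses_nodup : tableClasses.Nodup := by
  -- Positivity is carried along with the separation because `reps_iff` requires it.
  refine List.Pairwise.pmap (R := fun c d => (0 < disc3 c.1 ∧ 0 < disc4 c) ∧
    (0 < disc3 d.1 ∧ 0 < disc4 d) ∧ isSeparated c d = true) ?_ _ ?_
  · exact tableParams_pairwise.imp_of_mem fun hc hd h =>
      ⟨tableParams_disc _ hc, tableParams_disc _ hd, h⟩
  · rintro c hc d hd ⟨h1, h2, h3⟩ h
    exact not_isometric_of_isSeparated h1 h2 h3 (Quotient.exact h)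

theorem classesOf_isCandidate :
    classesOf (n := 5) (IsCandidate 29) = {x | x ∈ tableClasses} := by
  ext x
  simp only [classesOf, Set.mem_ofPred_eq, tableClasses, List.mem_pmap]
  constructor
  · rintro ⟨f, hf, rfl⟩
    obtain ⟨M, hM, h⟩ := isCandidate_iff.1 hf
    rw [tableGrams_eq] at hM
    obtain ⟨c, hc, rfl⟩ := List.mem_map.1 hM
    exact ⟨c, hc, Quotient.sound h.symm⟩
  · rintro ⟨c, hc, rfl⟩
    have hmem : gram c.1 c.2 ∈ tableGrams := by
      rw [tableGrams_eq]
      exact List.mem_map.2 ⟨c, hc, rfl⟩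
    exact ⟨_, isCandidate_of_mem_tableGrams hmem, rfl⟩

theorem encard_classesOf_isCandidate : (classesOf (n := 5) (IsCandidate 29)).encard = 231 := by
  classical
  have h : {x | x ∈ tableClasses} = (tableClasses.toFinset : Set (IsometryClass 5)) := by
    ext x
    simp
  rw [classesOf_isCandidate, h, Set.encard_coe_eq_coe_finsetCard,
    List.toFinset_card_of_nodup tableClasses_nodup, tableClasses_length]
  rfl

end QuadIsolation
-- The main theorem
theorem mainTheorem1 :
    -- the table has 231 entries, all of them integral positive definite forms
    QuadIsolation.tableGrams.length = 231 ∧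
    (∀ M ∈ QuadIsolation.tableGrams, QuadIsolation.IsForm M) ∧
    -- every quinary isolation of `I2` is isometric to an entry of the table
    (∀ L : Matrix (Fin 5) (Fin 5) ℤ, QuadIsolation.IsIsolation L QuadIsolation.I2 →
      ∃ M ∈ QuadIsolation.tableGrams, QuadIsolation.Isometric L M) ∧
    -- up to isometry there are at most 231 quinary isolations of `I2`
    (QuadIsolation.classesOf (n := 5)
      (fun L => QuadIsolation.IsIsolation L QuadIsolation.I2)).encard ≤ 231 ∧
    -- the table consists exactly of the quinary forms that represent all proper sublattices of
    -- `I2` of index at most 29, but not `I2`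
    (∀ L : Matrix (Fin 5) (Fin 5) ℤ, QuadIsolation.IsCandidate 29 L ↔
      ∃ M ∈ QuadIsolation.tableGrams, QuadIsolation.Isometric L M) ∧
    -- up to isometry there are exactly 231 such forms
    (QuadIsolation.classesOf (n := 5) (QuadIsolation.IsCandidate 29)).encard = 231 := by
  refine ⟨?_, fun M hM => (QuadIsolation.isCandidate_of_mem_tableGrams hM).1,
    fun L hL => (hL.isCandidate 29).exists_isometric, ?_,
    fun L => QuadIsolation.isCandidate_iff, QuadIsolation.encard_classesOf_isCandidate⟩
  · rw [QuadIsolation.tableGrams_eq, List.length_map, QuadIsolation.tableParams_length]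
  -- The classes of isolations form a subset of the 231 classes of candidates.
  · rw [← QuadIsolation.encard_classesOf_isCandidate]
    exact Set.encard_le_encard fun _ ⟨f, hf, h⟩ => ⟨f, hf.isCandidate 29, h⟩
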